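/- **Conventions.** Manifolds are smooth, finite-dimensional, Hausdorff, second countable and without boundary. A $\mathbb Z$-graded vector bundle $V=(V_d)_{d\in\mathbb Z}$ over a manifold $N$ is a family of smooth real vector bundles of finite rank over $N$; its dual has $(V^*)_d=(V_{-d})^*$, its shift has $V[i]_d=V_{i+d}$, and direct sums are taken over $N$, degree by degree. $\Gamma(S^{\ge 0}V^*)$ denotes the graded-commutative $\mathbb R$-algebra of finite sums of homogeneous smooth sections of the graded symmetric algebra bundle of $V^*$, where a section is smooth if it is locally a polynomial in smooth functions on $N$ and smooth sections of the bundles $(V^*)_d$. A $\mathbb Z$-graded manifold $\mathcal M$ is a $\mathbb Z$-graded, graded-commutative $\mathbb R$-algebra $C(\mathcal M)$ for which there exist a manifold $N$, a $\mathbb Z$-graded vector bundle $V$ over $N$ and an isomorphism of graded algebras $C(\mathcal M)\cong\Gamma(S^{\ge0}V^*)$. A morphism $\mathcal M\to\mathcal N$ is a degree-preserving algebra morphism $C(\mathcal N)\to C(\mathcal M)$, and $\hom(\mathcal M,\mathcal N)$ is the set of these. The split graded manifold $\mathfrak S(V)$ is given by $C(\mathfrak S(V))=\Gamma(S^{\ge0}V^*)$.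 An ordinary manifold $M$ is the graded manifold with $C(M)=C^\infty(M)$ in degree $0$. Let $D=\mathbb R[-1]$, that is, $C(D)=\mathbb R[\varepsilon]/(\varepsilon^2)$ with $\varepsilon$ of degree $-1$, and let $D^{\times k}$ be its $k$-fold product, with $C(D^{\times k})=C(D)^{\otimes k}$. For a graded manifold $T$ put $C(D^{\times k}\times T)=C(D^{\times k})\otimes C(T)$; all tensor products of algebras carry the Koszul sign rule $(a\otimes b)(a'\otimes b')=(-1)^{|b||a'|}aa'\otimes bb'$. For a manifold $M$, let $T[1]^kM:=\mathrm{Hom}(D^{\times k},M)$ be the presheaf on the category of $\mathbb Z$-graded manifolds $$T\longmapsto \hom(D^{\times k}\times T,\,M),$$ with a morphism $f$ of graded manifolds acting by precomposition with $\mathrm{id}_{D^{\times k}}\times f$. It is representable if it is naturally isomorphic to $\hom(-,X)$ for some graded manifold $X$. For $i\ge 1$ write $T[i]M$ for the graded vector bundle over $M$ that is the tangent bundle $TM$ placed in degree $-i$. **Statement.** Let $M$ be a manifold with a fixed smooth connection on $T^*M$, and let $k\ge 0$. Then the presheaf $T[1]^kM=\mathrm{Hom}(D^{\times k},M)$ is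 representable, and there is a natural isomorphism of presheaves $$T[1]^kM\;\cong\;\hom\Big(-,\ \mathfrak S\Big(\bigoplus_{i=1}^{k}T[i]M^{\oplus\binom{k}{i}}\Big)\Big).$$ That is, $T[1]^kM$ is represented by the split graded manifold of the graded vector bundle over $M$ whose component in degree $-i$ is the direct sum of $\binom ki$ copies of $TM$, for $1\le i\le k$, and whose other components vanish. -/

import Mathlib

open scoped Manifold ContDiff Topology DirectSum TensorProduct
open CategoryTheory

universe u v w

noncomputable section

theorem units_smul_mem {R M : Type*} [Ring R] [AddCommGroup M] [Module R M] (p : Submodule R M)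
    (e : ℤˣ) {x : M} (hx : x ∈ p) : e • x ∈ p := by
  rcases Int.units_eq_one_or e with rfl | rfl
  · simpa using hx
  · simpa [Units.smul_def] using hx

theorem units_smul_of {ι : Type*} [DecidableEq ι] {M : ι → Type*} [∀ i, AddCommGroup (M i)]
    (e : ℤˣ) (i : ι) (x : M i) :
    e • DirectSum.of M i x = DirectSum.of M i (e • x) := by
  rcases Int.units_eq_one_or e with rfl | rfl
  · simp
  · simp [Units.smul_def]

theorem units_smul_coe {R M : Type*} [Ring R] [AddCommGroup M] [Module R M] (p : Submodule R M)
    (e : ℤˣ) (x : p) : ((e • x : p) : M) = e • (x : M) := by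
  rcases Int.units_eq_one_or e with rfl | rfl
  · simp
  · simp [Units.smul_def]

namespace GradedTensor
variable {R A B : Type*} [CommRing R] [Ring A] [Ring B] [Algebra R A] [Algebra R B]
  (𝒜 : ℤ → Submodule R A) (ℬ : ℤ → Submodule R B) [GradedAlgebra 𝒜] [GradedAlgebra ℬ]

/-- The degree `n` part of the tensor product of two ℤ-graded algebras. The multiplication of
`𝒜 ᵍ⊗[R] ℬ` is `(a ⊗ b) (a' ⊗ b') = (-1) ^ (|b| |a'|) (a a' ⊗ b b')`. -/
def totalGr (n : ℤ) : @Submodule R (𝒜 ᵍ⊗[R] ℬ) _ _ Algebra.toModule :=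
  Submodule.span R {x | ∃ (i j : ℤ) (a : A) (b : B),
    i + j = n ∧ a ∈ 𝒜 i ∧ b ∈ ℬ j ∧ x = a ᵍ⊗ₜ[R] b}

variable {𝒜 ℬ} in
theorem tmul_mem {i j : ℤ} {a : A} {b : B} (ha : a ∈ 𝒜 i)
    (hb : b ∈ ℬ j) : (a ᵍ⊗ₜ[R] b : 𝒜 ᵍ⊗[R] ℬ) ∈ totalGr 𝒜 ℬ (i + j) :=
  Submodule.subset_span ⟨i, j, a, b, rfl, ha, hb, rfl⟩

theorem left_mem {i : ℤ} {a : A} (ha : a ∈ 𝒜 i) :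
    (a ᵍ⊗ₜ[R] 1 : 𝒜 ᵍ⊗[R] ℬ) ∈ totalGr 𝒜 ℬ i := by
  simpa using tmul_mem ha (SetLike.one_mem_graded ℬ)

theorem right_mem {i : ℤ} {b : B} (hb : b ∈ ℬ i) :
    (1 ᵍ⊗ₜ[R] b : 𝒜 ᵍ⊗[R] ℬ) ∈ totalGr 𝒜 ℬ i := by
  simpa using tmul_mem (SetLike.one_mem_graded 𝒜) hb

variable {𝒜 ℬ} in
theorem tmul_mul_tmul {j k : ℤ} (a : A) {b : B} {a' : A}
    (b' : B) (hb : b ∈ ℬ j) (ha' : a' ∈ 𝒜 k) :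
    (a ᵍ⊗ₜ[R] b * a' ᵍ⊗ₜ[R] b' : 𝒜 ᵍ⊗[R] ℬ) =
      (-1 : ℤˣ) ^ (j * k) • ((a * a') ᵍ⊗ₜ[R] (b * b')) :=
  GradedTensorProduct.tmul_coe_mul_coe_tmul 𝒜 ℬ a ⟨b, hb⟩ ⟨a', ha'⟩ b'

instance totalGr_gradedMonoid : SetLike.GradedMonoid (totalGr 𝒜 ℬ) where
  one_mem := Submodule.subset_span
    ⟨0, 0, 1, 1, rfl, SetLike.one_mem_graded _, SetLike.one_mem_graded _, rfl⟩
  mul_mem m n x y hx hy := by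
    induction hx using Submodule.span_induction with
    | zero => simp
    | add x x' _ _ h h' => rw [add_mul]; exact add_mem h h'
    | smul c x _ h => rw [smul_mul_assoc]; exact Submodule.smul_mem _ _ h
    | mem x hx =>
      obtain ⟨i, j, a, b, rfl, ha, hb, rfl⟩ := hx
      induction hy using Submodule.span_induction with
      | zero => simp
      | add x x' _ _ h h' => rw [mul_add]; exact add_mem h h'
      | smul c x _ h => rw [mul_smul_comm]; exact Submodule.smul_mem _ _ h
      | mem y hy =>
        obtain ⟨i', j', a', b', rfl, ha', hb', rfl⟩ := hy
        rw [tmul_mul_tmul a b' hb ha']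
        apply units_smul_mem
        have := tmul_mem (SetLike.mul_mem_graded ha ha') (SetLike.mul_mem_graded hb hb')
        rwa [show i + i' + (j + j') = i + j + (i' + j') by ring] at this

theorem totalGr_comm (hA : ∀ (i j : ℤ) (a b : A), a ∈ 𝒜 i → b ∈ 𝒜 j →
      a * b = (-1 : ℤˣ) ^ (i * j) • (b * a))
    (hB : ∀ (i j : ℤ) (a b : B), a ∈ ℬ i → b ∈ ℬ j → a * b = (-1 : ℤˣ) ^ (i * j) • (b * a))
    (m n : ℤ) (x y : 𝒜 ᵍ⊗[R] ℬ) (hx : x ∈ totalGr 𝒜 ℬ m)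
    (hy : y ∈ totalGr 𝒜 ℬ n) : x * y = (-1 : ℤˣ) ^ (m * n) • (y * x) := by
  induction hx using Submodule.span_induction with
  | zero => simp
  | add x x' _ _ h h' => rw [add_mul, h, h', mul_add, smul_add]
  | smul c x _ h => rw [smul_mul_assoc, h, mul_smul_comm, smul_comm]
  | mem x hx =>
    obtain ⟨i, j, a, b, rfl, ha, hb, rfl⟩ := hx
    induction hy using Submodule.span_induction with
    | zero => simp
    | add x x' _ _ h h' => rw [mul_add, h, h', add_mul _ _ (a ᵍ⊗ₜ[R] b), smul_add]
    | smul c x _ h => rw [mul_smul_comm, h, smul_mul_assoc, smul_comm]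
    | mem y hy =>
      obtain ⟨i', j', a', b', rfl, ha', hb', rfl⟩ := hy
      rw [tmul_mul_tmul a b' hb ha', tmul_mul_tmul a' b hb' ha, hA i i' a a' ha ha',
        hB j j' b b' hb hb']
      have e1 : ∀ (e f : ℤˣ) (s : A) (t : B),
          ((e • s) ᵍ⊗ₜ[R] (f • t) : 𝒜 ᵍ⊗[R] ℬ) = (e * f) • (s ᵍ⊗ₜ[R] t) := by
        intro e f s t
        have h1 : ((-s) ᵍ⊗ₜ[R] t : 𝒜 ᵍ⊗[R] ℬ) = -(s ᵍ⊗ₜ[R] t) :=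
          congrArg (GradedTensorProduct.of R 𝒜 ℬ) (TensorProduct.neg_tmul s t)
        have h2 : (s ᵍ⊗ₜ[R] (-t) : 𝒜 ᵍ⊗[R] ℬ) = -(s ᵍ⊗ₜ[R] t) :=
          congrArg (GradedTensorProduct.of R 𝒜 ℬ) (TensorProduct.tmul_neg s t)
        have h3 : ((-s) ᵍ⊗ₜ[R] (-t) : 𝒜 ᵍ⊗[R] ℬ) = s ᵍ⊗ₜ[R] t :=
          congrArg (GradedTensorProduct.of R 𝒜 ℬ)
            ((TensorProduct.neg_tmul s (-t)).trans (by rw [TensorProduct.tmul_neg, neg_neg]))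
        rcases Int.units_eq_one_or e with rfl | rfl <;>
          rcases Int.units_eq_one_or f with rfl | rfl <;>
          simp only [Units.smul_def, Units.val_one, Units.val_neg, one_smul, neg_smul,
            mul_one, neg_neg, h1, h2, h3, mul_neg]
      rw [e1, smul_smul, smul_smul]
      congr 1
      rw [← uzpow_add, ← uzpow_add, ← uzpow_add]
      have e2 : (i + j) * (i' + j') + j' * i = (j * i' + (i * i' + j * j')) + 2 * (i * j') := by
        ring
      rw [e2, uzpow_add _ _ (2 * (i * j'))]
      have e3 : (-1 : ℤˣ) ^ (2 * (i * j')) = 1 := by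
        rw [two_mul, uzpow_add, Int.units_mul_self]
      rw [e3, mul_one]

/-- The inclusion `a ↦ a ⊗ 1`, with values in the direct sum of the graded pieces. -/
def leftHom : A →ₐ[R] ⨁ n, totalGr 𝒜 ℬ n :=
  (DirectSum.toAlgebra R (fun i => 𝒜 i)
    (fun i => (DirectSum.lof R ℤ (fun n => totalGr 𝒜 ℬ n) i).comp
      (LinearMap.codRestrict (totalGr 𝒜 ℬ i) ((GradedTensorProduct.includeLeft 𝒜 ℬ).toLinearMap.comp
        (𝒜 i).subtype) (fun a => left_mem 𝒜 ℬ a.2)))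
    rfl
    (fun {i j} x y => by
      simp only [LinearMap.comp_apply, DirectSum.lof_eq_of, DirectSum.of_mul_of]
      apply DirectSum.of_eq_of_gradedMonoid_eq
      refine Sigma.subtype_ext rfl ?_
      exact map_mul (GradedTensorProduct.includeLeft 𝒜 ℬ) x.1 y.1)).comp
  (DirectSum.decomposeAlgEquiv 𝒜).toAlgHom

/-- The inclusion `b ↦ 1 ⊗ b`, with values in the direct sum of the graded pieces. -/
def rightHom : B →ₐ[R] ⨁ n, totalGr 𝒜 ℬ n :=
  (DirectSum.toAlgebra R (fun i => ℬ i)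
    (fun i => (DirectSum.lof R ℤ (fun n => totalGr 𝒜 ℬ n) i).comp
      (LinearMap.codRestrict (totalGr 𝒜 ℬ i)
        ((GradedTensorProduct.includeRight 𝒜 ℬ).toLinearMap.comp
        (ℬ i).subtype) (fun a => right_mem 𝒜 ℬ a.2)))
    rfl
    (fun {i j} x y => by
      simp only [LinearMap.comp_apply, DirectSum.lof_eq_of, DirectSum.of_mul_of]
      apply DirectSum.of_eq_of_gradedMonoid_eq
      refine Sigma.subtype_ext rfl ?_
      exact map_mul (GradedTensorProduct.includeRight 𝒜 ℬ) x.1 y.1)).comp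
  (DirectSum.decomposeAlgEquiv ℬ).toAlgHom

theorem leftHom_apply {i : ℤ} {a : A} (ha : a ∈ 𝒜 i) :
    leftHom 𝒜 ℬ a =
      DirectSum.of (fun n => totalGr 𝒜 ℬ n) i ⟨a ᵍ⊗ₜ[R] 1, left_mem 𝒜 ℬ ha⟩ := by
  lift a to 𝒜 i using ha
  simp only [leftHom, AlgHom.comp_apply]
  erw [DirectSum.decomposeAlgEquiv_apply]
  rw [DirectSum.decompose_coe]
  erw [DirectSum.toAddMonoid_of]
  rfl

theorem rightHom_apply {i : ℤ} {b : B} (hb : b ∈ ℬ i) :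
    rightHom 𝒜 ℬ b =
      DirectSum.of (fun n => totalGr 𝒜 ℬ n) i ⟨1 ᵍ⊗ₜ[R] b, right_mem 𝒜 ℬ hb⟩ := by
  lift b to ℬ i using hb
  simp only [rightHom, AlgHom.comp_apply]
  erw [DirectSum.decomposeAlgEquiv_apply]
  rw [DirectSum.decompose_coe]
  erw [DirectSum.toAddMonoid_of]
  rfl

theorem leftHom_mul_rightHom {i j : ℤ} {a : A} {b : B} (ha : a ∈ 𝒜 i)
    (hb : b ∈ ℬ j) : leftHom 𝒜 ℬ a * rightHom 𝒜 ℬ b =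
      DirectSum.of (fun n => totalGr 𝒜 ℬ n) (i + j) ⟨a ᵍ⊗ₜ[R] b, tmul_mem ha hb⟩ := by
  rw [leftHom_apply 𝒜 ℬ ha, rightHom_apply 𝒜 ℬ hb, DirectSum.of_mul_of]
  apply DirectSum.of_eq_of_gradedMonoid_eq
  refine Sigma.subtype_ext rfl ?_
  exact GradedTensorProduct.tmul_one_mul_one_tmul 𝒜 ℬ a b

theorem leftHom_rightHom_comm {i j : ℤ} (a : 𝒜 i) (b : ℬ j) :
    leftHom 𝒜 ℬ a * rightHom 𝒜 ℬ b =
      (-1 : ℤˣ) ^ (j * i) • (rightHom 𝒜 ℬ b * leftHom 𝒜 ℬ a) := by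
  rw [leftHom_mul_rightHom 𝒜 ℬ a.2 b.2, leftHom_apply 𝒜 ℬ a.2,
    rightHom_apply 𝒜 ℬ b.2, DirectSum.of_mul_of, units_smul_of]
  apply DirectSum.of_eq_of_gradedMonoid_eq
  refine Sigma.subtype_ext (add_comm _ _) ?_
  refine Eq.trans ?_ (units_smul_coe _ _ _).symm
  change _ = (-1 : ℤˣ) ^ (j * i) •
    ((1 ᵍ⊗ₜ[R] (b : B) * (a : A) ᵍ⊗ₜ[R] 1 : 𝒜 ᵍ⊗[R] ℬ))
  rw [tmul_mul_tmul 1 1 b.2 a.2, smul_smul, Int.units_mul_self, one_mul, mul_one, one_smul]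
  rfl

/-- Decomposition of the tensor product into its graded pieces. -/
def totalDecompose : (𝒜 ᵍ⊗[R] ℬ) →ₐ[R] ⨁ n, totalGr 𝒜 ℬ n :=
  GradedTensorProduct.lift (C := ⨁ n, totalGr 𝒜 ℬ n) 𝒜 ℬ (leftHom 𝒜 ℬ) (rightHom 𝒜 ℬ)
    (fun _ _ a b => leftHom_rightHom_comm 𝒜 ℬ a b)

theorem totalDecompose_tmul {i j : ℤ} {a : A} {b : B} (ha : a ∈ 𝒜 i) (hb : b ∈ ℬ j) :
    totalDecompose 𝒜 ℬ (a ᵍ⊗ₜ[R] b) =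
      DirectSum.of (fun n => totalGr 𝒜 ℬ n) (i + j) ⟨a ᵍ⊗ₜ[R] b, tmul_mem ha hb⟩ :=
  leftHom_mul_rightHom 𝒜 ℬ ha hb

theorem totalDecompose_left {i : ℤ} {a : A} (ha : a ∈ 𝒜 i) :
    totalDecompose 𝒜 ℬ (a ᵍ⊗ₜ[R] 1) =
      DirectSum.of (fun n => totalGr 𝒜 ℬ n) i ⟨a ᵍ⊗ₜ[R] 1, left_mem 𝒜 ℬ ha⟩ := by
  rw [totalDecompose_tmul 𝒜 ℬ ha (SetLike.one_mem_graded ℬ)]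
  exact DirectSum.of_eq_of_gradedMonoid_eq (Sigma.subtype_ext (add_zero _) rfl)

theorem totalDecompose_right {i : ℤ} {b : B} (hb : b ∈ ℬ i) :
    totalDecompose 𝒜 ℬ (1 ᵍ⊗ₜ[R] b) =
      DirectSum.of (fun n => totalGr 𝒜 ℬ n) i ⟨1 ᵍ⊗ₜ[R] b, right_mem 𝒜 ℬ hb⟩ := by
  rw [totalDecompose_tmul 𝒜 ℬ (SetLike.one_mem_graded 𝒜) hb]
  exact DirectSum.of_eq_of_gradedMonoid_eq (Sigma.subtype_ext (zero_add _) rfl)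

instance totalGr_graded : GradedAlgebra (totalGr 𝒜 ℬ) :=
  GradedAlgebra.ofAlgHom (totalGr 𝒜 ℬ) (totalDecompose 𝒜 ℬ)
    (by
      apply GradedTensorProduct.algHom_ext
      · ext a
        induction a using DirectSum.Decomposition.inductionOn 𝒜 with
        | zero => rw [map_zero, map_zero]
        | add x y hx hy => rw [map_add, map_add, hx, hy]
        | homogeneous x =>
          change DirectSum.coeAlgHom (totalGr 𝒜 ℬ) (totalDecompose 𝒜 ℬ ((x : A) ᵍ⊗ₜ[R] 1)) = _
          rw [totalDecompose_left 𝒜 ℬ x.2, DirectSum.coeAlgHom_of]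
          rfl
      · ext a
        induction a using DirectSum.Decomposition.inductionOn ℬ with
        | zero => rw [map_zero, map_zero]
        | add x y hx hy => rw [map_add, map_add, hx, hy]
        | homogeneous x =>
          change DirectSum.coeAlgHom (totalGr 𝒜 ℬ) (totalDecompose 𝒜 ℬ (1 ᵍ⊗ₜ[R] (x : B))) = _
          rw [totalDecompose_right 𝒜 ℬ x.2, DirectSum.coeAlgHom_of]
          rfl)
    (fun n x => by
      obtain ⟨x, hx⟩ := x
      dsimp only
      induction hx using Submodule.span_induction with
      | zero => rw [map_zero]; exact (map_zero (DirectSum.of (fun n => totalGr 𝒜 ℬ n) n)).symm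
      | add x y hx hy h h' => rw [map_add, h, h', ← map_add]; rfl
      | smul c x hx h =>
        rw [map_smul, h]
        exact ((DirectSum.lof R ℤ (fun n => totalGr 𝒜 ℬ n) n).map_smul c ⟨x, hx⟩).symm
      | mem x hx =>
        obtain ⟨i, j, a, b, rfl, ha, hb, rfl⟩ := hx
        exact totalDecompose_tmul 𝒜 ℬ ha hb)

section map
variable {C E : Type*} [Ring C] [Algebra R C] [Ring E] [Algebra R E] {𝒜 ℬ}
  {𝒞 : ℤ → Submodule R C} [GradedAlgebra 𝒞] {ℰ : ℤ → Submodule R E} [GradedAlgebra ℰ]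

/-- `id ⊗ φ` as an algebra morphism. -/
def mapAlgHom (φ : ℬ →ₐᵍ[R] 𝒞) : (𝒜 ᵍ⊗[R] ℬ) →ₐ[R] (𝒜 ᵍ⊗[R] 𝒞) :=
  GradedTensorProduct.lift 𝒜 ℬ (GradedTensorProduct.includeLeft 𝒜 𝒞)
    ((GradedTensorProduct.includeRight 𝒜 𝒞).comp φ.toAlgHom) (by
      intro i j a b
      have h : φ (b : B) ∈ 𝒞 j := φ.map_mem b.2
      change ((a : A) ᵍ⊗ₜ[R] (1 : C) * (1 : A) ᵍ⊗ₜ[R] φ (b : B) : 𝒜 ᵍ⊗[R] 𝒞) =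
        (-1 : ℤˣ) ^ (j * i) • ((1 : A) ᵍ⊗ₜ[R] φ (b : B) * (a : A) ᵍ⊗ₜ[R] (1 : C))
      rw [tmul_mul_tmul _ _ h a.2, smul_smul, Int.units_mul_self, one_smul, one_mul, mul_one]
      exact GradedTensorProduct.tmul_one_mul_one_tmul 𝒜 𝒞 a (φ b))

theorem mapAlgHom_tmul (φ : ℬ →ₐᵍ[R] 𝒞) (a : A) (b : B) :
    mapAlgHom φ (a ᵍ⊗ₜ[R] b : 𝒜 ᵍ⊗[R] ℬ) = (a ᵍ⊗ₜ[R] φ b : 𝒜 ᵍ⊗[R] 𝒞) :=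
  GradedTensorProduct.tmul_one_mul_one_tmul 𝒜 𝒞 a (φ b)

/-- `id ⊗ φ` as a morphism of graded algebras. -/
def map (φ : ℬ →ₐᵍ[R] 𝒞) : totalGr 𝒜 ℬ →ₐᵍ[R] totalGr 𝒜 𝒞 :=
  { mapAlgHom φ with
    map_mem := by
      intro n x hx
      change mapAlgHom φ x ∈ totalGr 𝒜 𝒞 n
      induction hx using Submodule.span_induction with
      | zero => rw [map_zero]; exact zero_mem _
      | add x y _ _ h h' => rw [map_add]; exact add_mem h h'
      | smul c x _ h => rw [map_smul]; exact Submodule.smul_mem _ c h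
      | mem x hx =>
        obtain ⟨i, j, a, b, rfl, ha, hb, rfl⟩ := hx
        rw [mapAlgHom_tmul]
        exact tmul_mem ha (φ.map_mem hb) }

theorem map_tmul (φ : ℬ →ₐᵍ[R] 𝒞) (a : A) (b : B) :
    map φ (a ᵍ⊗ₜ[R] b : 𝒜 ᵍ⊗[R] ℬ) = (a ᵍ⊗ₜ[R] φ b : 𝒜 ᵍ⊗[R] 𝒞) :=
  mapAlgHom_tmul φ a b

theorem hom_ext {f g : totalGr 𝒜 ℬ →ₐᵍ[R] 𝒞}
    (h : ∀ (a : A) (b : B), f (a ᵍ⊗ₜ[R] b : 𝒜 ᵍ⊗[R] ℬ) = g (a ᵍ⊗ₜ[R] b : 𝒜 ᵍ⊗[R] ℬ)) :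
    f = g := by
  apply GradedAlgHom.coe_toAlgHom_injective
  apply GradedTensorProduct.algHom_ext
  · ext a; exact h a 1
  · ext b; exact h 1 b

theorem map_id : map (GradedAlgHom.id R ℬ) = GradedAlgHom.id R (totalGr 𝒜 ℬ) :=
  hom_ext fun a b => map_tmul _ a b

theorem map_comp (ψ : 𝒞 →ₐᵍ[R] ℰ) (φ : ℬ →ₐᵍ[R] 𝒞) :
    (map (ψ.comp φ) : totalGr 𝒜 ℬ →ₐᵍ[R] totalGr 𝒜 ℰ) = (map ψ).comp (map φ) :=
  hom_ext fun a b => by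
    change map (ψ.comp φ) (a ᵍ⊗ₜ[R] b : 𝒜 ᵍ⊗[R] ℬ) = map ψ (map φ (a ᵍ⊗ₜ[R] b : 𝒜 ᵍ⊗[R] ℬ))
    rw [map_tmul, map_tmul, map_tmul]
    rfl

end map

end GradedTensor

/-- A ℤ-graded, graded-commutative ℝ-algebra. -/
structure GradedCommAlg : Type (u + 1) where
  carrier : Type u
  [ring : Ring carrier]
  [algebra : Algebra ℝ carrier]
  gr : ℤ → Submodule ℝ carrier
  [graded : GradedAlgebra gr]
  graded_comm : ∀ (i j : ℤ) (a b : carrier), a ∈ gr i → b ∈ gr j →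
    a * b = (-1 : ℤˣ) ^ (i * j) • (b * a)

attribute [instance] GradedCommAlg.ring GradedCommAlg.algebra GradedCommAlg.graded

namespace GradedCommAlg

/-- Degree-preserving algebra morphisms. -/
abbrev Hom (A : GradedCommAlg.{u}) (B : GradedCommAlg.{v}) : Type (max u v) := A.gr →ₐᵍ[ℝ] B.gr

/-- The tensor product of graded-commutative algebras, with the Koszul sign rule. -/
def tensor (A : GradedCommAlg.{u}) (B : GradedCommAlg.{v}) : GradedCommAlg.{max u v} where
  carrier := A.gr ᵍ⊗[ℝ] B.gr
  gr := GradedTensor.totalGr A.gr B.gr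
  graded_comm := GradedTensor.totalGr_comm A.gr B.gr A.graded_comm B.graded_comm


end GradedCommAlg


theorem map_units_smul {M N F : Type*} [AddCommGroup M] [AddCommGroup N] [FunLike F M N]
    [AddMonoidHomClass F M N] (f : F) (e : ℤˣ) (x : M) : f (e • x) = e • f x := by
  rcases Int.units_eq_one_or e with rfl | rfl
  · simp
  · simp [Units.smul_def]

namespace GradedSym
variable (P : ℤ → Type v) [∀ i, AddCommGroup (P i)] [∀ i, Module ℝ (P i)]

/-- Graded commutativity on the generators. -/
inductive Rel : TensorAlgebra ℝ (⨁ i, P i) → TensorAlgebra ℝ (⨁ i, P i) → Prop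
  | comm (i j : ℤ) (x : P i) (y : P j) :
    Rel (TensorAlgebra.ι ℝ (DirectSum.lof ℝ ℤ P i x) * TensorAlgebra.ι ℝ (DirectSum.lof ℝ ℤ P j y))
      ((-1 : ℤˣ) ^ (i * j) • (TensorAlgebra.ι ℝ (DirectSum.lof ℝ ℤ P j y) *
        TensorAlgebra.ι ℝ (DirectSum.lof ℝ ℤ P i x)))
end GradedSym

/-- The graded symmetric algebra of a ℤ-graded vector space `P`: the tensor algebra of `⨁ i, P i`
modulo `x y = (-1) ^ (|x| |y|) y x`. -/
def GradedSym (P : ℤ → Type v) [∀ i, AddCommGroup (P i)] [∀ i, Module ℝ (P i)] : Type v :=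
  RingQuot (GradedSym.Rel P)

namespace GradedSym
variable (P : ℤ → Type v) [∀ i, AddCommGroup (P i)] [∀ i, Module ℝ (P i)]

instance : Ring (GradedSym P) := inferInstanceAs (Ring (RingQuot (GradedSym.Rel P)))
instance : Algebra ℝ (GradedSym P) := inferInstanceAs (Algebra ℝ (RingQuot (GradedSym.Rel P)))

/-- The generators of degree `i`. -/
def ι (i : ℤ) : P i →ₗ[ℝ] GradedSym P :=
  (RingQuot.mkAlgHom ℝ (Rel P)).toLinearMap ∘ₗ TensorAlgebra.ι ℝ ∘ₗ DirectSum.lof ℝ ℤ P i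

variable {P} in
theorem ι_mul_ι {i j : ℤ} (x : P i) (y : P j) :
    ι P i x * ι P j y = (-1 : ℤˣ) ^ (i * j) • (ι P j y * ι P i x) := by
  have h := RingQuot.mkAlgHom_rel ℝ (Rel.comm i j x y)
  rw [map_mul, map_units_smul, map_mul] at h
  exact h

variable {P} in
/-- The universal property of the graded symmetric algebra. -/
def lift {A : Type*} [Ring A] [Algebra ℝ A] (f : ∀ i, P i →ₗ[ℝ] A)
    (hf : ∀ (i j : ℤ) (x : P i) (y : P j), f i x * f j y = (-1 : ℤˣ) ^ (i * j) • (f j y * f i x)) :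
    GradedSym P →ₐ[ℝ] A :=
  RingQuot.liftAlgHom ℝ ⟨TensorAlgebra.lift ℝ (DirectSum.toModule ℝ ℤ A f), by
    rintro _ _ ⟨i, j, x, y⟩
    simpa [map_units_smul] using hf i j x y⟩

variable {P} in
theorem lift_ι {A : Type*} [Ring A] [Algebra ℝ A] (f : ∀ i, P i →ₗ[ℝ] A)
    (hf : ∀ (i j : ℤ) (x : P i) (y : P j), f i x * f j y = (-1 : ℤˣ) ^ (i * j) • (f j y * f i x))
    (i : ℤ) (x : P i) : lift f hf (ι P i x) = f i x := by
  change RingQuot.liftAlgHom ℝ _ (RingQuot.mkAlgHom ℝ (Rel P) _) = _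
  rw [RingQuot.liftAlgHom_mkAlgHom_apply]
  simp

variable {P} in
theorem algHom_ext {A : Type*} [Ring A] [Algebra ℝ A] {f g : GradedSym P →ₐ[ℝ] A}
    (h : ∀ i x, f (ι P i x) = g (ι P i x)) : f = g := by
  apply RingQuot.ringQuot_ext'
  apply TensorAlgebra.hom_ext
  apply DirectSum.linearMap_ext
  intro i
  ext x
  exact h i x

/-- The degree `n` part: the span of the products of generators whose degrees add up to `n`. -/
def deg (n : ℤ) : Submodule ℝ (GradedSym P) :=
  Submodule.span ℝ {x | ∃ l : List (Σ i, P i),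
    (l.map Sigma.fst).sum = n ∧ x = (l.map fun p => ι P p.1 p.2).prod}

variable {P} in
theorem ι_mem (i : ℤ) (x : P i) : ι P i x ∈ deg P i :=
  Submodule.subset_span ⟨[⟨i, x⟩], by simp, by simp⟩

instance : SetLike.GradedMonoid (deg P) where
  one_mem := Submodule.subset_span ⟨[], rfl, rfl⟩
  mul_mem m n x y hx hy := by
    induction hx using Submodule.span_induction with
    | zero => simp
    | add x x' _ _ h h' => rw [add_mul]; exact add_mem h h'
    | smul c x _ h => rw [smul_mul_assoc]; exact Submodule.smul_mem _ _ h
    | mem x hx =>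
      obtain ⟨l, rfl, rfl⟩ := hx
      induction hy using Submodule.span_induction with
      | zero => simp
      | add x x' _ _ h h' => rw [mul_add]; exact add_mem h h'
      | smul c x _ h => rw [mul_smul_comm]; exact Submodule.smul_mem _ _ h
      | mem y hy =>
        obtain ⟨l', rfl, rfl⟩ := hy
        exact Submodule.subset_span ⟨l ++ l', by simp, by simp⟩

/-- Decomposition of the graded symmetric algebra into its graded pieces. -/
def decomposeHom : GradedSym P →ₐ[ℝ] ⨁ n, deg P n :=
  lift (A := ⨁ n, deg P n)
    (fun i => (DirectSum.lof ℝ ℤ (fun n => deg P n) i).comp ((ι P i).codRestrict (deg P i) (ι_mem i)))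
    (by
      intro i j x y
      simp only [LinearMap.comp_apply, DirectSum.lof_eq_of, DirectSum.of_mul_of, units_smul_of]
      apply DirectSum.of_eq_of_gradedMonoid_eq
      refine Sigma.subtype_ext (add_comm _ _) ?_
      refine Eq.trans ?_ (units_smul_coe _ _ _).symm
      exact ι_mul_ι x y)

theorem decomposeHom_ι (i : ℤ) (x : P i) :
    decomposeHom P (ι P i x) = DirectSum.of (fun n => deg P n) i ⟨ι P i x, ι_mem i x⟩ :=
  lift_ι _ _ i x

theorem decomposeHom_prod (l : List (Σ i, P i)) :
    decomposeHom P (l.map fun p => ι P p.1 p.2).prod =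
      DirectSum.of (fun n => deg P n) (l.map Sigma.fst).sum
        ⟨(l.map fun p => ι P p.1 p.2).prod, Submodule.subset_span ⟨l, rfl, rfl⟩⟩ := by
  induction l with
  | nil => exact map_one _
  | cons p l ih =>
    have h : decomposeHom P ((p :: l).map fun p => ι P p.1 p.2).prod =
        decomposeHom P (ι P p.1 p.2) * decomposeHom P (l.map fun p => ι P p.1 p.2).prod := by
      rw [List.map_cons, List.prod_cons, map_mul]
    rw [h, ih, decomposeHom_ι, DirectSum.of_mul_of]
    apply DirectSum.of_eq_of_gradedMonoid_eq
    refine Sigma.subtype_ext List.sum_cons.symm ?_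
    exact List.prod_cons.symm

instance : GradedAlgebra (deg P) :=
  GradedAlgebra.ofAlgHom (deg P) (decomposeHom P)
    (algHom_ext fun i x => by
      change DirectSum.coeAlgHom (deg P) (decomposeHom P (ι P i x)) = _
      rw [decomposeHom_ι, DirectSum.coeAlgHom_of]
      rfl)
    (fun n x => by
      obtain ⟨x, hx⟩ := x
      dsimp only
      induction hx using Submodule.span_induction with
      | zero => rw [map_zero]; exact (map_zero (DirectSum.of (fun n => deg P n) n)).symm
      | add x y hx hy h h' => rw [map_add, h, h', ← map_add]; rfl
      | smul c x hx h =>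
        rw [map_smul, h]
        exact ((DirectSum.lof ℝ ℤ (fun n => deg P n) n).map_smul c ⟨x, hx⟩).symm
      | mem x hx =>
        obtain ⟨l, rfl, rfl⟩ := hx
        exact decomposeHom_prod P l)

variable {P} in
theorem graded_comm (m n : ℤ) (x y : GradedSym P) (hx : x ∈ deg P m) (hy : y ∈ deg P n) :
    x * y = (-1 : ℤˣ) ^ (m * n) • (y * x) := by
  have hu : ∀ (e : ℤˣ) (a b : GradedSym P), a * (e • b) = e • (a * b) := fun e a b => mul_smul_comm e a b
  have hv : ∀ (e : ℤˣ) (a b : GradedSym P), (e • a) * b = e • (a * b) := fun e a b => smul_mul_assoc e a b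
  have key1 : ∀ (i : ℤ) (s : P i) (l : List (Σ i, P i)),
      ι P i s * (l.map fun p => ι P p.1 p.2).prod =
        (-1 : ℤˣ) ^ (i * (l.map Sigma.fst).sum) • ((l.map fun p => ι P p.1 p.2).prod * ι P i s) := by
    intro i s l
    induction l with
    | nil => simp
    | cons p l ih =>
      simp only [List.map_cons, List.prod_cons, List.sum_cons]
      rw [← mul_assoc, ι_mul_ι, hv, mul_assoc, ih, hu, smul_smul, ← mul_assoc, mul_add, uzpow_add]
  have key2 : ∀ (l l' : List (Σ i, P i)),
      (l.map fun p => ι P p.1 p.2).prod * (l'.map fun p => ι P p.1 p.2).prod =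
        (-1 : ℤˣ) ^ ((l.map Sigma.fst).sum * (l'.map Sigma.fst).sum) •
          ((l'.map fun p => ι P p.1 p.2).prod * (l.map fun p => ι P p.1 p.2).prod) := by
    intro l l'
    induction l with
    | nil => simp
    | cons p l ih =>
      simp only [List.map_cons, List.prod_cons, List.sum_cons]
      rw [mul_assoc, ih, hu, ← mul_assoc, key1, hv, smul_smul, mul_assoc, add_mul, uzpow_add,
        mul_comm ((-1 : ℤˣ) ^ _)]
  induction hx using Submodule.span_induction with
  | zero => simp
  | add x x' _ _ h h' => rw [add_mul, h, h', mul_add, smul_add]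
  | smul c x _ h => rw [smul_mul_assoc, h, mul_smul_comm, smul_comm]
  | mem x hx =>
    obtain ⟨l, rfl, rfl⟩ := hx
    induction hy using Submodule.span_induction with
    | zero => simp
    | add x x' _ _ h h' => rw [mul_add, h, h', add_mul, smul_add]
    | smul c x _ h => rw [mul_smul_comm, h, smul_mul_assoc, smul_comm]
    | mem y hy =>
      obtain ⟨l', rfl, rfl⟩ := hy
      exact key2 l l'

end GradedSym

/-- A smooth real vector bundle of finite rank over `M`. -/
structure SmoothVB (n : ℕ) (M : Type u) [TopologicalSpace M]
    [ChartedSpace (EuclideanSpace ℝ (Fin n)) M] where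
  model : Type
  [normed : NormedAddCommGroup model]
  [normedSpace : NormedSpace ℝ model]
  [finiteDimensional : FiniteDimensional ℝ model]
  fiber : M → Type
  [addCommGroup : ∀ x, AddCommGroup (fiber x)]
  [module : ∀ x, Module ℝ (fiber x)]
  [topology : ∀ x, TopologicalSpace (fiber x)]
  [topologicalAddGroup : ∀ x, IsTopologicalAddGroup (fiber x)]
  [continuousSMul : ∀ x, ContinuousSMul ℝ (fiber x)]
  [totalSpaceTopology : TopologicalSpace (Bundle.TotalSpace model fiber)]
  [fiberBundle : FiberBundle model fiber]
  [vectorBundle : VectorBundle ℝ model fiber]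
  [contMDiff : ContMDiffVectorBundle ∞ model fiber (𝓡 n)]

attribute [instance] SmoothVB.normed SmoothVB.normedSpace SmoothVB.finiteDimensional
  SmoothVB.addCommGroup SmoothVB.module SmoothVB.topology SmoothVB.topologicalAddGroup
  SmoothVB.continuousSMul SmoothVB.totalSpaceTopology SmoothVB.fiberBundle
  SmoothVB.vectorBundle SmoothVB.contMDiff

namespace SmoothVB
variable (n : ℕ) (M : Type u) [TopologicalSpace M] [ChartedSpace (EuclideanSpace ℝ (Fin n)) M]

/-- The zero bundle. -/
def zero : SmoothVB n M where
  model := EuclideanSpace ℝ (Fin 0)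
  fiber := Bundle.Trivial M (EuclideanSpace ℝ (Fin 0))
  topologicalAddGroup _ := inferInstanceAs (IsTopologicalAddGroup (EuclideanSpace ℝ (Fin 0)))
  continuousSMul _ := inferInstanceAs (ContinuousSMul ℝ (EuclideanSpace ℝ (Fin 0)))

/-- The tangent bundle. -/
def tangent [IsManifold (𝓡 n) ∞ M] : SmoothVB n M where
  model := EuclideanSpace ℝ (Fin n)
  fiber := fun x => TangentSpace (𝓡 n) x
  topologicalAddGroup _ := inferInstanceAs (IsTopologicalAddGroup (EuclideanSpace ℝ (Fin n)))
  continuousSMul _ := inferInstanceAs (ContinuousSMul ℝ (EuclideanSpace ℝ (Fin n)))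

variable {n M}

open scoped Bundle in
/-- The direct sum of two vector bundles. -/
def prod [IsManifold (𝓡 n) ∞ M] (V W : SmoothVB n M) : SmoothVB n M where
  model := V.model × W.model
  fiber := V.fiber ×ᵇ W.fiber
  contMDiff := Bundle.Prod.contMDiffVectorBundle V.model V.fiber W.model W.fiber

/-- The fibre at `x` of the dual bundle. -/
abbrev Dual (V : SmoothVB n M) (x : M) : Type := V.fiber x →L[ℝ] Bundle.Trivial M ℝ x

/-- Smooth sections of the dual bundle. -/
abbrev DualSection (V : SmoothVB n M) : Type u :=
  Cₛ^∞⟮𝓡 n; V.model →L[ℝ] ℝ, V.Dual⟯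

end SmoothVB

/-- A ℤ-graded smooth vector bundle, of finite rank in each degree. -/
abbrev GradedVB (n : ℕ) (M : Type u) [TopologicalSpace M] [ChartedSpace (EuclideanSpace ℝ (Fin n)) M] :
    Type (max 1 u) :=
  ℤ → SmoothVB n M

namespace GradedVB
variable {n : ℕ} {M : Type u} [TopologicalSpace M] [ChartedSpace (EuclideanSpace ℝ (Fin n)) M]
  (V : GradedVB n M)

/-- The fibre at `x` of `S^{≥0} V^*`, where `(V^*)_d = (V_{-d})^*`. -/
abbrev symFiber (x : M) : Type :=
  GradedSym fun d : ℤ => (V (-d)).Dual x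

/-- The algebra generated by smooth functions and smooth sections of the bundles `(V^*)_d`,
as fibrewise sections of `S^{≥0} V^*`. -/
def polySections : Subalgebra ℝ (∀ x, V.symFiber x) :=
  Algebra.adjoin ℝ
    ({s | ∃ f : C^∞⟮𝓡 n, M; ℝ⟯, s = fun x => algebraMap ℝ (V.symFiber x) (f x)} ∪
      {s | ∃ (d : ℤ) (σ : (V (-d)).DualSection),
        s = fun x => GradedSym.ι (fun d : ℤ => (V (-d)).Dual x) d (σ x)})

/-- Smooth sections of `S^{≥0} V^*`: those which, near each point, are polynomial expressions in
smooth functions and smooth sections of the bundles `(V^*)_d`. -/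
def smoothSections : Subalgebra ℝ (∀ x, V.symFiber x) where
  carrier := {s | ∀ x₀, ∃ t ∈ V.polySections, ∀ᶠ x in 𝓝 x₀, s x = t x}
  mul_mem' {s s'} hs hs' x₀ := by
    obtain ⟨t, ht, h⟩ := hs x₀
    obtain ⟨t', ht', h'⟩ := hs' x₀
    exact ⟨t * t', mul_mem ht ht', by
      filter_upwards [h, h'] with x e e'
      rw [Pi.mul_apply, Pi.mul_apply, e, e']⟩
  add_mem' {s s'} hs hs' x₀ := by
    obtain ⟨t, ht, h⟩ := hs x₀
    obtain ⟨t', ht', h'⟩ := hs' x₀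
    exact ⟨t + t', add_mem ht ht', by
      filter_upwards [h, h'] with x e e'
      rw [Pi.add_apply, Pi.add_apply, e, e']⟩
  algebraMap_mem' c x₀ :=
    ⟨algebraMap ℝ _ c, Subalgebra.algebraMap_mem _ c, Filter.Eventually.of_forall fun _ => rfl⟩

/-- Smooth sections that are homogeneous of degree `m`. -/
def homSections (m : ℤ) : Submodule ℝ (∀ x, V.symFiber x) where
  carrier := {s | s ∈ V.smoothSections ∧
    ∀ x, s x ∈ GradedSym.deg (fun d : ℤ => (V (-d)).Dual x) m}
  add_mem' hs hs' := ⟨add_mem hs.1 hs'.1, fun x => add_mem (hs.2 x) (hs'.2 x)⟩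
  zero_mem' := ⟨zero_mem _, fun _ => zero_mem _⟩
  smul_mem' c _ hs := ⟨Subalgebra.smul_mem _ hs.1 c, fun x => Submodule.smul_mem _ c (hs.2 x)⟩

instance : SetLike.GradedMonoid V.homSections where
  one_mem := ⟨one_mem _, fun _ => SetLike.GradedOne.one_mem⟩
  mul_mem _ _ _ _ hs ht := ⟨mul_mem hs.1 ht.1, fun x => SetLike.mul_mem_graded (hs.2 x) (ht.2 x)⟩

/-- `Γ(S^{≥0} V^*)`: finite sums of homogeneous smooth sections. -/
def sections : Subalgebra ℝ (∀ x, V.symFiber x) :=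
  (DirectSum.coeAlgHom V.homSections).range

theorem homSections_le (m : ℤ) : V.homSections m ≤ V.sections.toSubmodule := fun s hs =>
  ⟨DirectSum.of (fun m => V.homSections m) m ⟨s, hs⟩, DirectSum.coeAlgHom_of _ _ _⟩

/-- The degree `m` part of `Γ(S^{≥0} V^*)`. -/
def sectionsGr (m : ℤ) : Submodule ℝ V.sections :=
  (V.homSections m).comap V.sections.toSubmodule.subtype

instance : SetLike.GradedMonoid V.sectionsGr where
  one_mem := SetLike.GradedOne.one_mem (A := V.homSections)
  mul_mem _ _ _ _ hs ht := SetLike.mul_mem_graded (A := V.homSections) hs ht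

theorem sectionsGr_iSupIndep : iSupIndep V.sectionsGr := by
  rw [iSupIndep_iff_dfinsupp_lsum_injective]
  intro a b h
  have key : ∀ (c : Π₀ m, V.sectionsGr m) (i : ℤ) (x : M),
      ((DirectSum.decompose (GradedSym.deg fun d : ℤ => (V (-d)).Dual x)
        (((DFinsupp.lsum ℕ fun i => (V.sectionsGr i).subtype) c : V.sections).1 x) i : _) :
          V.symFiber x) = (c i : V.sections).1 x := by
    intro c i x
    induction c using DFinsupp.induction with
    | h0 => simp
    | ha j s c _ _ ih =>
      rw [map_add, Subalgebra.coe_add, Pi.add_apply, DirectSum.decompose_add, DFinsupp.add_apply,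
        DFinsupp.lsum_single]
      rw [DirectSum.add_apply, Submodule.coe_add, ih, Submodule.coe_add, Subalgebra.coe_add,
        Pi.add_apply]
      congr 1
      by_cases hij : j = i
      · subst hij
        rw [DFinsupp.single_eq_same]
        exact DirectSum.decompose_of_mem_same _ (s.2.2 x)
      · rw [DFinsupp.single_eq_of_ne (Ne.symm hij)]
        exact DirectSum.decompose_of_mem_ne _ (s.2.2 x) hij
  have h' : ∀ (i : ℤ) (x : M), (a i : V.sections).1 x = (b i : V.sections).1 x := by
    intro i x
    refine (key a i x).symm.trans (Eq.trans ?_ (key b i x))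
    exact congrArg (fun z : V.sections =>
      ((DirectSum.decompose (GradedSym.deg fun d : ℤ => (V (-d)).Dual x) (z.1 x) i : _) :
        V.symFiber x)) h
  exact DFinsupp.ext fun i => Subtype.ext (Subtype.ext (funext (h' i)))

theorem sectionsGr_iSup : iSup V.sectionsGr = ⊤ := by
  rw [eq_top_iff]
  rintro ⟨s, a, rfl⟩ -
  induction a using DirectSum.induction_on with
  | zero =>
    convert zero_mem (iSup V.sectionsGr)
    exact Subtype.ext (map_zero (DirectSum.coeAlgHom V.homSections))
  | of m s =>
    refine Submodule.mem_iSup_of_mem m ?_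
    change DirectSum.coeAlgHom V.homSections _ ∈ V.homSections m
    rw [DirectSum.coeAlgHom_of]
    exact s.2
  | add a b ha hb =>
    convert add_mem ha hb
    exact Subtype.ext (map_add (DirectSum.coeAlgHom V.homSections) a b)

instance : GradedAlgebra V.sectionsGr where
  toDecomposition := (DirectSum.isInternal_submodule_of_iSupIndep_of_iSup_eq_top
    V.sectionsGr_iSupIndep V.sectionsGr_iSup).chooseDecomposition

/-- The graded algebra of functions of the split graded manifold `𝔖(V)`. -/
def functions : GradedCommAlg.{u} where
  carrier := V.sections
  gr := V.sectionsGr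
  graded_comm i j a b ha hb := by
    apply Subtype.ext
    have h1 : (((-1 : ℤˣ) ^ (i * j) • (b * a) : V.sections) : ∀ x, V.symFiber x) =
        (-1 : ℤˣ) ^ (i * j) • ((b : ∀ x, V.symFiber x) * a) :=
      map_units_smul V.sections.val _ _
    rw [h1]
    funext x
    exact (GradedSym.graded_comm i j (a.1 x) (b.1 x) (ha.2 x) (hb.2 x))

end GradedVB

namespace GradedCommAlg

section
variable (A : Type u) [CommRing A] [Algebra ℝ A]

/-- The grading concentrated in degree `0`. -/
def zeroGr (d : ℤ) : Submodule ℝ A := if d = 0 then ⊤ else ⊥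

variable {A} in
theorem mem_zeroGr {d : ℤ} {a : A} : a ∈ zeroGr A d ↔ (d ≠ 0 → a = 0) := by
  unfold zeroGr
  split_ifs with h <;> simp [h]

instance : SetLike.GradedMonoid (zeroGr A) where
  one_mem := mem_zeroGr.2 fun h => absurd rfl h
  mul_mem i j a b ha hb := by
    rw [mem_zeroGr] at *
    intro h
    rcases eq_or_ne i 0 with hi | hi
    · rw [hb (by omega), mul_zero]
    · rw [ha hi, zero_mul]

instance : GradedAlgebra (zeroGr A) where
  decompose' a := DirectSum.of (fun d => zeroGr A d) 0 ⟨a, mem_zeroGr.2 fun h => absurd rfl h⟩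
  left_inv a := DirectSum.coeAddMonoidHom_of _ _ _
  right_inv a := by
    induction a using DirectSum.induction_on with
    | zero =>
      rw [map_zero]
      exact map_zero (DirectSum.of (fun d => zeroGr A d) 0)
    | of i a =>
      rw [DirectSum.coeAddMonoidHom_of]
      by_cases hi : i = 0
      · subst hi; rfl
      · obtain rfl : a = 0 := Subtype.ext (mem_zeroGr.1 a.2 hi)
        rw [map_zero]
        exact map_zero (DirectSum.of (fun d => zeroGr A d) 0)
    | add a b ha hb =>
      rw [← ha, ← hb, map_add, ← map_add (DirectSum.of (fun d => zeroGr A d) 0)]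
      simp only [DirectSum.coeAddMonoidHom_of]
      rfl

/-- An algebra concentrated in degree `0`. -/
def concentrated : GradedCommAlg.{u} where
  carrier := A
  gr := zeroGr A
  graded_comm i j a b ha hb := by
    rcases eq_or_ne i 0 with rfl | hi
    · rw [zero_mul, uzpow_zero, one_smul, mul_comm]
    · rw [mem_zeroGr.1 ha hi, zero_mul, mul_zero, smul_zero]

end

/-- The functions on an ordinary manifold. -/
def ofManifold (n : ℕ) (M : Type u) [TopologicalSpace M]
    [ChartedSpace (EuclideanSpace ℝ (Fin n)) M] : GradedCommAlg.{u} :=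
  concentrated C^∞⟮𝓡 n, M; ℝ⟯

/-- The functions on a point. -/
def point : GradedCommAlg.{0} := concentrated ℝ

/-- The grading on `ℝ[ε]` with `ε` in degree `-1`: the degree `0` part is `ℝ`, the degree `-1` part
is `ℝ ε`, and all others vanish. -/
def dualGr (d : ℤ) : Submodule ℝ (DualNumber ℝ) where
  carrier := {z | (d ≠ 0 → z.fst = 0) ∧ (d ≠ -1 → z.snd = 0)}
  add_mem' h h' := ⟨fun hd => by simp [h.1 hd, h'.1 hd], fun hd => by simp [h.2 hd, h'.2 hd]⟩
  zero_mem' := by simp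
  smul_mem' c z h := ⟨fun hd => by simp [h.1 hd], fun hd => by simp [h.2 hd]⟩

theorem inl_mem_dualGr (a : ℝ) : (TrivSqZeroExt.inl a : DualNumber ℝ) ∈ dualGr 0 :=
  ⟨fun h => absurd rfl h, fun _ => TrivSqZeroExt.snd_inl ℝ a⟩

theorem inr_mem_dualGr (a : ℝ) : (TrivSqZeroExt.inr a : DualNumber ℝ) ∈ dualGr (-1) :=
  ⟨fun _ => TrivSqZeroExt.fst_inr ℝ a, fun h => absurd rfl h⟩

instance : SetLike.GradedMonoid dualGr where
  one_mem := inl_mem_dualGr 1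
  mul_mem i j a b ha hb := by
    refine ⟨fun h => ?_, fun h => ?_⟩
    · rw [TrivSqZeroExt.fst_mul]
      rcases eq_or_ne i 0 with hi | hi
      · rw [hb.1 (by omega), mul_zero]
      · rw [ha.1 hi, zero_mul]
    · have h1 : a.fst * b.snd = 0 := by
        rcases eq_or_ne i 0 with hi | hi
        · rw [hb.2 (by omega), mul_zero]
        · rw [ha.1 hi, zero_mul]
      have h2 : b.fst * a.snd = 0 := by
        rcases eq_or_ne j 0 with hj | hj
        · rw [ha.2 (by omega), mul_zero]
        · rw [hb.1 hj, zero_mul]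
      rw [TrivSqZeroExt.snd_mul, smul_eq_mul, h1, zero_add]
      exact (mul_comm _ _).trans h2

/-- Decomposition of `ℝ[ε]` into its graded pieces. -/
def dualDecompose : DualNumber ℝ →+ ⨁ d, dualGr d where
  toFun z := DirectSum.of (fun d => dualGr d) 0 ⟨TrivSqZeroExt.inl z.fst, inl_mem_dualGr _⟩ +
    DirectSum.of (fun d => dualGr d) (-1) ⟨TrivSqZeroExt.inr z.snd, inr_mem_dualGr _⟩
  map_zero' := by
    have h1 : (⟨TrivSqZeroExt.inl (0 : DualNumber ℝ).fst, inl_mem_dualGr _⟩ : dualGr 0) = 0 :=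
      Subtype.ext (TrivSqZeroExt.inl_zero ℝ)
    have h2 : (⟨TrivSqZeroExt.inr (0 : DualNumber ℝ).snd, inr_mem_dualGr _⟩ : dualGr (-1)) = 0 :=
      Subtype.ext (TrivSqZeroExt.inr_zero ℝ)
    rw [h1, h2, map_zero, map_zero, add_zero]
  map_add' z w := by
    have h1 : (⟨TrivSqZeroExt.inl (z + w).fst, inl_mem_dualGr _⟩ : dualGr 0) =
        ⟨TrivSqZeroExt.inl z.fst, inl_mem_dualGr _⟩ + ⟨TrivSqZeroExt.inl w.fst, inl_mem_dualGr _⟩ :=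
      Subtype.ext (TrivSqZeroExt.inl_add ℝ _ _)
    have h2 : (⟨TrivSqZeroExt.inr (z + w).snd, inr_mem_dualGr _⟩ : dualGr (-1)) =
        ⟨TrivSqZeroExt.inr z.snd, inr_mem_dualGr _⟩ + ⟨TrivSqZeroExt.inr w.snd, inr_mem_dualGr _⟩ :=
      Subtype.ext (TrivSqZeroExt.inr_add ℝ _ _)
    rw [h1, h2, map_add, map_add]
    abel

instance : GradedAlgebra dualGr where
  decompose' := dualDecompose
  left_inv z := by
    change DirectSum.coeAddMonoidHom dualGr (DirectSum.of (fun d => dualGr d) 0 _ +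
      DirectSum.of (fun d => dualGr d) (-1) _) = z
    rw [map_add, DirectSum.coeAddMonoidHom_of, DirectSum.coeAddMonoidHom_of]
    exact TrivSqZeroExt.inl_fst_add_inr_snd_eq z
  right_inv a := by
    induction a using DirectSum.induction_on with
    | zero => rw [map_zero, map_zero]
    | add a b ha hb => rw [map_add, map_add, ha, hb]
    | of i a =>
      rw [DirectSum.coeAddMonoidHom_of]
      change DirectSum.of (fun d => dualGr d) 0 _ + DirectSum.of (fun d => dualGr d) (-1) _ = _
      by_cases h0 : i = 0
      · subst h0
        have h1 : (⟨TrivSqZeroExt.inl a.1.fst, inl_mem_dualGr _⟩ : dualGr 0) = a :=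
          Subtype.ext (TrivSqZeroExt.ext rfl (a.2.2 (by decide)).symm)
        have h2 : (⟨TrivSqZeroExt.inr a.1.snd, inr_mem_dualGr _⟩ : dualGr (-1)) = 0 :=
          Subtype.ext (by rw [a.2.2 (by decide)]; exact TrivSqZeroExt.inr_zero ℝ)
        rw [h1, h2, map_zero, add_zero]
      · by_cases h1 : i = -1
        · subst h1
          have h1 : (⟨TrivSqZeroExt.inl a.1.fst, inl_mem_dualGr _⟩ : dualGr 0) = 0 :=
            Subtype.ext (by rw [a.2.1 (by decide)]; exact TrivSqZeroExt.inl_zero ℝ)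
          have h2 : (⟨TrivSqZeroExt.inr a.1.snd, inr_mem_dualGr _⟩ : dualGr (-1)) = a :=
            Subtype.ext (TrivSqZeroExt.ext (a.2.1 (by decide)).symm rfl)
          rw [h1, h2, map_zero, zero_add]
        · obtain rfl : a = 0 := Subtype.ext (TrivSqZeroExt.ext (a.2.1 h0) (a.2.2 h1))
          rw [map_zero]
          exact map_zero dualDecompose

/-- The functions on `D = ℝ[-1]`: the algebra `ℝ[ε]`, `ε² = 0`, with `ε` of degree `-1`. -/
def D : GradedCommAlg.{0} where
  carrier := DualNumber ℝ
  gr := dualGr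
  graded_comm i j a b ha hb := by
    by_cases hi : i = 0
    · subst hi
      rw [zero_mul, uzpow_zero, one_smul, mul_comm]
    · by_cases hj : j = 0
      · subst hj
        rw [mul_zero, uzpow_zero, one_smul, mul_comm]
      · have h1 : a * b = 0 := TrivSqZeroExt.ext
          (by rw [TrivSqZeroExt.fst_mul, ha.1 hi, zero_mul]; rfl)
          (by rw [TrivSqZeroExt.snd_mul, ha.1 hi, hb.1 hj]; simp)
        rw [mul_comm b a, h1, smul_zero]

/-- The functions on `D^{×k}`. -/
def Dpow : ℕ → GradedCommAlg.{0}
  | 0 => point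
  | k + 1 => (Dpow k).tensor D

end GradedCommAlg

namespace GradedVB
variable (n : ℕ) (M : Type u) [TopologicalSpace M] [ChartedSpace (EuclideanSpace ℝ (Fin n)) M]

/-- The zero graded vector bundle. -/
def zero : GradedVB n M := fun _ => SmoothVB.zero n M

variable {n M}

/-- An ordinary vector bundle as a graded vector bundle concentrated in degree `0`. -/
def ofBundle (W : SmoothVB n M) : GradedVB n M := fun d => if d = 0 then W else SmoothVB.zero n M

/-- The degree shift `V[i]`, with `V[i]_d = V_{i+d}`. -/
def shift (V : GradedVB n M) (i : ℤ) : GradedVB n M := fun d => V (i + d)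

/-- Direct sum of graded vector bundles over the same base. -/
def prod [IsManifold (𝓡 n) ∞ M] (V W : GradedVB n M) : GradedVB n M := fun d => (V d).prod (W d)

/-- `V^{⊕ m}`, the direct sum of `m` copies of `V`. -/
def copies [IsManifold (𝓡 n) ∞ M] (V : GradedVB n M) : ℕ → GradedVB n M
  | 0 => zero n M
  | m + 1 => (copies V m).prod V

/-- `V 1 ⊕ ⋯ ⊕ V m`. -/
def sumIcc [IsManifold (𝓡 n) ∞ M] (V : ℕ → GradedVB n M) : ℕ → GradedVB n M
  | 0 => zero n M
  | m + 1 => (sumIcc V m).prod (V (m + 1))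

variable (n M)

/-- `T[i]M`: the tangent bundle placed in degree `-i`. -/
def shiftedTangent [IsManifold (𝓡 n) ∞ M] (i : ℤ) : GradedVB n M :=
  (ofBundle (SmoothVB.tangent n M)).shift i

/-- `⊕_{i=1}^k T[i]M^{⊕ binom(k,i)}`. -/
def iteratedTangent [IsManifold (𝓡 n) ∞ M] (k : ℕ) : GradedVB n M :=
  sumIcc (fun i => (shiftedTangent n M i).copies (k.choose i)) k

end GradedVB

/-- ℤ-graded manifolds: graded-commutative algebras isomorphic, as graded algebras, to
`Γ(S^{≥0} V^*)` for a graded vector bundle `V` over some smooth manifold. -/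
structure ZManifold : Type (u + 1) where
  alg : GradedCommAlg.{u}
  isSplit : ∃ (n : ℕ) (N : Type u) (_ : TopologicalSpace N)
    (_ : ChartedSpace (EuclideanSpace ℝ (Fin n)) N) (_ : IsManifold (𝓡 n) ∞ N) (_ : T2Space N)
    (_ : SecondCountableTopology N) (V : GradedVB n N) (e : alg.carrier ≃ₐ[ℝ] V.functions.carrier),
    ∀ (d : ℤ) (a : alg.carrier), a ∈ alg.gr d ↔ e a ∈ V.functions.gr d

namespace ZManifold

/-- Morphisms `X ⟶ Y` are the graded algebra morphisms from functions on `Y` to functions on `X`. -/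
instance : Category ZManifold.{u} where
  Hom X Y := GradedCommAlg.Hom Y.alg X.alg
  id X := GradedAlgHom.id ℝ X.alg.gr
  comp f g := f.comp g

/-- The split graded manifold `𝔖(V)`. -/
def split {n : ℕ} {M : Type u} [TopologicalSpace M] [ChartedSpace (EuclideanSpace ℝ (Fin n)) M]
    [IsManifold (𝓡 n) ∞ M] [T2Space M] [SecondCountableTopology M] (V : GradedVB n M) : ZManifold.{u} where
  alg := V.functions
  isSplit := ⟨n, M, inferInstance, inferInstance, inferInstance, inferInstance, inferInstance, V,
    AlgEquiv.refl, fun _ _ => Iff.rfl⟩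

/-- The presheaf `Hom(A, B) : T ↦ hom(A × T, B)` on ℤ-graded manifolds. -/
def homPresheaf (A : GradedCommAlg.{0}) (B : GradedCommAlg.{u}) : ZManifold.{u}ᵒᵖ ⥤ Type u where
  obj T := GradedCommAlg.Hom B (A.tensor T.unop.alg)
  map f := TypeCat.ofHom fun φ => (GradedTensor.map f.unop).comp φ
  map_id T := by
    apply ConcreteCategory.hom_ext; intro φ
    change (GradedTensor.map (GradedAlgHom.id ℝ _)).comp φ = φ
    rw [GradedTensor.map_id]
    rfl
  map_comp f g := by
    apply ConcreteCategory.hom_ext; intro φ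
    change (GradedTensor.map (GradedAlgHom.comp g.unop f.unop)).comp φ = _
    rw [GradedTensor.map_comp]
    rfl

end ZManifold

end

/-! Write L = C(D^{×k}) and let V be the graded bundle of the statement. By Yoneda it is enough to
find a universal morphism C^∞(M) → L ⊗ C(𝔖(V)). The basis of L by products of distinct generators
has binom(k,i) elements of degree -i, so every basis element e_i ≠ 1 can be matched with one copy of
T*M among the generators of C(𝔖(V)), sitting in the opposite degree. A 1-form α then has a
tautological value τ(α) = Σ e_i ⊗ α^{(i)}, of total degree 0 and with coefficients in the
augmentation ideal of L.

The connection enters through the derivation D of Γ(S T*M) given by f ↦ df and α ↦ Sym(∇α), which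
raises the symmetric order by one (`symDeriv`). Substituting τ(α) for α is an algebra morphism
(`tautHom`), and the universal morphism is `taylor`: f ↦ Σ τ(D^m f)/m!. The sum is finite because
the augmentation ideal of L is nilpotent, and multiplicative because it is the exponential of a
derivation followed by an algebra morphism. Formally it is f at the end of the geodesic with
tautological initial velocity.

For universality, Ψ ↦ (id ⊗ Ψ) ∘ `taylor` must be bijective onto the morphisms Φ : C^∞(M) → L ⊗
C(T), and T may be taken split. The coefficient of 1 in Φ is a morphism φ, which Ψ must equal on
functions. The coefficient of e_i in (id ⊗ Ψ)(`taylor` f) is Ψ((df)^{(i)}) plus terms that involve Ψ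
only on functions and on generators of degree smaller than that of the i-th copy
(`IsBase.coord_taylor_sub`). So Ψ is found by induction on the degree: where Φ and (id ⊗ Ψ) ∘
`taylor` first differ, the difference is a derivation along φ. It factors uniquely through d by a
φ-linear map on 1-forms, and adding this map to Ψ on the i-th copy removes the difference
(`IsBase.exists_correction`).

This uses three facts about purely algebraic morphisms. A morphism from C^∞(M) to a fibre of
S^{≥0}W* is a nilpotent thickening of the evaluation at a point, hence local
(`exists_isThickenedEval`). The reason is that 1 + g² is a unit, that a polynomial p with 1 + p² a
unit is constant, and that the graded symmetric algebra modulo nilpotents is a polynomial ring;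
Milnor's exercise provides the point. Secondly, morphisms out of 𝔖(V) are determined by, and can be
prescribed on, functions and generators (`IsBase.hom_ext`, `IsBase.exists_hom`). Thirdly, a
derivation along a thickened evaluation is determined by its values on coordinates
(`derivation_eq_zero`), by Hadamard's lemma and nilpotency. -/

set_option linter.unusedSectionVars false

/-! ### Nilpotent elements of graded-commutative algebras -/

section GradedCommNilpotent
variable {R A : Type*} [CommRing R] [Ring A] [Algebra R A] (𝒜 : ℤ → Submodule R A)
  [GradedAlgebra 𝒜]

/-- In a graded-commutative algebra a homogeneous element can be moved past any element. -/
theorem exists_mul_eq_mul_of_homogeneous (hA : ∀ (i j : ℤ) (a b : A), a ∈ 𝒜 i → b ∈ 𝒜 j →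
      a * b = (-1 : ℤˣ) ^ (i * j) • (b * a)) {i : ℤ} {x : A} (hx : x ∈ 𝒜 i) (s : A) :
    ∃ t, s * x = x * t := by
  induction s using DirectSum.Decomposition.inductionOn 𝒜 with
  | zero => exact ⟨0, by simp⟩
  | add a b ha hb =>
    obtain ⟨t, ht⟩ := ha
    obtain ⟨t', ht'⟩ := hb
    exact ⟨t + t', by rw [add_mul, ht, ht', mul_add]⟩
  | @homogeneous j a =>
    exact ⟨(-1 : ℤˣ) ^ (j * i) • (a : A), by rw [hA j i a x a.2 hx, mul_smul_comm]⟩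

/-- An element whose sum with every nilpotent element is nilpotent: the multiples of an element of
odd degree in a graded-commutative algebra. -/
theorem isNilpotent_mul_add (hA : ∀ (i j : ℤ) (a b : A), a ∈ 𝒜 i → b ∈ 𝒜 j →
      a * b = (-1 : ℤˣ) ^ (i * j) • (b * a)) {i : ℤ} {x : A} (hx : x ∈ 𝒜 i) (hxx : x * x = 0)
    (s : A) {b : A} (hb : IsNilpotent b) : IsNilpotent (x * s + b) := by
  obtain ⟨m, hm⟩ := hb
  -- The multiples of x form a two-sided ideal, modulo which x s + b is b.
  have key : ∀ r : ℕ, ∃ t, (x * s + b) ^ r = x * t + b ^ r := by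
    intro r
    induction r with
    | zero => exact ⟨0, by simp⟩
    | succ r ih =>
      obtain ⟨t, ht⟩ := ih
      obtain ⟨t', ht'⟩ := exists_mul_eq_mul_of_homogeneous 𝒜 hA hx (b ^ r)
      refine ⟨t * (x * s + b) + t' * s, ?_⟩
      rw [pow_succ, ht, pow_succ, add_mul, mul_add (b ^ r), ← mul_assoc (b ^ r), ht']
      noncomm_ring
  obtain ⟨t, ht⟩ := key m
  rw [hm, add_zero] at ht
  -- The m-th power is already a multiple of x, and products of two multiples of x vanish because x²
  -- = 0.
  refine ⟨m * 2, ?_⟩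
  obtain ⟨t', ht'⟩ := exists_mul_eq_mul_of_homogeneous 𝒜 hA hx t
  rw [pow_mul, ht, pow_two, mul_assoc, ← mul_assoc t, ht', ← mul_assoc, ← mul_assoc, hxx, zero_mul,
    zero_mul]

end GradedCommNilpotent

theorem neg_one_uzpow_odd {i : ℤ} (h : Odd i) : (-1 : ℤˣ) ^ i = -1 := by
  obtain ⟨m, rfl⟩ := h
  rw [uzpow_add, two_mul, uzpow_add, Int.units_mul_self, one_mul, uzpow_one]

theorem neg_one_uzpow_even {i : ℤ} (h : Even i) : (-1 : ℤˣ) ^ i = 1 := by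
  obtain ⟨m, rfl⟩ := h
  rw [uzpow_add, Int.units_mul_self]

namespace MvPolynomial

/-- A real polynomial `p` such that `1 + p ^ 2` is a unit is constant. -/
theorem eq_C_of_isUnit_one_add_sq {σ : Type*} {p : MvPolynomial σ ℝ} (h : IsUnit (1 + p ^ 2)) :
    p = C (constantCoeff p) := by
  obtain ⟨c, hc⟩ : ∃ c : ℝ, 1 + p ^ 2 = C c := by
    obtain ⟨c, -, hc⟩ := MvPolynomial.isUnit_iff_eq_C_of_isReduced.1 h
    exact ⟨c, hc⟩
  have h2 : p ^ 2 = C (c - 1) := by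
    rw [C_sub, ← hc, C_1]; ring
  -- Polynomials over ℝ form a domain, so squaring doubles the total degree.
  have h3 : p.totalDegree = 0 := by
    have := congrArg totalDegree h2
    rw [totalDegree_C] at this
    rcases eq_or_ne p 0 with rfl | hp
    · simp
    · rw [pow_two, totalDegree_mul_of_isDomain hp hp] at this
      omega
  rw [constantCoeff_eq]
  exact (totalDegree_eq_zero_iff_eq_C).1 h3

end MvPolynomial

/-! ### The graded symmetric algebra modulo nilpotents -/

namespace GradedSym
variable {P : ℤ → Type v} [∀ i, AddCommGroup (P i)] [∀ i, Module ℝ (P i)]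

/-- The generators generate the graded symmetric algebra. -/
theorem induction {p : GradedSym P → Prop} (halg : ∀ c : ℝ, p (algebraMap ℝ _ c))
    (hι : ∀ i x, p (ι P i x)) (hadd : ∀ a b, p a → p b → p (a + b))
    (hmul : ∀ a b, p a → p b → p (a * b)) (a : GradedSym P) : p a := by
  let S : Subalgebra ℝ (GradedSym P) :=
    { carrier := {a | p a}
      mul_mem' := fun ha hb => hmul _ _ ha hb
      add_mem' := fun ha hb => hadd _ _ ha hb
      algebraMap_mem' := halg }
  let f : GradedSym P →ₐ[ℝ] S := lift (fun i => (ι P i).codRestrict S.toSubmodule (hι i)) (by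
    intro i j x y
    apply Subtype.ext
    refine Eq.trans (ι_mul_ι x y) ?_
    exact (map_units_smul S.val ((-1 : ℤˣ) ^ (i * j))
      ((⟨ι P j y, hι j y⟩ : S) * ⟨ι P i x, hι i x⟩)).symm)
  -- The lift into `S` followed by the inclusion fixes the generators, so it is the identity and its
  -- image is everything.
  have h : S.val.comp f = AlgHom.id ℝ _ := algHom_ext fun i x => by
    change ((f (ι P i x) : S) : GradedSym P) = _
    rw [lift_ι]
    rfl
  have := DFunLike.congr_fun h a
  change ((f a : S) : GradedSym P) = a at this
  rw [← this]
  exact (f a).2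

/-- The augmentation, sending all generators to `0`. -/
noncomputable def aug : GradedSym P →ₐ[ℝ] ℝ := lift (fun _ => 0) (by simp)

@[simp] theorem aug_ι (i : ℤ) (x : P i) : aug (ι P i x) = 0 := lift_ι _ _ i x

open Classical in
/-- The quotient onto the symmetric algebra on the generators of even degree. -/
noncomputable def evenPart : GradedSym P →ₐ[ℝ] SymmetricAlgebra ℝ (⨁ i, P i) :=
  lift (fun i => if Even i then SymmetricAlgebra.ι ℝ (⨁ i, P i) ∘ₗ DirectSum.lof ℝ ℤ P i else 0) (by
    intro i j x y
    by_cases hi : Even i <;> by_cases hj : Even j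
    · rw [neg_one_uzpow_even (hi.mul_right j), one_smul, mul_comm]
    all_goals simp [hi, hj])

/-- An odd generator anticommutes with itself, and 2 is invertible. -/
theorem ι_odd_mul_self {i : ℤ} (hi : Odd i) (x : P i) : ι P i x * ι P i x = 0 := by
  have h := ι_mul_ι x x
  rw [neg_one_uzpow_odd (hi.mul hi), Units.neg_smul, one_smul] at h
  have h2 : (2 : ℝ) • (ι P i x * ι P i x) = 0 := by
    rw [two_smul]; nth_rewrite 1 [h]; exact neg_add_cancel _
  exact (smul_eq_zero_iff_right two_ne_zero).1 h2

theorem ι_even_mem_center {i : ℤ} (hi : Even i) (x : P i) :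
    ι P i x ∈ Subalgebra.center ℝ (GradedSym P) := by
  rw [Subalgebra.mem_center_iff]
  intro b
  induction b using GradedSym.induction with
  | halg c => exact Algebra.commutes c _
  | hι j y =>
    rw [ι_mul_ι, neg_one_uzpow_even (hi.mul_left j), one_smul]
  | hadd a b ha hb => rw [add_mul, ha, hb, mul_add]
  | hmul a b ha hb => rw [mul_assoc, hb, ← mul_assoc, ha, mul_assoc]

open Classical in
/-- The section of `evenPart`. -/
noncomputable def ofEven :
    SymmetricAlgebra ℝ (⨁ i, P i) →ₐ[ℝ] Subalgebra.center ℝ (GradedSym P) :=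
  SymmetricAlgebra.lift (DirectSum.toModule ℝ ℤ _ fun i =>
    if hi : Even i then
      (ι P i).codRestrict (Subalgebra.center ℝ (GradedSym P)).toSubmodule (ι_even_mem_center hi)
    else 0)

/-- The span of the multiples of the generators of odd degree. -/
def oddIdeal (P : ℤ → Type v) [∀ i, AddCommGroup (P i)] [∀ i, Module ℝ (P i)] :
    AddSubmonoid (GradedSym P) :=
  AddSubmonoid.closure {a | ∃ (i : ℤ) (x : P i) (s : GradedSym P), Odd i ∧ a = ι P i x * s}

theorem oddIdeal_mul_right {a : GradedSym P} (ha : a ∈ oddIdeal P) (b : GradedSym P) :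
    a * b ∈ oddIdeal P := by
  induction ha using AddSubmonoid.closure_induction with
  | mem a ha =>
    obtain ⟨i, x, s, hi, rfl⟩ := ha
    exact AddSubmonoid.subset_closure ⟨i, x, s * b, hi, mul_assoc _ _ _⟩
  | zero => simp
  | add a a' _ _ h h' => rw [add_mul]; exact add_mem h h'

theorem oddIdeal_mul_left {a : GradedSym P} (ha : a ∈ oddIdeal P) (b : GradedSym P) :
    b * a ∈ oddIdeal P := by
  induction ha using AddSubmonoid.closure_induction with
  | mem a ha =>
    obtain ⟨i, x, s, hi, rfl⟩ := ha
    obtain ⟨t, ht⟩ := exists_mul_eq_mul_of_homogeneous (deg P)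
      (fun _ _ _ _ h h' => graded_comm _ _ _ _ h h') (ι_mem i x) b
    exact AddSubmonoid.subset_closure ⟨i, x, t * s, hi, by rw [← mul_assoc, ht, mul_assoc]⟩
  | zero => simp
  | add a a' _ _ h h' => rw [mul_add]; exact add_mem h h'

/-- Carrying an arbitrary nilpotent summand b lets the induction absorb one multiple of an odd
generator at a time; nilpotents of a noncommutative ring need not be closed under addition. -/
theorem isNilpotent_add_of_mem_oddIdeal {a : GradedSym P} (ha : a ∈ oddIdeal P) :
    ∀ {b : GradedSym P}, IsNilpotent b → IsNilpotent (a + b) := by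
  induction ha using AddSubmonoid.closure_induction with
  | mem a ha =>
    obtain ⟨i, x, s, hi, rfl⟩ := ha
    intro b hb
    exact isNilpotent_mul_add (deg P) (fun _ _ _ _ h h' => graded_comm _ _ _ _ h h') (ι_mem i x)
      (ι_odd_mul_self hi x) s hb
  | zero => intro b hb; simpa using hb
  | add a a' _ _ h h' => intro b hb; rw [add_assoc]; exact h (h' hb)

/-- Dropping the odd generators is the identity modulo the ideal they span. This is clear on
generators and passes to products by ab - a'b' = (a - a')b + a'(b - b'). -/
theorem sub_ofEven_mem_oddIdeal (a : GradedSym P) :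
    a - (ofEven (evenPart a) : GradedSym P) ∈ oddIdeal P := by
  induction a using GradedSym.induction with
  | halg c => simp
  | hι i x =>
    rw [evenPart, lift_ι]
    by_cases hi : Even i
    · rw [if_pos hi]
      simp only [LinearMap.comp_apply, ofEven, SymmetricAlgebra.lift_ι_apply,
        DirectSum.toModule_lof, dif_pos hi]
      convert zero_mem (oddIdeal P)
      exact sub_self _
    · rw [if_neg hi]
      refine AddSubmonoid.subset_closure ⟨i, x, 1, Int.not_even_iff_odd.1 hi, ?_⟩
      simp
  | hadd a b ha hb =>
    rw [map_add, map_add]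
    convert add_mem ha hb using 1
    push_cast
    abel
  | hmul a b ha hb =>
    rw [map_mul, map_mul]
    convert add_mem (oddIdeal_mul_right ha b) (oddIdeal_mul_left hb (ofEven (evenPart a))) using 1
    push_cast
    noncomm_ring

theorem isNilpotent_of_evenPart {a : GradedSym P} (h : evenPart a = 0) : IsNilpotent a := by
  have := sub_ofEven_mem_oddIdeal a
  rw [h, map_zero, ZeroMemClass.coe_zero, sub_zero] at this
  simpa using isNilpotent_add_of_mem_oddIdeal this IsNilpotent.zero

/-- The even part of r lies in a polynomial ring, where a unit 1 + p² forces p to be constant. The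
constant is the augmentation of r, so the even part vanishes and r is in the odd ideal. -/
theorem isNilpotent_of_isUnit_one_add_sq {r : GradedSym P} (h : IsUnit (1 + r ^ 2))
    (h0 : aug r = 0) : IsNilpotent r := by
  apply isNilpotent_of_evenPart
  let b := Module.Basis.ofVectorSpace ℝ (⨁ i, P i)
  let E := SymmetricAlgebra.equivMvPolynomial b
  -- The augmentation is the constant coefficient of the even part.
  have hE : (MvPolynomial.aeval fun _ => (0 : ℝ)).comp
      (E.toAlgHom.comp evenPart) = aug (P := P) := by
    have h1 : (MvPolynomial.aeval fun _ => (0 : ℝ)).comp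
        E.toAlgHom = SymmetricAlgebra.lift 0 := by
      apply SymmetricAlgebra.algHom_ext
      apply b.ext
      intro i
      simp [E]
    rw [← AlgHom.comp_assoc, h1]
    apply algHom_ext
    intro i x
    rw [aug_ι, AlgHom.comp_apply, evenPart, lift_ι]
    split_ifs
    · simp
    · simp
  have h1 : IsUnit (1 + (E (evenPart r)) ^ 2) := by
    simpa using h.map (E.toAlgHom.comp evenPart)
  have h2 := MvPolynomial.eq_C_of_isUnit_one_add_sq h1
  have h3 : MvPolynomial.constantCoeff (E (evenPart r)) = 0 := by
    have := DFunLike.congr_fun hE r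
    rw [h0] at this
    rw [← this]
    change _ = MvPolynomial.aeval (fun _ => (0 : ℝ)) (E (evenPart r))
    rw [MvPolynomial.aeval_zero']
    rfl
  rw [h3, map_zero] at h2
  exact (map_eq_zero_iff E E.injective).1 h2

/-- The morphism of graded symmetric algebras induced by linear maps on the generators. -/
noncomputable def map {Q : ℤ → Type w} [∀ i, AddCommGroup (Q i)] [∀ i, Module ℝ (Q i)]
    (f : ∀ i, P i →ₗ[ℝ] Q i) : GradedSym P →ₐ[ℝ] GradedSym Q :=
  lift (fun i => ι Q i ∘ₗ f i) fun _ _ x y => ι_mul_ι (f _ x) (f _ y)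

@[simp] theorem map_ι {Q : ℤ → Type w} [∀ i, AddCommGroup (Q i)] [∀ i, Module ℝ (Q i)]
    (f : ∀ i, P i →ₗ[ℝ] Q i) (i : ℤ) (x : P i) : map f (ι P i x) = ι Q i (f i x) :=
  lift_ι _ _ i x

end GradedSym

/-! ### Coordinates in a tensor product L ⊗ B and the filtration by L-degree -/

noncomputable section

/-- A finite basis of a graded algebra by homogeneous elements of nonpositive degree, in which `1`
is the only element of degree `0`. -/
structure WeilBasis (L : GradedCommAlg.{u}) where
  idx : Type
  [fintype : Fintype idx]
  basis : Module.Basis idx ℝ L.carrier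
  deg : idx → ℕ
  mem : ∀ i, basis i ∈ L.gr (-(deg i : ℤ))
  unit : idx
  basis_unit : basis unit = 1
  deg_eq_zero : ∀ i, deg i = 0 ↔ i = unit

attribute [instance] WeilBasis.fintype

namespace GradedCommAlg
variable (L : GradedCommAlg.{u}) (B : GradedCommAlg.{v})

/-- The linear equivalence from the tensor product to the graded tensor product. -/
def tensorEquiv : (L.carrier ⊗[ℝ] B.carrier) ≃ₗ[ℝ] (L.tensor B).carrier :=
  GradedTensorProduct.of ℝ L.gr B.gr

/-- The product `l ⊗ x` in `L.tensor B`. -/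
def tmul (l : L.carrier) (x : B.carrier) : (L.tensor B).carrier := L.tensorEquiv B (l ⊗ₜ[ℝ] x)

variable {L B}

theorem tmul_add (l : L.carrier) (x y : B.carrier) :
    tmul L B l (x + y) = tmul L B l x + tmul L B l y := by
  rw [tmul, TensorProduct.tmul_add, map_add]; rfl

theorem add_tmul (l l' : L.carrier) (x : B.carrier) :
    tmul L B (l + l') x = tmul L B l x + tmul L B l' x := by
  rw [tmul, TensorProduct.add_tmul, map_add]; rfl

@[simp] theorem tmul_zero (l : L.carrier) : tmul L B l 0 = 0 := by
  rw [tmul, TensorProduct.tmul_zero, map_zero]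

@[simp] theorem zero_tmul (x : B.carrier) : tmul L B 0 x = 0 := by
  rw [tmul, TensorProduct.zero_tmul, map_zero]

theorem tmul_smul (c : ℝ) (l : L.carrier) (x : B.carrier) :
    tmul L B l (c • x) = c • tmul L B l x := by
  rw [tmul, TensorProduct.tmul_smul, map_smul]; rfl

theorem tmul_mem {i j : ℤ} {l : L.carrier} {x : B.carrier} (hl : l ∈ L.gr i) (hx : x ∈ B.gr j) :
    tmul L B l x ∈ (L.tensor B).gr (i + j) :=
  GradedTensor.tmul_mem hl hx

theorem tmul_mul_tmul {j k : ℤ} (l : L.carrier) {x : B.carrier} {l' : L.carrier} (x' : B.carrier)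
    (hx : x ∈ B.gr j) (hl : l' ∈ L.gr k) :
    tmul L B l x * tmul L B l' x' = (-1 : ℤˣ) ^ (j * k) • tmul L B (l * l') (x * x') :=
  GradedTensor.tmul_mul_tmul l x' hx hl

/-- An element x of degree 0 passes l without a Koszul sign. -/
theorem one_tmul_mul_tmul {x : B.carrier} (hx : x ∈ B.gr 0) (l : L.carrier) (x' : B.carrier) :
    tmul L B 1 x * tmul L B l x' = tmul L B l (x * x') := by
  induction l using DirectSum.Decomposition.inductionOn L.gr with
  | zero => rw [zero_tmul, mul_zero, zero_tmul]
  | add a b ha hb => rw [add_tmul, mul_add, ha, hb, add_tmul]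
  | @homogeneous j a =>
    rw [tmul_mul_tmul 1 x' hx a.2, zero_mul, uzpow_zero, one_smul, one_mul]

theorem tmul_one_one : tmul L B 1 1 = 1 := rfl

theorem tensor_induction {p : (L.tensor B).carrier → Prop} (zero : p 0)
    (tmul : ∀ l x, p (tmul L B l x)) (add : ∀ x y, p x → p y → p (x + y)) (x) : p x := by
  obtain ⟨x, rfl⟩ := (L.tensorEquiv B).surjective x
  induction x using TensorProduct.induction_on with
  | zero => rw [map_zero]; exact zero
  | tmul l x => exact tmul l x
  | add x y hx hy => rw [map_add]; exact add _ _ hx hy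

variable (L) in
/-- `id ⊗ φ`. -/
def mapRight {C : GradedCommAlg.{w}} (φ : Hom B C) : Hom (L.tensor B) (L.tensor C) :=
  GradedTensor.map φ

@[simp] theorem mapRight_tmul {C : GradedCommAlg.{w}} (φ : Hom B C) (l : L.carrier)
    (x : B.carrier) : mapRight L φ (tmul L B l x) = tmul L C l (φ x) :=
  GradedTensor.map_tmul φ l x

end GradedCommAlg

namespace WeilBasis
open GradedCommAlg (tmul tensorEquiv)

/-- The basis `1` of `ℝ`. -/
def point : WeilBasis GradedCommAlg.point where
  idx := Unit
  basis := (Module.Basis.singleton Unit ℝ : Module.Basis Unit ℝ ℝ)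
  deg _ := 0
  mem _ := (GradedCommAlg.mem_zeroGr (A := ℝ)).2 fun h => absurd rfl h
  unit := ()
  basis_unit := Module.Basis.singleton_apply _ _ _
  deg_eq_zero _ := by simp

/-- The basis `1, ε` of the dual numbers. -/
def dualBasis : Module.Basis (Fin 2) ℝ GradedCommAlg.D.carrier :=
  (Module.Basis.finTwoProd ℝ : Module.Basis (Fin 2) ℝ (ℝ × ℝ))

theorem dualBasis_zero : dualBasis 0 = 1 := Module.Basis.finTwoProd_zero ℝ

theorem dualBasis_one : dualBasis 1 = (TrivSqZeroExt.inr 1 : DualNumber ℝ) :=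
  Module.Basis.finTwoProd_one ℝ

theorem dualBasis_mem (i : Fin 2) : dualBasis i ∈ GradedCommAlg.D.gr (-((i : ℕ) : ℤ)) := by
  fin_cases i
  · change dualBasis 0 ∈ _
    rw [dualBasis_zero]
    exact GradedCommAlg.inl_mem_dualGr 1
  · change dualBasis 1 ∈ _
    rw [dualBasis_one]
    exact GradedCommAlg.inr_mem_dualGr 1

/-- The products of the elements of a basis of `L` with `1` and `ε`. -/
def tensorD {L : GradedCommAlg.{0}} (b : WeilBasis L) : WeilBasis (L.tensor GradedCommAlg.D) where
  idx := b.idx × Fin 2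
  basis := (b.basis.tensorProduct dualBasis).map (tensorEquiv L GradedCommAlg.D)
  deg i := b.deg i.1 + i.2
  mem i := by
    have h := GradedCommAlg.tmul_mem (b.mem i.1) (dualBasis_mem i.2)
    rw [Module.Basis.map_apply, Module.Basis.tensorProduct_apply']
    push_cast
    rw [neg_add]
    exact h
  unit := (b.unit, 0)
  basis_unit := by
    rw [Module.Basis.map_apply, Module.Basis.tensorProduct_apply, b.basis_unit, dualBasis_zero]
    rfl
  deg_eq_zero i := by
    rw [Nat.add_eq_zero_iff, b.deg_eq_zero, Prod.ext_iff]
    exact and_congr Iff.rfl (by rw [Fin.ext_iff]; rfl)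

/-- The basis of `C(D^{×k})` by the products of distinct generators. -/
def Dpow : ∀ k, WeilBasis (GradedCommAlg.Dpow k)
  | 0 => point
  | k + 1 => tensorD (Dpow k)

/-- Pascal's rule: a product of generators for k + 1 either omits or contains the last ε, and
containing it raises `deg` by one. -/
theorem card_Dpow (k d : ℕ) : Fintype.card {i : (Dpow k).idx // (Dpow k).deg i = d} = k.choose d := by
  classical
  induction k generalizing d with
  | zero =>
    change Fintype.card {i : Unit // 0 = d} = _
    cases d with
    | zero => simp
    | succ d => simp
  | succ k ih =>
    change Fintype.card {i : (Dpow k).idx × Fin 2 // (Dpow k).deg i.1 + (i.2 : ℕ) = d} = _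
    rw [Fintype.card_subtype, Finset.card_filter, Fintype.sum_prod_type]
    simp only [Fin.sum_univ_two, Fin.val_zero, Fin.val_one, add_zero, Finset.sum_add_distrib]
    rw [← Finset.card_filter, ← Finset.card_filter, ← Fintype.card_subtype, ih]
    cases d with
    | zero => simp
    | succ d =>
      simp only [add_left_inj]
      rw [← Fintype.card_subtype, ih, Nat.choose_succ_succ, add_comm]

section coord
variable {L : GradedCommAlg.{u}} (b : WeilBasis L) {B : GradedCommAlg.{v}} {C : GradedCommAlg.{w}}

/-- Projection to degree m fixes l, and it kills every basis element of another degree. -/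
theorem repr_eq_zero {l : L.carrier} {m : ℤ} (hl : l ∈ L.gr m) {i : b.idx}
    (hi : m ≠ -(b.deg i : ℤ)) : b.basis.repr l i = 0 := by
  classical
  let l' : L.carrier := ∑ j, (if m = -(b.deg j : ℤ) then b.basis.repr l j else 0) • b.basis j
  have h : l = l' := by
    have h1 := DirectSum.decompose_of_mem_same L.gr hl
    nth_rewrite 1 [← b.basis.sum_repr l] at h1
    rw [← h1, DirectSum.decompose_sum]
    rw [DFinsupp.finsetSum_apply, AddSubmonoidClass.coe_finsetSum]
    refine Finset.sum_congr rfl fun j _ => ?_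
    rw [DirectSum.decompose_smul]
    change b.basis.repr l j • ((DirectSum.decompose L.gr (b.basis j) m : L.gr m) : L.carrier) = _
    split_ifs with hj
    · rw [hj, DirectSum.decompose_of_mem_same _ (b.mem j)]
    · rw [DirectSum.decompose_of_mem_ne _ (b.mem j) (Ne.symm hj), smul_zero, zero_smul]
  rw [h, b.basis.repr_sum_self, if_neg hi]

/-- The coordinates of an element of `L ⊗ B` with respect to a basis of `L`. -/
def coord (i : b.idx) : (L.tensor B).carrier →ₗ[ℝ] B.carrier :=
  (TensorProduct.lid ℝ B.carrier).toLinearMap ∘ₗ (b.basis.coord i).rTensor B.carrier ∘ₗ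
    (tensorEquiv L B).symm.toLinearMap

theorem coord_tmul (i : b.idx) (l : L.carrier) (x : B.carrier) :
    b.coord i (tmul L B l x) = b.basis.repr l i • x := by
  rw [tmul, coord, LinearMap.comp_apply, LinearMap.comp_apply, LinearEquiv.coe_coe,
    LinearEquiv.coe_coe, LinearEquiv.symm_apply_apply, LinearMap.rTensor_tmul,
    TensorProduct.lid_tmul, Module.Basis.coord_apply]

theorem sum_coord (x : (L.tensor B).carrier) :
    ∑ i, tmul L B (b.basis i) (b.coord i x) = x := by
  induction x using GradedCommAlg.tensor_induction with
  | zero => simp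
  | tmul l x =>
    simp only [coord_tmul, GradedCommAlg.tmul_smul]
    nth_rewrite 2 [← b.basis.sum_repr l]
    simp only [tmul, TensorProduct.sum_tmul, map_sum, ← TensorProduct.smul_tmul', map_smul]
  | add x y hx hy => simp only [map_add, GradedCommAlg.tmul_add, Finset.sum_add_distrib, hx, hy]

theorem ext_coord {x y : (L.tensor B).carrier} (h : ∀ i, b.coord i x = b.coord i y) : x = y := by
  rw [← b.sum_coord x, ← b.sum_coord y]
  simp only [h]

theorem coord_sum_tmul [DecidableEq b.idx] (c : b.idx → B.carrier) (i : b.idx) :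
    b.coord i (∑ j, tmul L B (b.basis j) (c j)) = c i := by
  simp [coord_tmul, Finsupp.single_apply]

theorem coord_mapRight (φ : GradedCommAlg.Hom B C) (i : b.idx) (x : (L.tensor B).carrier) :
    b.coord i (GradedCommAlg.mapRight L φ x) = φ (b.coord i x) := by
  induction x using GradedCommAlg.tensor_induction with
  | zero => simp
  | tmul l x => rw [GradedCommAlg.mapRight_tmul, coord_tmul, coord_tmul, map_smul]
  | add x y hx hy => rw [map_add, map_add, hx, hy, map_add, map_add]

/-- The basis element with index i has degree -`deg i`, so its coefficient must compensate by +`deg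
i`. In total degree 0 the coefficient sits exactly in degree `deg i`. -/
theorem coord_mem {n : ℤ} {x : (L.tensor B).carrier} (hx : x ∈ (L.tensor B).gr n) (i : b.idx) :
    b.coord i x ∈ B.gr (n + b.deg i) := by
  induction hx using Submodule.span_induction with
  | zero => rw [map_zero]; exact zero_mem _
  | add x y _ _ h h' => rw [map_add]; exact add_mem h h'
  | smul c x _ h => rw [map_smul]; exact Submodule.smul_mem _ _ h
  | mem x hx =>
    obtain ⟨k, j, l, y, rfl, hl, hy, rfl⟩ := hx
    change b.coord i (tmul L B l y) ∈ _
    rw [coord_tmul]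
    by_cases hk : k = -(b.deg i : ℤ)
    · rw [hk, add_assoc, add_comm j, ← add_assoc, neg_add_cancel, zero_add]
      exact Submodule.smul_mem _ _ hy
    · rw [b.repr_eq_zero hl hk, zero_smul]
      exact zero_mem _

theorem mem_of_coord {n : ℤ} {x : (L.tensor B).carrier}
    (hx : ∀ i, b.coord i x ∈ B.gr (n + b.deg i)) : x ∈ (L.tensor B).gr n := by
  rw [← b.sum_coord x]
  refine sum_mem fun i _ => ?_
  have := GradedCommAlg.tmul_mem (b.mem i) (hx i)
  rwa [add_comm n, neg_add_cancel_left] at this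

theorem coord_one_tmul_mul {c : B.carrier} (hc : c ∈ B.gr 0) (x : (L.tensor B).carrier)
    (i : b.idx) : b.coord i (tmul L B 1 c * x) = c * b.coord i x := by
  induction x using GradedCommAlg.tensor_induction with
  | zero => simp
  | tmul l x => rw [GradedCommAlg.one_tmul_mul_tmul hc, coord_tmul, coord_tmul, mul_smul_comm]
  | add x y hx hy => rw [mul_add, map_add, hx, hy, map_add, mul_add]

/-- The elements of `L ⊗ B` without terms of `L`-degree greater than `-d`. -/
def fil (B : GradedCommAlg.{v}) (d : ℕ) : Submodule ℝ (L.tensor B).carrier where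
  carrier := {x | ∀ i, b.deg i < d → b.coord i x = 0}
  add_mem' h h' i hi := by rw [map_add, h i hi, h' i hi, add_zero]
  zero_mem' i _ := map_zero _
  smul_mem' c x h i hi := by rw [map_smul, h i hi, smul_zero]

theorem mem_fil_zero (x : (L.tensor B).carrier) : x ∈ b.fil B 0 := fun _ h => absurd h (by simp)

theorem fil_anti {d e : ℕ} (h : d ≤ e) : b.fil B e ≤ b.fil B d := fun _ hx i hi =>
  hx i (hi.trans_le h)

/-- A product of two basis elements is homogeneous, with `deg` the sum of the two, so it has
coordinates only at that `deg`. -/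
theorem mul_mem_fil {d e : ℕ} {x y : (L.tensor B).carrier} (hx : x ∈ b.fil B d)
    (hy : y ∈ b.fil B e) : x * y ∈ b.fil B (d + e) := by
  have key : ∀ (i j : b.idx) (u v : B.carrier),
      tmul L B (b.basis i) u * tmul L B (b.basis j) v ∈ b.fil B (b.deg i + b.deg j) := by
    intro i j u v
    induction u using DirectSum.Decomposition.inductionOn B.gr with
    | zero => rw [GradedCommAlg.tmul_zero, zero_mul]; exact zero_mem _
    | add u u' h h' => rw [GradedCommAlg.tmul_add, add_mul]; exact add_mem h h'
    | @homogeneous m u =>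
      rw [GradedCommAlg.tmul_mul_tmul _ _ u.2 (b.mem j)]
      apply units_smul_mem
      intro l hl
      rw [coord_tmul, b.repr_eq_zero (SetLike.mul_mem_graded (b.mem i) (b.mem j)), zero_smul]
      omega
  rw [← b.sum_coord x, ← b.sum_coord y, Finset.sum_mul_sum]
  refine sum_mem fun i _ => sum_mem fun j _ => ?_
  by_cases hi : b.deg i < d
  · rw [hx i hi, GradedCommAlg.tmul_zero, zero_mul]; exact zero_mem _
  by_cases hj : b.deg j < e
  · rw [hy j hj, GradedCommAlg.tmul_zero, mul_zero]; exact zero_mem _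
  exact b.fil_anti (by omega) (key i j _ _)

/-- The only basis element with `deg` 0 is 1, so removing its term leaves the part in the
augmentation ideal of L. -/
theorem sub_unit_mem_fil (x : (L.tensor B).carrier) :
    x - tmul L B 1 (b.coord b.unit x) ∈ b.fil B 1 := by
  intro i hi
  obtain rfl : i = b.unit := (b.deg_eq_zero i).1 (by omega)
  rw [map_sub, coord_tmul, ← b.basis_unit, Module.Basis.repr_self, Finsupp.single_eq_same, one_smul,
    sub_self]

theorem deg_unit : b.deg b.unit = 0 := (b.deg_eq_zero _).2 rfl

theorem coord_unit_mem {x : (L.tensor B).carrier} (hx : x ∈ (L.tensor B).gr 0) :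
    b.coord b.unit x ∈ B.gr 0 := by
  simpa [b.deg_unit] using b.coord_mem hx b.unit

/-- The coefficient of 1 is reduction modulo the augmentation ideal of L. Applied to a morphism from
C^∞(M), it yields the underlying morphism φ. -/
theorem coord_unit_mul {x y : (L.tensor B).carrier} (hx : x ∈ (L.tensor B).gr 0) :
    b.coord b.unit (x * y) = b.coord b.unit x * b.coord b.unit y := by
  have h := b.mul_mem_fil (b.sub_unit_mem_fil x) (b.mem_fil_zero y) b.unit
    (by rw [b.deg_unit]; norm_num)
  rwa [sub_mul, map_sub, b.coord_one_tmul_mul (b.coord_unit_mem hx), sub_eq_zero] at h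

end coord
end WeilBasis

end

/-! ### Extension of germs, local frames, and characters of C^∞(M) -/

noncomputable section

section Bump
variable {n : ℕ} {M : Type u} [TopologicalSpace M] [ChartedSpace (EuclideanSpace ℝ (Fin n)) M]
  [IsManifold (𝓡 n) ∞ M] [T2Space M]

theorem exists_bump {p : M} {U : Set M} (hU : U ∈ 𝓝 p) :
    ∃ χ : C^∞⟮𝓡 n, M; ℝ⟯, (∀ᶠ x in 𝓝 p, χ x = 1) ∧ tsupport χ ⊆ U := by
  obtain ⟨f, -, hf⟩ := (SmoothBumpFunction.nhds_basis_tsupport (I := 𝓡 n) p).mem_iff.1 hU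
  exact ⟨⟨f, f.contMDiff⟩, f.eventuallyEq_one, hf⟩

/-- A germ of a smooth function extends to a smooth function. -/
theorem exists_smooth_eventuallyEq {p : M} {f : M → ℝ}
    (hf : ∀ᶠ x in 𝓝 p, ContMDiffAt (𝓡 n) 𝓘(ℝ) ∞ f x) :
    ∃ F : C^∞⟮𝓡 n, M; ℝ⟯, ∀ᶠ x in 𝓝 p, F x = f x := by
  obtain ⟨χ, hχ, hs⟩ := exists_bump (n := n) hf
  refine ⟨⟨fun x => χ x • f x, contMDiff_of_tsupport fun x hx => ?_⟩, ?_⟩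
  · exact χ.contMDiff.contMDiffAt.smul (hs (tsupport_smul_subset_left _ _ hx))
  · filter_upwards [hχ] with x hx
    change χ x • f x = f x
    rw [hx, one_smul]

/-- A germ of a smooth section extends to a smooth section. -/
theorem exists_section_eventuallyEq {F : Type*} [NormedAddCommGroup F] [NormedSpace ℝ F]
    {V : M → Type*} [TopologicalSpace (Bundle.TotalSpace F V)] [∀ x, AddCommGroup (V x)]
    [∀ x, Module ℝ (V x)] [∀ x, TopologicalSpace (V x)] [FiberBundle F V] [VectorBundle ℝ F V]
    {p : M} {s : ∀ x, V x}
    (hs : ∀ᶠ x in 𝓝 p, ContMDiffAt (𝓡 n) ((𝓡 n).prod 𝓘(ℝ, F)) ∞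
      (fun x => (⟨x, s x⟩ : Bundle.TotalSpace F V)) x) :
    ∃ S : Cₛ^∞⟮𝓡 n; F, V⟯, ∀ᶠ x in 𝓝 p, S x = s x := by
  obtain ⟨U, hU, hUo, hp⟩ := eventually_nhds_iff.1 hs
  obtain ⟨χ, hχ, hsupp⟩ := exists_bump (n := n) (hUo.mem_nhds hp)
  refine ⟨⟨fun x => χ x • s x, ?_⟩, ?_⟩
  · exact (ContMDiffOn.smul_section_of_tsupport (I := 𝓡 n) (V := V) (ψ := χ) (s := s)
      χ.contMDiff.contMDiffOn hUo hsupp fun x hx => (hU x hx).contMDiffWithinAt)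
  · filter_upwards [hχ] with x hx
    change χ x • s x = s x
    rw [hx, one_smul]

end Bump

namespace SmoothVB
variable {n : ℕ} {M : Type u} [TopologicalSpace M] [ChartedSpace (EuclideanSpace ℝ (Fin n)) M]
  [IsManifold (𝓡 n) ∞ M] [T2Space M]

/-- The product of a function and a section of the dual bundle. -/
def smulSection {V : SmoothVB n M} (f : C^∞⟮𝓡 n, M; ℝ⟯) (σ : V.DualSection) : V.DualSection :=
  ⟨fun x => f x • σ x, f.contMDiff.smul_section σ.contMDiff⟩

@[simp] theorem smulSection_apply {V : SmoothVB n M} (f : C^∞⟮𝓡 n, M; ℝ⟯) (σ : V.DualSection)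
    (x : M) : smulSection f σ x = f x • σ x := rfl

/-- Sections of the dual bundle that form a frame near `p`, with their coefficients. -/
theorem exists_dual_frame (V : SmoothVB n M) (p : M) :
    ∃ (m : ℕ) (e : Fin m → V.DualSection) (c : ∀ x, V.Dual x →ₗ[ℝ] (Fin m → ℝ)),
      ∀ σ : V.DualSection, ∃ a : Fin m → C^∞⟮𝓡 n, M; ℝ⟯, ∀ᶠ x in 𝓝 p,
        (∀ i, a i x = c x (σ x) i) ∧ σ x = ∑ i, a i x • e i x := by
  let F := V.model →L[ℝ] ℝ
  let t := trivializationAt F V.Dual p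
  let b : Module.Basis (Fin (Module.finrank ℝ F)) ℝ F := Module.finBasis ℝ F
  have hp : p ∈ t.baseSet := FiberBundle.mem_baseSet_trivializationAt F V.Dual p
  have hmem : ∀ᶠ x in 𝓝 p, x ∈ t.baseSet := t.open_baseSet.mem_nhds hp
  have h1 : ∀ i, ∃ S : V.DualSection, ∀ᶠ x in 𝓝 p, S x = t.localFrame b i x := fun i =>
    exists_section_eventuallyEq (n := n) (hmem.mono fun x hx =>
      contMDiffAt_localFrame_of_mem (I := 𝓡 n) ∞ t b i hx)
  choose e he using h1
  -- The coefficient functionals are given at every x, but they are related to the frame only near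
  -- p.
  refine ⟨_, e, fun x => LinearMap.pi fun i => t.localFrameCoeff (𝓡 n) b i x, fun σ => ?_⟩
  have h2 : ∀ i, ∃ a : C^∞⟮𝓡 n, M; ℝ⟯, ∀ᶠ x in 𝓝 p,
      a x = t.localFrameCoeff (𝓡 n) b i x (σ x) := fun i =>
    exists_smooth_eventuallyEq (n := n) (hmem.mono fun x hx =>
      contMDiffAt_localFrameCoeff (I := 𝓡 n) b hx σ.contMDiff.contMDiffAt i)
  choose a ha using h2
  refine ⟨a, ?_⟩
  filter_upwards [Filter.eventually_all.2 ha, Filter.eventually_all.2 he, hmem] with x h h' hx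
  refine ⟨h, ?_⟩
  rw [t.eq_sum_localFrameCoeff_smul (I := 𝓡 n) (b := b) (s := σ) hx]
  simp only [h, h']

end SmoothVB

section Milnor
variable {n : ℕ} {M : Type u} [TopologicalSpace M] [ChartedSpace (EuclideanSpace ℝ (Fin n)) M]
  [IsManifold (𝓡 n) ∞ M] [T2Space M] [SecondCountableTopology M]

/-- A smooth function with compact sublevel sets. -/
theorem exists_smooth_exhaustion (n : ℕ) (M : Type u) [TopologicalSpace M]
    [ChartedSpace (EuclideanSpace ℝ (Fin n)) M] [IsManifold (𝓡 n) ∞ M] [T2Space M]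
    [SecondCountableTopology M] : ∃ h : C^∞⟮𝓡 n, M; ℝ⟯, ∀ c : ℝ, IsCompact {x | h x ≤ c} := by
  have : LocallyCompactSpace M := ChartedSpace.locallyCompactSpace (EuclideanSpace ℝ (Fin n)) M
  let K : CompactExhaustion M := CompactExhaustion.choice M
  obtain ⟨h, hh⟩ := exists_contMDiffMap_forall_mem_convex_of_local_const (𝓡 n) (n := ⊤)
    (t := fun x : M => Set.Ici (K.find x : ℝ)) (fun x => convex_Ici _) (fun x => by
      -- Near x the index of the first exhausting compact set containing y is at most one more than
      -- that of x, so this constant lies in the convex set attached to each such y.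
      refine ⟨(K.find x + 1 : ℕ), ?_⟩
      have hx : interior (K (K.find x + 1)) ∈ 𝓝 x :=
        isOpen_interior.mem_nhds (K.subset_interior_succ _ (K.mem_find x))
      filter_upwards [hx] with y hy
      exact Set.mem_Ici.2 (Nat.cast_le.2 (K.mem_iff_find_le.1 (interior_subset hy))))
  refine ⟨h, fun c => ?_⟩
  refine (K.isCompact ⌊c⌋₊).of_isClosed_subset (isClosed_le h.contMDiff.continuous
    continuous_const) fun x hx => ?_
  exact K.mem_iff_find_le.2 (Nat.le_floor ((hh x).trans hx))

/-- A smooth function without zeros is a unit. -/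
theorem isUnit_of_forall_ne_zero {f : C^∞⟮𝓡 n, M; ℝ⟯} (hf : ∀ x, f x ≠ 0) : IsUnit f := by
  refine IsUnit.of_mul_eq_one ⟨fun x => (f x)⁻¹, fun x => ?_⟩ ?_
  · exact (f.contMDiff x).inv₀ (hf x)
  · ext x
    exact mul_inv_cancel₀ (hf x)

/-- Every character of the algebra of smooth functions is the evaluation at a point. -/
theorem exists_eq_eval (φ : C^∞⟮𝓡 n, M; ℝ⟯ →ₐ[ℝ] ℝ) : ∃ p : M, ∀ f, φ f = f p := by
  by_contra! hcon
  choose f hf using hcon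
  obtain ⟨h, hh⟩ := exists_smooth_exhaustion n M
  -- The function g p lies in the kernel of φ, is nonnegative, and is nonzero at p since φ is not
  -- the evaluation there.
  let g : M → C^∞⟮𝓡 n, M; ℝ⟯ := fun p => (f p - algebraMap ℝ _ (φ (f p))) ^ 2
  have hg : ∀ p, φ (g p) = 0 := fun p => by simp [g]
  have hg' : ∀ p x, g p x = (f p x - φ (f p)) ^ 2 := fun p x => rfl
  obtain ⟨t, -, ht⟩ := (hh (φ h)).elim_nhds_subcover (fun p => {x | g p x ≠ 0}) fun p _ => by
    refine (isOpen_ne_fun (g p).contMDiff.continuous continuous_const).mem_nhds ?_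
    change g p p ≠ 0
    rw [hg']
    exact pow_ne_zero _ (sub_ne_zero.2 (Ne.symm (hf p)))
  -- Off the compact sublevel set h ≤ φ h the first square is positive; on it one of finitely many g
  -- p is. So G is a unit in the kernel of φ, a contradiction.
  let G : C^∞⟮𝓡 n, M; ℝ⟯ := (h - algebraMap ℝ _ (φ h)) ^ 2 + ∑ p ∈ t, g p
  have hG : φ G = 0 := by simp [G, hg]
  have hGx : ∀ x, G x = (h x - φ h) ^ 2 + ∑ p ∈ t, g p x := by
    intro x
    change ((h - algebraMap ℝ _ (φ h)) ^ 2 + ∑ p ∈ t, g p : C^∞⟮𝓡 n, M; ℝ⟯) x = _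
    rw [ContMDiffMap.coe_add, Pi.add_apply]
    congr 1
    exact map_sum (ContMDiffMap.evalRingHom (n := ∞) (I := 𝓡 n) (I' := 𝓘(ℝ)) (R := ℝ) x) _ _
  refine (isUnit_of_forall_ne_zero (f := G) fun x => ?_).map φ |>.ne_zero hG
  rw [hGx]
  have h0 : ∀ p ∈ t, 0 ≤ g p x := fun p _ => by rw [hg']; positivity
  by_cases hx : h x ≤ φ h
  · obtain ⟨p, hp, hpx⟩ : ∃ p ∈ t, g p x ≠ 0 := by simpa using ht hx
    have := Finset.single_le_sum h0 hp
    have h3 : 0 < g p x := lt_of_le_of_ne (h0 p hp) (Ne.symm hpx)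
    exact ne_of_gt (add_pos_of_nonneg_of_pos (sq_nonneg _) (h3.trans_le this))
  · have : 0 < (h x - φ h) ^ 2 := by
      have : 0 < h x - φ h := by linarith
      positivity
    exact ne_of_gt (add_pos_of_pos_of_nonneg this (Finset.sum_nonneg h0))

end Milnor

end

/-! ### Hadamard's lemma and local coordinates -/

noncomputable section

open MeasureTheory in
/-- Hadamard's lemma. -/
theorem exists_hadamard {n : ℕ} {G : EuclideanSpace ℝ (Fin n) → ℝ} (hG : ContDiff ℝ ∞ G)
    (h0 : G 0 = 0) : ∃ h : Fin n → EuclideanSpace ℝ (Fin n) → ℝ, (∀ i, ContDiff ℝ ∞ (h i)) ∧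
      ∀ z, G z = ∑ i, z i * h i z := by
  let E := EuclideanSpace ℝ (Fin n)
  -- The bump is 1 on [-1, 1] and supported in [-2, 2]. It makes the integrand compactly supported
  -- in s without changing it where |s| ≤ 1.
  let ψ : ContDiffBump (0 : ℝ) := ⟨1, 2, one_pos, one_lt_two⟩
  have hG' : ContDiff ℝ ∞ (fderiv ℝ G) := hG.fderiv_right (by simp)
  let g : Fin n → E → ℝ → ℝ := fun i z s =>
    ψ s * fderiv ℝ G (-s • z) (EuclideanSpace.single i 1)
  have hg : ∀ i, ContDiff ℝ ∞ (Function.uncurry (g i)) := fun i => by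
    refine (ψ.contDiff.comp contDiff_snd).mul ?_
    exact (hG'.comp ((contDiff_snd.neg).smul contDiff_fst)).clm_apply contDiff_const
  let f : ℝ → ℝ := Set.indicator (Set.Ioc 0 1) fun _ => 1
  have hf : LocallyIntegrable f volume :=
    ((integrable_indicator_iff measurableSet_Ioc).2 (by simp)).locallyIntegrable
  refine ⟨fun i z => ∫ t in (0 : ℝ)..1, fderiv ℝ G (t • z) (EuclideanSpace.single i 1),
    fun i => ?_, fun z => ?_⟩
  -- Smoothness of ∫₀¹ ∂_iG(tz) dt in z: the integral is the value at 0 of the convolution of the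
  -- indicator of (0, 1] with `g i z`, and convolutions depend smoothly on parameters.
  · have key := contDiffOn_convolution_right_with_param_comp (μ := volume) (n := ⊤)
      (ContinuousLinearMap.mul ℝ ℝ) (s := Set.univ) (v := fun _ : E => (0 : ℝ)) contDiffOn_const
      (f := f) (g := g i) (k := Metric.closedBall 0 2) isOpen_univ (isCompact_closedBall 0 2)
      (fun z x _ hx => by
        have : ψ x = 0 := ψ.zero_of_le_dist (by
          change (2 : ℝ) ≤ _
          simpa using (not_le.1 (fun h => hx (Metric.mem_closedBall.2 h))).le)
        simp [g, this]) hf (hg i).contDiffOn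
    rw [contDiffOn_univ] at key
    convert key using 2 with z
    beta_reduce
    rw [convolution, intervalIntegral.integral_of_le zero_le_one,
      ← integral_indicator measurableSet_Ioc]
    congr 1
    funext t
    by_cases ht : t ∈ Set.Ioc (0 : ℝ) 1
    · have : ψ (-t) = 1 := ψ.one_of_mem_closedBall (by
        rw [Metric.mem_closedBall, dist_zero_right, norm_neg, Real.norm_eq_abs, abs_of_pos ht.1]
        exact ht.2)
      simp only [f, ht, g, this, Set.indicator_of_mem, zero_sub, neg_neg, ContinuousLinearMap.mul_apply',
        one_mul]
    · simp [f, ht]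
  · have h1 : ∀ t ∈ Set.uIcc (0 : ℝ) 1,
        HasDerivAt (fun t : ℝ => G (t • z)) (fderiv ℝ G (t • z) z) t := fun t _ => by
      have := (hG.differentiable (by simp) (t • z)).hasFDerivAt.comp_hasDerivAt t
        ((hasDerivAt_id t).smul_const z)
      rw [one_smul] at this
      exact this
    have hc : ∀ v : E, Continuous fun t : ℝ => fderiv ℝ G (t • z) v := fun v =>
      (hG'.continuous.comp (continuous_id.smul continuous_const)).clm_apply continuous_const
    have h2 := intervalIntegral.integral_eq_sub_of_hasDerivAt h1 ((hc z).intervalIntegrable 0 1)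
    rw [one_smul, zero_smul, h0, sub_zero] at h2
    rw [← h2]
    have h3 : ∀ t : ℝ, fderiv ℝ G (t • z) z =
        ∑ i, z i * fderiv ℝ G (t • z) (EuclideanSpace.single i 1) := by
      intro t
      have hz : z = ∑ i, z i • EuclideanSpace.single i (1 : ℝ) := by
        ext j; simp [Pi.single_apply]
      conv_lhs => rw [hz]
      rw [map_sum]
      refine Finset.sum_congr rfl fun i _ => ?_
      rw [← hz, map_smul, smul_eq_mul]
    simp only [h3]
    have h4 := intervalIntegral.integral_finsetSum (μ := volume) (a := 0) (b := 1)
      (s := Finset.univ)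
      (f := fun i t => z i * fderiv ℝ G (t • z) (EuclideanSpace.single i 1)) fun i _ =>
      (continuous_const.mul (hc _)).intervalIntegrable 0 1
    rw [h4]
    simp only [intervalIntegral.integral_const_mul]

section Coordinates
variable {n : ℕ} {M : Type u} [TopologicalSpace M] [ChartedSpace (EuclideanSpace ℝ (Fin n)) M]
  [IsManifold (𝓡 n) ∞ M]

theorem contMDiff_mvfderiv {f : M → ℝ} (hf : ContMDiff (𝓡 n) 𝓘(ℝ) ∞ f) :
    ContMDiff (𝓡 n) ((𝓡 n).prod 𝓘(ℝ, EuclideanSpace ℝ (Fin n) →L[ℝ] ℝ)) ∞ (fun x =>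
      (⟨x, mvfderiv (𝓡 n) f x⟩ : Bundle.TotalSpace (EuclideanSpace ℝ (Fin n) →L[ℝ] ℝ)
        (fun x : M => TangentSpace (𝓡 n) x →L[ℝ] Bundle.Trivial M ℝ x))) := fun x₀ => by
  refine (contMDiffAt_hom_bundle _).2 ⟨contMDiffAt_id, ?_⟩
  have h := (hf x₀).mfderiv_const (m := ∞) (by simp)
  convert h using 1
  funext x
  ext v
  simp [inTangentCoordinates, ContinuousLinearMap.inCoordinates, mvfderiv]
  rfl

/-- The differential of a smooth function, as a section of the cotangent bundle. -/
def differential (f : C^∞⟮𝓡 n, M; ℝ⟯) : (SmoothVB.tangent n M).DualSection :=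
  ⟨fun x => mvfderiv (𝓡 n) f x, contMDiff_mvfderiv f.contMDiff⟩

theorem differential_apply (f : C^∞⟮𝓡 n, M; ℝ⟯) (x : M) :
    differential f x = mvfderiv (𝓡 n) f x := rfl

theorem differential_add (f g : C^∞⟮𝓡 n, M; ℝ⟯) :
    differential (f + g) = differential f + differential g := by
  ext1 x
  exact mvfderiv_add (f.contMDiff.mdifferentiable (by simp) x)
    (g.contMDiff.mdifferentiable (by simp) x)

theorem differential_mul (f g : C^∞⟮𝓡 n, M; ℝ⟯) :
    differential (f * g) = SmoothVB.smulSection f (differential g) +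
      SmoothVB.smulSection g (differential f) := by
  ext1 x
  exact mvfderiv_mul (f.contMDiff.mdifferentiable (by simp) x)
    (g.contMDiff.mdifferentiable (by simp) x)

theorem differential_const (c : ℝ) :
    differential (algebraMap ℝ C^∞⟮𝓡 n, M; ℝ⟯ c) = 0 := by
  ext1 x
  exact mvfderiv_const c

theorem differential_congr {f g : C^∞⟮𝓡 n, M; ℝ⟯} {p : M} (h : ∀ᶠ x in 𝓝 p, f x = g x) :
    ∀ᶠ x in 𝓝 p, differential f x = differential g x := by
  filter_upwards [h.eventually_nhds] with x hx
  rw [differential_apply, differential_apply, mvfderiv, mvfderiv, Filter.EventuallyEq.mfderiv_eq hx,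
    hx.self_of_nhds]

theorem localFrame_expansion {F : Type*} [NormedAddCommGroup F] [NormedSpace ℝ F]
    {V : M → Type*} [TopologicalSpace (Bundle.TotalSpace F V)] [∀ x, AddCommGroup (V x)]
    [∀ x, Module ℝ (V x)] [∀ x, TopologicalSpace (V x)] [FiberBundle F V] [VectorBundle ℝ F V]
    [ContMDiffVectorBundle 1 F V (𝓡 n)]
    (t : Bundle.Trivialization F (Bundle.TotalSpace.proj : Bundle.TotalSpace F V → M))
    [MemTrivializationAtlas t] {ι : Type*} [Fintype ι] (b : Module.Basis ι ℝ F) {x : M}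
    (hx : x ∈ t.baseSet) (v : V x) :
    v = ∑ i, b.repr (t.continuousLinearMapAt ℝ x v) i • t.localFrame b i x := by
  classical
  -- The vector v is extended to the section that vanishes away from x; no continuity is needed for
  -- a pointwise expansion.
  have h := t.eq_sum_localFrameCoeff_smul (I := 𝓡 n) (b := b) (s := Function.update 0 x v) hx
  rw [Function.update_self] at h
  nth_rewrite 1 [h]
  refine Finset.sum_congr rfl fun i _ => ?_
  have h' := t.localFrameCoeff_eq_coeff (I := 𝓡 n) (b := b) (s := Function.update 0 x v) (i := i) hx
  beta_reduce at h'
  rw [Function.update_self] at h'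
  rw [h', t.continuousLinearMapAt_apply_of_mem (R := ℝ) hx]

variable [T2Space M]

/-- The frame of the tangent bundle dual to the differentials of local coordinates. -/
theorem exists_frame_of_coordinates {p : M} (X : Fin n → C^∞⟮𝓡 n, M; ℝ⟯)
    (hX : ∀ i, ∀ᶠ x in 𝓝 p, X i x = (extChartAt (𝓡 n) p x - extChartAt (𝓡 n) p p) i) :
    ∃ e : Fin n → ∀ x : M, TangentSpace (𝓡 n) x,
      (∀ i, ∀ᶠ x in 𝓝 p, ContMDiffAt (𝓡 n) ((𝓡 n).prod 𝓘(ℝ, EuclideanSpace ℝ (Fin n))) ∞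
        (fun x => (⟨x, e i x⟩ : TangentBundle (𝓡 n) M)) x) ∧
      ∀ᶠ x in 𝓝 p, (∀ v, v = ∑ i, mvfderiv (𝓡 n) (X i) x v • e i x) ∧
        ∀ i j, mvfderiv (𝓡 n) (X i) x (e j x) = if j = i then 1 else 0 := by
  let E := EuclideanSpace ℝ (Fin n)
  let t := trivializationAt E (TangentSpace (𝓡 n) : M → Type _) p
  let b : Module.Basis (Fin n) ℝ E := (EuclideanSpace.basisFun (Fin n) ℝ).toBasis
  have hsrc : ∀ᶠ x in 𝓝 p, x ∈ (chartAt (EuclideanSpace ℝ (Fin n)) p).source :=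
    (chartAt _ p).open_source.mem_nhds (mem_chart_source _ p)
  have hmem : ∀ᶠ x in 𝓝 p, x ∈ t.baseSet :=
    t.open_baseSet.mem_nhds (FiberBundle.mem_baseSet_trivializationAt E _ p)
  -- The preferred trivialization of TM at p is the derivative of the chart at p, so dX_i reads off
  -- its i-th component.
  have hd : ∀ᶠ x in 𝓝 p, ∀ i (v : TangentSpace (𝓡 n) x),
      mvfderiv (𝓡 n) (X i) x v = b.repr (t.continuousLinearMapAt ℝ x v) i := by
    filter_upwards [(Filter.eventually_all.2 hX).eventually_nhds, hsrc] with x h2 h4 i v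
    have h5 : HasMFDerivAt (𝓡 n) 𝓘(ℝ, E) (extChartAt (𝓡 n) p) x
        (mfderiv (𝓡 n) 𝓘(ℝ, E) (extChartAt (𝓡 n) p) x) :=
      (mdifferentiableAt_extChartAt h4).hasMFDerivAt
    have h6 : HasFDerivAt (fun z : E => (z - extChartAt (𝓡 n) p p) i)
        (EuclideanSpace.proj i : E →L[ℝ] ℝ) (extChartAt (𝓡 n) p x) :=
      (EuclideanSpace.proj i : E →L[ℝ] ℝ).hasFDerivAt.comp (extChartAt (𝓡 n) p x)
        ((hasFDerivAt_id (extChartAt (𝓡 n) p x)).sub_const (extChartAt (𝓡 n) p p))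
    have h7 := (h6.hasMFDerivAt.comp x h5).congr_of_eventuallyEq
      (f₁ := X i) (h2.mono fun y hy => hy i)
    rw [mvfderiv, h7.mfderiv, TangentBundle.continuousLinearMapAt_trivializationAt h4]
    rfl
  refine ⟨fun i => t.localFrame b i, fun i => hmem.mono fun x hx =>
    contMDiffAt_localFrame_of_mem (I := 𝓡 n) ∞ t b i hx, ?_⟩
  filter_upwards [hd, hmem] with x h2 h3
  have hv := localFrame_expansion (n := n) t b h3
  refine ⟨fun v => ?_, fun i j => ?_⟩
  · simp only [h2]
    exact hv v
  · rw [h2, Bundle.Trivialization.localFrame_apply_of_mem_baseSet _ _ h3,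
      t.continuousLinearMapAt_apply_of_mem (R := ℝ) h3]
    have h4 : (t (⟨x, t.symm x (b j)⟩ : Bundle.TotalSpace E (TangentSpace (𝓡 n) : M → Type _))).2 =
        b j := by rw [t.apply_mk_symm h3]
    have h5 : ((t (⟨x, (t.basisAt b h3) j⟩ :
        Bundle.TotalSpace E (TangentSpace (𝓡 n) : M → Type _))).2) = b j := h4
    rw [h5, Module.Basis.repr_self, Finsupp.single_apply]

/-- Pairing with the dual frame e_i gives the coefficients α(e_i), which are smooth near p.
Evaluating a vanishing combination on e_j isolates its j-th coefficient. -/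
theorem exists_coefficients_of_coordinates {p : M} (X : Fin n → C^∞⟮𝓡 n, M; ℝ⟯)
    (hX : ∀ i, ∀ᶠ x in 𝓝 p, X i x = (extChartAt (𝓡 n) p x - extChartAt (𝓡 n) p p) i)
    {α : ∀ x : M, TangentSpace (𝓡 n) x →L[ℝ] Bundle.Trivial M ℝ x}
    (hα : ContMDiff (𝓡 n) ((𝓡 n).prod 𝓘(ℝ, EuclideanSpace ℝ (Fin n) →L[ℝ] ℝ)) ∞ (fun x =>
      (⟨x, α x⟩ : Bundle.TotalSpace (EuclideanSpace ℝ (Fin n) →L[ℝ] ℝ)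
        (fun x : M => TangentSpace (𝓡 n) x →L[ℝ] Bundle.Trivial M ℝ x)))) :
    (∃ a : Fin n → C^∞⟮𝓡 n, M; ℝ⟯,
      ∀ᶠ x in 𝓝 p, α x = ∑ i, a i x • mvfderiv (𝓡 n) (X i) x) ∧
    ∀ᶠ x in 𝓝 p, ∀ a : Fin n → ℝ, ∑ i, a i • mvfderiv (𝓡 n) (X i) x = 0 → a = 0 := by
  obtain ⟨e, he, hX⟩ := exists_frame_of_coordinates X hX
  have ha : ∀ i, ∃ a : C^∞⟮𝓡 n, M; ℝ⟯, ∀ᶠ x in 𝓝 p, a x = α x (e i x) := fun i =>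
    exists_smooth_eventuallyEq ((he i).mono fun x h1 => by
      have h2 := ContMDiffAt.clm_bundle_apply (F₁ := EuclideanSpace ℝ (Fin n)) (F₂ := ℝ)
        (E₂ := Bundle.Trivial M ℝ) (hα x) h1
      exact (Bundle.contMDiffAt_section _).1 h2)
  choose a ha using ha
  refine ⟨⟨a, ?_⟩, ?_⟩
  · filter_upwards [Filter.eventually_all.2 ha, hX] with x h1 h2
    refine ContinuousLinearMap.ext fun v => ?_
    rw [sum_apply]
    nth_rewrite 1 [h2.1 v]
    rw [map_sum]
    refine Finset.sum_congr rfl fun i _ => ?_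
    rw [map_smul, smul_apply, h1]
    exact mul_comm _ _
  · filter_upwards [hX] with x h2 a ha
    funext j
    have h4 := DFunLike.congr_fun ha (e j x)
    rw [sum_apply] at h4
    have h5 : ∀ i, (a i • mvfderiv (𝓡 n) (X i) x) (e j x) = a i * (if j = i then 1 else 0) := by
      intro i
      rw [smul_apply, h2.2]
      rfl
    simpa [h5] using h4

/-- The centred chart coordinates are only smooth near p; their germs extend after a cutoff. -/
theorem exists_coordinate_functions (n : ℕ) {M : Type u} [TopologicalSpace M]
    [ChartedSpace (EuclideanSpace ℝ (Fin n)) M] [IsManifold (𝓡 n) ∞ M] [T2Space M] (p : M) :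
    ∃ X : Fin n → C^∞⟮𝓡 n, M; ℝ⟯,
      ∀ i, ∀ᶠ x in 𝓝 p, X i x = (extChartAt (𝓡 n) p x - extChartAt (𝓡 n) p p) i := by
  have hsrc : ∀ᶠ x in 𝓝 p, x ∈ (chartAt (EuclideanSpace ℝ (Fin n)) p).source :=
    (chartAt _ p).open_source.mem_nhds (mem_chart_source _ p)
  have hX : ∀ i : Fin n, ∃ X : C^∞⟮𝓡 n, M; ℝ⟯, ∀ᶠ x in 𝓝 p,
      X x = (extChartAt (𝓡 n) p x - extChartAt (𝓡 n) p p) i := fun i =>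
    exists_smooth_eventuallyEq (hsrc.mono fun x hx =>
      ((EuclideanSpace.proj i : EuclideanSpace ℝ (Fin n) →L[ℝ] ℝ).contMDiff.contMDiffAt.comp x
        ((contMDiffAt_extChartAt' hx).sub contMDiffAt_const)))
  choose X hX using hX
  exact ⟨X, hX⟩

/-- Local coordinates at `p`, as globally defined functions: they generate the functions vanishing
at `p`, and their differentials generate the `1`-forms. -/
theorem exists_coordinates (n : ℕ) {M : Type u} [TopologicalSpace M]
    [ChartedSpace (EuclideanSpace ℝ (Fin n)) M] [IsManifold (𝓡 n) ∞ M] [T2Space M] (p : M) :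
    ∃ X : Fin n → C^∞⟮𝓡 n, M; ℝ⟯, (∀ i, X i p = 0) ∧
      (∀ g : C^∞⟮𝓡 n, M; ℝ⟯, g p = 0 → ∃ h : Fin n → C^∞⟮𝓡 n, M; ℝ⟯,
        ∀ᶠ x in 𝓝 p, g x = ∑ i, X i x * h i x) ∧
      (∀ α : (SmoothVB.tangent n M).DualSection, ∃ a : Fin n → C^∞⟮𝓡 n, M; ℝ⟯,
        ∀ᶠ x in 𝓝 p, α x = ∑ i, a i x • differential (X i) x) ∧
      ∀ᶠ x in 𝓝 p, ∀ a : Fin n → ℝ, ∑ i, a i • differential (X i) x = 0 → a = 0 := by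
  have hsrc : ∀ᶠ x in 𝓝 p, x ∈ (chartAt (EuclideanSpace ℝ (Fin n)) p).source :=
    (chartAt _ p).open_source.mem_nhds (mem_chart_source _ p)
  let φ : M → EuclideanSpace ℝ (Fin n) := extChartAt (𝓡 n) p
  have hφ : ∀ᶠ x in 𝓝 p, ContMDiffAt (𝓡 n) 𝓘(ℝ, EuclideanSpace ℝ (Fin n)) ∞ φ x :=
    hsrc.mono fun x hx => contMDiffAt_extChartAt' hx
  obtain ⟨X, hX⟩ := exists_coordinate_functions n p
  refine ⟨X, fun i => by rw [(hX i).self_of_nhds, sub_self]; rfl, fun g hg => ?_, fun α =>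
    (exists_coefficients_of_coordinates (p := p) X hX α.contMDiff).1,
    (exists_coefficients_of_coordinates (p := p) X hX (contMDiff_mvfderiv (0 :
      C^∞⟮𝓡 n, M; ℝ⟯).contMDiff)).2⟩
  · let ψ := (extChartAt (𝓡 n) p).symm
    have ht : ∀ᶠ z in 𝓝 (φ p), z ∈ (extChartAt (𝓡 n) p).target := extChartAt_target_mem_nhds p
    -- The germ of g in the chart is extended to all of Euclidean space, and then translated so that
    -- p sits at the origin, as Hadamard's lemma requires.
    obtain ⟨G, hG⟩ := exists_smooth_eventuallyEq (n := n) (M := EuclideanSpace ℝ (Fin n))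
      (p := φ p) (f := g ∘ ψ) (ht.mono fun z hz =>
        (g.contMDiff.contMDiffAt.comp z ((contMDiffOn_extChartAt_symm p).contMDiffAt
          ((isOpen_extChartAt_target p).mem_nhds hz))))
    have hG' : ContDiff ℝ ∞ fun z => G (z + φ p) :=
      G.contMDiff.contDiff.comp (contDiff_id.add contDiff_const)
    have h0 : G (0 + φ p) = 0 := by
      rw [zero_add, hG.self_of_nhds]
      change g (ψ (φ p)) = 0
      rw [extChartAt_to_inv, hg]
    obtain ⟨h, hh, hsum⟩ := exists_hadamard hG' h0
    have hH : ∀ i, ∃ H : C^∞⟮𝓡 n, M; ℝ⟯, ∀ᶠ x in 𝓝 p, H x = h i (φ x - φ p) := fun i =>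
      exists_smooth_eventuallyEq (hφ.mono fun x hx =>
        (hh i).contMDiff.contMDiffAt.comp x (hx.sub contMDiffAt_const))
    choose H hH using hH
    refine ⟨H, ?_⟩
    have hcont : Filter.Tendsto φ (𝓝 p) (𝓝 (φ p)) := continuousAt_extChartAt p
    filter_upwards [Filter.eventually_all.2 hX, Filter.eventually_all.2 hH, hcont.eventually hG,
      hsrc] with x h1 h2 h3 h4
    have h5 := hsum (φ x - φ p)
    rw [sub_add_cancel, h3] at h5
    simp only [h1, h2]
    rw [← h5]
    change g x = g (ψ (φ x))
    rw [(extChartAt (𝓡 n) p).left_inv (by rwa [extChartAt_source])]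

end Coordinates
end

/-! ### Local morphisms out of smooth sections of S^{≥0}V* -/

noncomputable section

theorem SmoothVB.sum_smulSection_apply {n : ℕ} {M : Type u} [TopologicalSpace M]
    [ChartedSpace (EuclideanSpace ℝ (Fin n)) M] {V : SmoothVB n M} {ι : Type*} (s : Finset ι)
    (a : ι → C^∞⟮𝓡 n, M; ℝ⟯) (e : ι → V.DualSection) (x : M) :
    (∑ i ∈ s, SmoothVB.smulSection (a i) (e i)) x = ∑ i ∈ s, a i x • e i x := by
  classical
  induction s using Finset.induction_on with
  | empty => rfl
  | insert i s hi ih =>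
    rw [Finset.sum_insert hi, Finset.sum_insert hi, ← ih]
    rfl

namespace GradedVB
variable {n : ℕ} {M : Type u} [TopologicalSpace M] [ChartedSpace (EuclideanSpace ℝ (Fin n)) M]

/-- The evaluation of smooth functions at a point. -/
def evalAt (n : ℕ) {M : Type u} [TopologicalSpace M] [ChartedSpace (EuclideanSpace ℝ (Fin n)) M]
    (x : M) : C^∞⟮𝓡 n, M; ℝ⟯ →ₐ[ℝ] ℝ :=
  { ContMDiffMap.evalRingHom (n := ∞) (I := 𝓡 n) (I' := 𝓘(ℝ)) (R := ℝ) x with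
    commutes' := fun _ => rfl }

variable (V : GradedVB n M)

theorem polySections_le_smoothSections : V.polySections ≤ V.smoothSections := fun t ht _ =>
  ⟨t, ht, Filter.Eventually.of_forall fun _ => rfl⟩

/-- A function as a section of `S^{≥0} V^*`. -/
def fnSection : C^∞⟮𝓡 n, M; ℝ⟯ →ₐ[ℝ] ∀ x, V.symFiber x :=
  AlgHom.pi fun x => (Algebra.ofId ℝ (V.symFiber x)).comp (evalAt n x)

theorem fnSection_apply (f : C^∞⟮𝓡 n, M; ℝ⟯) (x : M) :
    V.fnSection f x = algebraMap ℝ (V.symFiber x) (f x) := rfl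

/-- A section of `(V^*)_d` as a section of `S^{≥0} V^*`. -/
def genSection (d : ℤ) : (V (-d)).DualSection →ₗ[ℝ] ∀ x, V.symFiber x where
  toFun σ x := GradedSym.ι (fun d : ℤ => (V (-d)).Dual x) d (σ x)
  map_add' _ _ := funext fun x => map_add (GradedSym.ι (fun d : ℤ => (V (-d)).Dual x) d) _ _
  map_smul' _ _ := funext fun x => map_smul (GradedSym.ι (fun d : ℤ => (V (-d)).Dual x) d) _ _

theorem genSection_apply (d : ℤ) (σ : (V (-d)).DualSection) (x : M) :
    V.genSection d σ x = GradedSym.ι (fun d : ℤ => (V (-d)).Dual x) d (σ x) := rfl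

theorem fnSection_mem (f : C^∞⟮𝓡 n, M; ℝ⟯) : V.fnSection f ∈ V.polySections :=
  Algebra.subset_adjoin (Or.inl ⟨f, rfl⟩)

theorem genSection_mem (d : ℤ) (σ : (V (-d)).DualSection) : V.genSection d σ ∈ V.polySections :=
  Algebra.subset_adjoin (Or.inr ⟨d, σ, rfl⟩)

variable {V} in
theorem polySections_induction {q : ∀ s, s ∈ V.polySections → Prop}
    (fn : ∀ f, q (V.fnSection f) (V.fnSection_mem f))
    (gen : ∀ d σ, q (V.genSection d σ) (V.genSection_mem d σ))
    (add : ∀ s t hs ht, q s hs → q t ht → q (s + t) (add_mem hs ht))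
    (mul : ∀ s t hs ht, q s hs → q t ht → q (s * t) (mul_mem hs ht))
    {s : ∀ x, V.symFiber x} (hs : s ∈ V.polySections) : q s hs := by
  induction hs using Algebra.adjoin_induction with
  | mem s hs =>
    rcases hs with ⟨f, rfl⟩ | ⟨d, σ, rfl⟩
    · exact fn f
    · exact gen d σ
  | algebraMap c =>
    have h := fn (algebraMap ℝ _ c)
    simp only [AlgHom.commutes] at h
    exact h
  | add s t hs ht h h' => exact add s t hs ht h h'
  | mul s t hs ht h h' => exact mul s t hs ht h h'

/-- The product of a function and of sections of the bundles `(V^*)_d`. -/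
def monomial (f : C^∞⟮𝓡 n, M; ℝ⟯) (l : List (Σ d : ℤ, (V (-d)).DualSection)) :
    ∀ x, V.symFiber x :=
  V.fnSection f * (l.map fun σ => V.genSection σ.1 σ.2).prod

theorem monomial_mem (f : C^∞⟮𝓡 n, M; ℝ⟯) (l : List (Σ d : ℤ, (V (-d)).DualSection)) :
    V.monomial f l ∈ V.polySections :=
  mul_mem (V.fnSection_mem f) (list_prod_mem fun s hs => by
    obtain ⟨σ, -, rfl⟩ := List.mem_map.1 hs
    exact V.genSection_mem _ _)

theorem fnSection_commute (f : C^∞⟮𝓡 n, M; ℝ⟯) (s : ∀ x, V.symFiber x) :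
    V.fnSection f * s = s * V.fnSection f :=
  funext fun x => Algebra.commutes (f x) (s x)

theorem monomial_mul_monomial (f g : C^∞⟮𝓡 n, M; ℝ⟯)
    (l l' : List (Σ d : ℤ, (V (-d)).DualSection)) :
    V.monomial f l * V.monomial g l' = V.monomial (f * g) (l ++ l') := by
  rw [monomial, monomial, monomial, List.map_append, List.prod_append, map_mul, mul_assoc, mul_assoc,
    ← mul_assoc _ (V.fnSection g), ← fnSection_commute V g, mul_assoc]

variable {V}

/-- Functions are central, so a product of monomials is again a monomial. -/
theorem mem_span_monomial {s : ∀ x, V.symFiber x} (hs : s ∈ V.polySections) :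
    s ∈ Submodule.span ℝ {t | ∃ f l, t = V.monomial f l} := by
  induction hs using polySections_induction with
  | fn f => exact Submodule.subset_span ⟨f, [], by simp [monomial]⟩
  | gen d σ => exact Submodule.subset_span ⟨1, [⟨d, σ⟩], by simp [monomial]⟩
  | add s t _ _ h h' => exact add_mem h h'
  | mul s t hs ht h h' =>
    clear hs ht
    induction h using Submodule.span_induction with
    | zero => rw [zero_mul]; exact zero_mem _
    | add x y _ _ hx hy => rw [add_mul]; exact add_mem hx hy
    | smul c x _ hx => rw [smul_mul_assoc]; exact Submodule.smul_mem _ _ hx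
    | mem x hx =>
      obtain ⟨f, l, rfl⟩ := hx
      induction h' using Submodule.span_induction with
      | zero => rw [mul_zero]; exact zero_mem _
      | add x y _ _ hx hy => rw [mul_add]; exact add_mem hx hy
      | smul c x _ hx => rw [mul_smul_comm]; exact Submodule.smul_mem _ _ hx
      | mem y hy =>
        obtain ⟨g, l', rfl⟩ := hy
        exact Submodule.subset_span ⟨f * g, l ++ l', V.monomial_mul_monomial f g l l'⟩

theorem monomial_deg (f : C^∞⟮𝓡 n, M; ℝ⟯) (l : List (Σ d : ℤ, (V (-d)).DualSection)) (x : M) :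
    V.monomial f l x ∈
      GradedSym.deg (fun d : ℤ => (V (-d)).Dual x) (l.map Sigma.fst).sum := by
  have h : V.monomial f l x = f x • (l.map fun σ => V.genSection σ.1 σ.2 x).prod := by
    rw [monomial, Pi.mul_apply, fnSection_apply, ← Algebra.smul_def, Pi.list_prod_apply,
      List.map_map]
    rfl
  rw [h]
  refine Submodule.smul_mem _ _ (Submodule.subset_span ⟨l.map fun σ => ⟨σ.1, σ.2 x⟩, ?_, ?_⟩)
  · rw [List.map_map]; rfl
  · rw [List.map_map]; rfl

/-- A homogeneous smooth section is locally a sum of monomials of the same degree. -/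
theorem exists_eventually_eq_monomials {m : ℤ} {s : ∀ x, V.symFiber x} (hs : s ∈ V.homSections m)
    (p : M) : ∃ t ∈ Submodule.span ℝ {t | ∃ f l, (l.map Sigma.fst).sum = m ∧ t = V.monomial f l},
      ∀ᶠ x in 𝓝 p, s x = t x := by
  obtain ⟨t, ht, hst⟩ := hs.1 p
  -- The degree m component of a polynomial section is obtained by keeping the monomials of degree
  -- m. It agrees with s near p because s is already homogeneous.
  have key : ∃ t' ∈ Submodule.span ℝ {t | ∃ f l, (l.map Sigma.fst).sum = m ∧ t = V.monomial f l},
      ∀ x, (DirectSum.decompose (GradedSym.deg fun d : ℤ => (V (-d)).Dual x) (t x) m :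
        V.symFiber x) = t' x := by
    have hspan := mem_span_monomial ht
    clear hst ht
    induction hspan using Submodule.span_induction with
    | zero => exact ⟨0, zero_mem _, fun x => by simp⟩
    | add s t _ _ hs ht =>
      obtain ⟨s', hs', h⟩ := hs
      obtain ⟨t', ht', h'⟩ := ht
      refine ⟨s' + t', add_mem hs' ht', fun x => ?_⟩
      rw [Pi.add_apply, DirectSum.decompose_add, DirectSum.add_apply, Submodule.coe_add, h, h']
      rfl
    | smul c t _ ht =>
      obtain ⟨t', ht', h'⟩ := ht
      refine ⟨c • t', Submodule.smul_mem _ _ ht', fun x => ?_⟩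
      rw [Pi.smul_apply, DirectSum.decompose_smul, Pi.smul_apply, ← h']
      rfl
    | mem t ht =>
      obtain ⟨f, l, rfl⟩ := ht
      by_cases hl : (l.map Sigma.fst).sum = m
      · exact ⟨_, Submodule.subset_span ⟨f, l, hl, rfl⟩, fun x =>
          DirectSum.decompose_of_mem_same _ (hl ▸ monomial_deg f l x)⟩
      · exact ⟨0, zero_mem _, fun x => DirectSum.decompose_of_mem_ne _ (monomial_deg f l x) hl⟩
  obtain ⟨t', ht', h⟩ := key
  refine ⟨t', ht', ?_⟩
  filter_upwards [hst] with x hx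
  rw [← h x, ← hx, DirectSum.decompose_of_mem_same _ (hs.2 x)]

variable (V) in
/-- Images of the functions and of the sections of the bundles `(V^*)_d` in an algebra `R`, where
functions act through their germs at `p`. -/
structure LocalData (p : M) (R : Type v) [Ring R] [Algebra ℝ R] where
  fn : C^∞⟮𝓡 n, M; ℝ⟯ →ₐ[ℝ] R
  gen : ∀ d, (V (-d)).DualSection →ₗ[ℝ] R
  fn_commute : ∀ f r, Commute (fn f) r
  fn_local : ∀ f, (∀ᶠ x in 𝓝 p, f x = 0) → fn f = 0
  gen_smul : ∀ d (f : C^∞⟮𝓡 n, M; ℝ⟯) (σ : (V (-d)).DualSection),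
    gen d (SmoothVB.smulSection f σ) = fn f * gen d σ
  gen_mul_gen : ∀ (i j : ℤ) (σ : (V (-i)).DualSection) (τ : (V (-j)).DualSection),
    gen i σ * gen j τ = (-1 : ℤˣ) ^ (i * j) • (gen j τ * gen i σ)

namespace LocalData
variable [IsManifold (𝓡 n) ∞ M] [T2Space M] {p : M} {R : Type v} [Ring R] [Algebra ℝ R]
  (Φ : LocalData V p R)

theorem fn_congr {f g : C^∞⟮𝓡 n, M; ℝ⟯} (h : ∀ᶠ x in 𝓝 p, f x = g x) : Φ.fn f = Φ.fn g := by
  rw [← sub_eq_zero, ← map_sub]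
  refine Φ.fn_local _ (h.mono fun x hx => ?_)
  exact sub_eq_zero.2 hx

/-- Multiplying by a bump that is 1 near p changes neither image, and makes two sections with the
same germ equal. -/
theorem gen_congr {d : ℤ} {σ τ : (V (-d)).DualSection} (h : ∀ᶠ x in 𝓝 p, σ x = τ x) :
    Φ.gen d σ = Φ.gen d τ := by
  obtain ⟨χ, hχ, hs⟩ := exists_bump (n := n) h
  have h1 : Φ.fn χ = 1 := by
    rw [← map_one Φ.fn]
    exact Φ.fn_congr hχ
  have h2 : SmoothVB.smulSection χ σ = SmoothVB.smulSection χ τ := by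
    ext1 x
    rw [SmoothVB.smulSection_apply, SmoothVB.smulSection_apply]
    by_cases hx : χ x = 0
    · rw [hx, zero_smul, zero_smul]
    · rw [show σ x = τ x from hs (subset_tsupport _ hx)]
  rw [← one_mul (Φ.gen d σ), ← h1, ← Φ.gen_smul, h2, Φ.gen_smul, h1, one_mul]

/-- The rank of `V_{-d}^*` in a frame near `p`. -/
def rank (V : GradedVB n M) (p : M) (d : ℤ) : ℕ := ((V (-d)).exists_dual_frame p).choose

/-- A frame of `V_{-d}^*` near `p`. -/
def frame (V : GradedVB n M) (p : M) (d : ℤ) : Fin (rank V p d) → (V (-d)).DualSection :=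
  ((V (-d)).exists_dual_frame p).choose_spec.choose

/-- The coefficients in the frame. -/
def coeff (V : GradedVB n M) (p : M) (d : ℤ) (x : M) :
    (V (-d)).Dual x →ₗ[ℝ] (Fin (rank V p d) → ℝ) :=
  ((V (-d)).exists_dual_frame p).choose_spec.choose_spec.choose x

theorem frame_spec (V : GradedVB n M) (p : M) (d : ℤ) (σ : (V (-d)).DualSection) :
    ∃ a : Fin (rank V p d) → C^∞⟮𝓡 n, M; ℝ⟯, ∀ᶠ x in 𝓝 p,
      (∀ i, a i x = coeff V p d x (σ x) i) ∧ σ x = ∑ i, a i x • frame V p d i x :=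
  ((V (-d)).exists_dual_frame p).choose_spec.choose_spec.choose_spec σ

/-- The graded symmetric algebra of the typical fibre at `p`. -/
abbrev Model (V : GradedVB n M) (p : M) : Type := GradedSym fun d => Fin (rank V p d) → ℝ

/-- The fibre of `S^{≥0} V^*` at `x`, read in the frames at `p`. -/
def toModel (V : GradedVB n M) (p x : M) : V.symFiber x →ₐ[ℝ] Model V p :=
  GradedSym.map fun d => coeff V p d x

/-- The image of the typical fibre under the frames. -/
def ofModel : Model V p →ₐ[ℝ] R :=
  GradedSym.lift (fun d => Fintype.linearCombination ℝ fun i => Φ.gen d (frame V p d i)) (by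
    intro i j x y
    simp only [Fintype.linearCombination_apply, Finset.sum_mul_sum, smul_mul_smul_comm]
    rw [Finset.sum_comm, Finset.smul_sum]
    refine Finset.sum_congr rfl fun k _ => ?_
    rw [Finset.smul_sum]
    refine Finset.sum_congr rfl fun l _ => ?_
    rw [Φ.gen_mul_gen, mul_comm, smul_comm])

/-- The value at `x` of an element of `C^∞(M) ⊗ S`. -/
def value (V : GradedVB n M) (p x : M) : C^∞⟮𝓡 n, M; ℝ⟯ ⊗[ℝ] Model V p →ₐ[ℝ] Model V p :=
  Algebra.TensorProduct.lift ((Algebra.ofId ℝ _).comp (evalAt n x)) (AlgHom.id ℝ _)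
    fun f s => (Algebra.commutes (f x) s : Commute _ _)

theorem value_tmul (x : M) (f : C^∞⟮𝓡 n, M; ℝ⟯) (s : Model V p) :
    value V p x (f ⊗ₜ s) = f x • s := by
  rw [Algebra.smul_def]
  exact Algebra.TensorProduct.lift_tmul _ _ _ _ _

/-- The image in `R` of an element of `C^∞(M) ⊗ S`. -/
def image : C^∞⟮𝓡 n, M; ℝ⟯ ⊗[ℝ] Model V p →ₐ[ℝ] R :=
  Algebra.TensorProduct.lift Φ.fn Φ.ofModel fun f s => Φ.fn_commute f _

theorem image_tmul (f : C^∞⟮𝓡 n, M; ℝ⟯) (s : Model V p) :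
    Φ.image (f ⊗ₜ s) = Φ.fn f * Φ.ofModel s := Algebra.TensorProduct.lift_tmul _ _ _ _ _

/-- Expand a as Σ f_i ⊗ b_i in a basis of the typical fibre. If the value vanishes near p, so does
every f_i by linear independence, and functions act through germs. This is what makes the morphism
on sections well defined. -/
theorem image_eq_zero {a : C^∞⟮𝓡 n, M; ℝ⟯ ⊗[ℝ] Model V p} (h : ∀ᶠ x in 𝓝 p, value V p x a = 0) :
    Φ.image a = 0 := by
  let b := Module.Basis.ofVectorSpace ℝ (Model V p)
  obtain ⟨c, rfl⟩ := TensorProduct.eq_repr_basis_right b a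
  rw [Finsupp.sum, map_sum]
  refine Finset.sum_eq_zero fun i hi => ?_
  rw [image_tmul, Φ.fn_local, zero_mul]
  filter_upwards [h] with x hx
  rw [Finsupp.sum, map_sum] at hx
  simp only [value_tmul] at hx
  exact linearIndependent_iff'.1 b.linearIndependent _ _ hx i hi

/-- Near p a section is a polynomial in functions and frame elements; it therefore comes from C^∞(M)
⊗ S, with S the fixed typical fibre. All sections can then be compared in one algebra although the
fibres vary. -/
theorem exists_value (V : GradedVB n M) (p : M) {s : ∀ x, V.symFiber x} (hs : s ∈ V.smoothSections) :
    ∃ a : C^∞⟮𝓡 n, M; ℝ⟯ ⊗[ℝ] Model V p, ∀ᶠ x in 𝓝 p, toModel V p x (s x) = value V p x a := by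
  obtain ⟨t, ht, hst⟩ := hs p
  have : ∃ a : C^∞⟮𝓡 n, M; ℝ⟯ ⊗[ℝ] Model V p,
      ∀ᶠ x in 𝓝 p, toModel V p x (t x) = value V p x a := by
    clear hst
    induction ht using polySections_induction with
    | fn f =>
      refine ⟨f ⊗ₜ 1, Filter.Eventually.of_forall fun x => ?_⟩
      rw [value_tmul, fnSection_apply, AlgHom.commutes, Algebra.algebraMap_eq_smul_one]
    | gen d σ =>
      obtain ⟨a, ha⟩ := frame_spec V p d σ
      refine ⟨∑ i, a i ⊗ₜ GradedSym.ι _ d (Pi.single i 1), ?_⟩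
      filter_upwards [ha] with x hx
      rw [map_sum, genSection_apply, toModel, GradedSym.map_ι]
      simp only [value_tmul, hx.1, ← map_smul, ← map_sum]
      congr 1
      ext j
      simp [Pi.single_apply]
    | add s t _ _ hs ht =>
      obtain ⟨a, ha⟩ := hs
      obtain ⟨a', ha'⟩ := ht
      refine ⟨a + a', ?_⟩
      filter_upwards [ha, ha'] with x h h'
      rw [Pi.add_apply, map_add, map_add, h, h']
    | mul s t _ _ hs ht =>
      obtain ⟨a, ha⟩ := hs
      obtain ⟨a', ha'⟩ := ht
      refine ⟨a * a', ?_⟩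
      filter_upwards [ha, ha'] with x h h'
      rw [Pi.mul_apply, map_mul, map_mul, h, h']
  obtain ⟨a, ha⟩ := this
  exact ⟨a, by filter_upwards [ha, hst] with x h h' using h' ▸ h⟩

/-- The value on a smooth section. -/
def homFun (s : V.smoothSections) : R := Φ.image (exists_value V p s.2).choose

/-- Independence of the chosen lift: two lifts differ by an element whose value vanishes near p. -/
theorem homFun_eq {s : V.smoothSections} {a : C^∞⟮𝓡 n, M; ℝ⟯ ⊗[ℝ] Model V p}
    (h : ∀ᶠ x in 𝓝 p, toModel V p x (s.1 x) = value V p x a) : Φ.homFun s = Φ.image a := by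
  rw [homFun, ← sub_eq_zero, ← map_sub]
  apply Φ.image_eq_zero
  filter_upwards [h, (exists_value V p s.2).choose_spec] with x hx hx'
  rw [map_sub, ← hx', hx, sub_self]

theorem homFun_spec (s : V.smoothSections) : ∃ a, Φ.homFun s = Φ.image a ∧
    ∀ᶠ x in 𝓝 p, toModel V p x (s.1 x) = value V p x a :=
  ⟨_, rfl, (exists_value V p s.2).choose_spec⟩

/-- The algebra morphism determined by the images of the generators. -/
def hom : V.smoothSections →ₐ[ℝ] R := AlgHom.ofLinearMap
  { toFun := Φ.homFun
    map_add' := fun s t => by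
      obtain ⟨a, ha, h⟩ := Φ.homFun_spec s
      obtain ⟨a', ha', h'⟩ := Φ.homFun_spec t
      rw [ha, ha', ← map_add]
      apply Φ.homFun_eq
      filter_upwards [h, h'] with x h h'
      rw [Subalgebra.coe_add, Pi.add_apply, map_add, map_add, h, h']
    map_smul' := fun _ s => by
      obtain ⟨a, ha, h⟩ := Φ.homFun_spec s
      rw [ha, ← map_smul]
      apply Φ.homFun_eq
      filter_upwards [h] with x h
      rw [Subalgebra.coe_smul, Pi.smul_apply, map_smul, map_smul, h]
      rfl }
  (by
    rw [← map_one Φ.image]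
    apply Φ.homFun_eq
    refine Filter.Eventually.of_forall fun x => ?_
    rw [map_one]
    exact map_one _)
  (fun s t => by
    change Φ.homFun (s * t) = Φ.homFun s * Φ.homFun t
    obtain ⟨a, ha, h⟩ := Φ.homFun_spec s
    obtain ⟨a', ha', h'⟩ := Φ.homFun_spec t
    rw [ha, ha', ← map_mul]
    apply Φ.homFun_eq
    filter_upwards [h, h'] with x h h'
    rw [Subalgebra.coe_mul, Pi.mul_apply, map_mul, map_mul, h, h'])

theorem hom_congr {s t : V.smoothSections} (h : ∀ᶠ x in 𝓝 p, s.1 x = t.1 x) :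
    Φ.hom s = Φ.hom t := by
  obtain ⟨a, ha, h'⟩ := Φ.homFun_spec t
  refine Eq.trans (Φ.homFun_eq ?_) ha.symm
  filter_upwards [h, h'] with x h h'
  rw [h, h']

theorem hom_fn (f : C^∞⟮𝓡 n, M; ℝ⟯) (h) : Φ.hom ⟨V.fnSection f, h⟩ = Φ.fn f := by
  have h1 : Φ.homFun ⟨V.fnSection f, h⟩ = Φ.image (f ⊗ₜ 1) :=
    Φ.homFun_eq (Filter.Eventually.of_forall fun x => by
      change toModel V p x (V.fnSection f x) = _
      rw [value_tmul, fnSection_apply, AlgHom.commutes, Algebra.algebraMap_eq_smul_one])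
  refine h1.trans ?_
  rw [image_tmul, map_one, mul_one]

theorem hom_gen (d : ℤ) (σ : (V (-d)).DualSection) (h) :
    Φ.hom ⟨V.genSection d σ, h⟩ = Φ.gen d σ := by
  obtain ⟨a, ha⟩ := frame_spec V p d σ
  have h1 : Φ.homFun ⟨V.genSection d σ, h⟩ =
      Φ.image (∑ i, a i ⊗ₜ GradedSym.ι _ d (Pi.single i 1)) := by
    apply Φ.homFun_eq
    filter_upwards [ha] with x hx
    rw [map_sum, genSection_apply, toModel, GradedSym.map_ι]
    simp only [value_tmul, hx.1, ← map_smul, ← map_sum]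
    congr 1
    ext j
    simp [Pi.single_apply]
  refine h1.trans ?_
  have h2 : Φ.gen d σ = Φ.gen d (∑ i, SmoothVB.smulSection (a i) (frame V p d i)) := by
    apply Φ.gen_congr
    filter_upwards [ha] with x hx
    rw [hx.2, SmoothVB.sum_smulSection_apply]
  rw [h2, map_sum, map_sum]
  refine Finset.sum_congr rfl fun i _ => ?_
  rw [image_tmul, Φ.gen_smul, ofModel, GradedSym.lift_ι, Fintype.linearCombination_apply_single,
    one_smul]

end LocalData

/-- Algebra morphisms that are local at `p` are determined by the images of the generators. -/
theorem algHom_ext_of_local [IsManifold (𝓡 n) ∞ M] [T2Space M] {T : Subalgebra ℝ (∀ x, V.symFiber x)}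
    (h1 : V.polySections ≤ T) (h2 : T ≤ V.smoothSections) {R : Type v} [Ring R] [Algebra ℝ R]
    {Ψ Ψ' : T →ₐ[ℝ] R} {p : M}
    (hloc : ∀ f : C^∞⟮𝓡 n, M; ℝ⟯, (∀ᶠ x in 𝓝 p, f x = 0) →
      Ψ ⟨V.fnSection f, h1 (V.fnSection_mem f)⟩ = 0)
    (hfn : ∀ f, Ψ ⟨V.fnSection f, h1 (V.fnSection_mem f)⟩ =
      Ψ' ⟨V.fnSection f, h1 (V.fnSection_mem f)⟩)
    (hgen : ∀ d σ, Ψ ⟨V.genSection d σ, h1 (V.genSection_mem d σ)⟩ =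
      Ψ' ⟨V.genSection d σ, h1 (V.genSection_mem d σ)⟩) : Ψ = Ψ' := by
  have hpoly : ∀ t (ht : t ∈ V.polySections), Ψ ⟨t, h1 ht⟩ = Ψ' ⟨t, h1 ht⟩ := by
    intro t ht
    suffices ∃ h : t ∈ T, Ψ ⟨t, h⟩ = Ψ' ⟨t, h⟩ from this.2
    induction ht using polySections_induction with
    | fn f => exact ⟨_, hfn f⟩
    | gen d σ => exact ⟨_, hgen d σ⟩
    | add s t _ _ hs ht =>
      obtain ⟨hs, h⟩ := hs
      obtain ⟨ht, h'⟩ := ht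
      refine ⟨add_mem hs ht, ?_⟩
      have := congrArg₂ (· + ·) h h'
      simp only [← map_add] at this
      exact this
    | mul s t _ _ hs ht =>
      obtain ⟨hs, h⟩ := hs
      obtain ⟨ht, h'⟩ := ht
      refine ⟨mul_mem hs ht, ?_⟩
      have := congrArg₂ (· * ·) h h'
      simp only [← map_mul] at this
      exact this
  have hone : ∀ χ : C^∞⟮𝓡 n, M; ℝ⟯, (∀ᶠ x in 𝓝 p, χ x = 1) →
      Ψ ⟨V.fnSection χ, h1 (V.fnSection_mem χ)⟩ = 1 := by
    intro χ hχ
    have := hloc (χ - 1) (hχ.mono fun x hx => sub_eq_zero.2 hx)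
    have h3 : (⟨V.fnSection (χ - 1), h1 (V.fnSection_mem _)⟩ : T) =
        ⟨V.fnSection χ, h1 (V.fnSection_mem χ)⟩ - 1 :=
      Subtype.ext (by change V.fnSection (χ - 1) = V.fnSection χ - 1; rw [map_sub, map_one])
    rwa [h3, map_sub, map_one, sub_eq_zero] at this
  ext ⟨s, hs⟩
  obtain ⟨t, ht, hst⟩ := h2 hs p
  -- A bump supported where s equals the polynomial t, and mapped to 1 by both morphisms, reduces
  -- the claim to t.
  obtain ⟨χ, hχ, hsupp⟩ := exists_bump (n := n) hst
  let χ' : T := ⟨V.fnSection χ, h1 (V.fnSection_mem χ)⟩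
  have h3 : χ' * ⟨s, hs⟩ = χ' * ⟨t, h1 ht⟩ := by
    apply Subtype.ext
    funext x
    change V.fnSection χ x * s x = V.fnSection χ x * t x
    by_cases hx : χ x = 0
    · rw [fnSection_apply, hx, map_zero, zero_mul, zero_mul]
    · rw [show s x = t x from hsupp (subset_tsupport _ hx)]
  have h4 := congrArg Ψ h3
  have h5 := congrArg Ψ' h3
  rw [map_mul, map_mul, ← hfn, hone χ hχ, one_mul, one_mul] at h5
  rw [map_mul, map_mul, hone χ hχ, one_mul, one_mul] at h4
  rw [h4, h5, hpoly t ht]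

end GradedVB
end

/-! ### Thickened evaluations and derivations along them -/

noncomputable section

section Pointwise
variable {n : ℕ} {M : Type u} [TopologicalSpace M] [ChartedSpace (EuclideanSpace ℝ (Fin n)) M]
  [IsManifold (𝓡 n) ∞ M] [T2Space M] {R : Type v} [Ring R] [Algebra ℝ R]

/-- An algebra morphism that behaves like a nilpotent thickening of the evaluation at `p`. -/
structure IsThickenedEval (p : M) (φ : C^∞⟮𝓡 n, M; ℝ⟯ →ₐ[ℝ] R) : Prop where
  isNilpotent : ∀ g, g p = 0 → IsNilpotent (φ g)

/-- A morphism from an algebra of smooth functions to a graded symmetric algebra is a nilpotent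
thickening of an evaluation. -/
theorem exists_isThickenedEval [SecondCountableTopology M] {P : ℤ → Type v}
    [∀ i, AddCommGroup (P i)] [∀ i, Module ℝ (P i)]
    (φ : C^∞⟮𝓡 n, M; ℝ⟯ →ₐ[ℝ] GradedSym P) :
    ∃ p : M, (∀ f, GradedSym.aug (φ f) = f p) ∧ IsThickenedEval p φ := by
  obtain ⟨p, hp⟩ := exists_eq_eval (GradedSym.aug.comp φ)
  refine ⟨p, hp, ⟨fun g hg => ?_⟩⟩
  apply GradedSym.isNilpotent_of_isUnit_one_add_sq
  -- The reality of the functions is used here: 1 + g² has no zeros, so it and its image are units.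
  · have h : IsUnit (1 + g ^ 2) := isUnit_of_forall_ne_zero fun x => by
      change 1 + (g ^ 2) x ≠ 0
      rw [show (g ^ 2) x = g x ^ 2 from rfl]
      positivity
    simpa using h.map φ
  · exact (hp g).trans hg

namespace IsThickenedEval
variable {p : M} {φ : C^∞⟮𝓡 n, M; ℝ⟯ →ₐ[ℝ] R} (hφ : IsThickenedEval p φ)
include hφ

/-- A bump χ with χ f = 0 and χ = 1 near p has image 1 plus a nilpotent, which is a unit and
annihilates φ(f). -/
theorem eq_zero_of_eventually {f : C^∞⟮𝓡 n, M; ℝ⟯} (hf : ∀ᶠ x in 𝓝 p, f x = 0) : φ f = 0 := by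
  obtain ⟨χ, hχ, hs⟩ := exists_bump (n := n) hf
  have h1 : χ * f = 0 := by
    ext x
    change χ x * f x = 0
    by_cases hx : χ x = 0
    · rw [hx, zero_mul]
    · rw [show f x = 0 from hs (subset_tsupport _ hx), mul_zero]
  have h2 : IsUnit (φ χ) := by
    have h3 := hφ.isNilpotent (χ - 1) (sub_eq_zero.2 hχ.self_of_nhds)
    have h4 := h3.isUnit_one_add
    rwa [map_sub, map_one, add_sub_cancel] at h4
  have h5 := congrArg φ h1
  rw [map_mul, map_zero] at h5
  exact h2.mul_right_eq_zero.1 h5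

theorem congr {f g : C^∞⟮𝓡 n, M; ℝ⟯} (h : ∀ᶠ x in 𝓝 p, f x = g x) : φ f = φ g := by
  rw [← sub_eq_zero, ← map_sub]
  exact hφ.eq_zero_of_eventually (h.mono fun x hx => sub_eq_zero.2 hx)

/-- Maps on sections of a dual bundle that are linear over functions are local. -/
theorem linear_congr {V : SmoothVB n M} {G : V.DualSection →ₗ[ℝ] R}
    (hG : ∀ f σ, G (SmoothVB.smulSection f σ) = φ f * G σ) {σ τ : V.DualSection}
    (h : ∀ᶠ x in 𝓝 p, σ x = τ x) : G σ = G τ := by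
  obtain ⟨χ, hχ, hs⟩ := exists_bump (n := n) h
  have h1 : φ χ = 1 := by
    rw [← map_one φ]
    exact hφ.congr hχ
  have h2 : SmoothVB.smulSection χ σ = SmoothVB.smulSection χ τ := by
    ext1 x
    rw [SmoothVB.smulSection_apply, SmoothVB.smulSection_apply]
    by_cases hx : χ x = 0
    · rw [hx, zero_smul, zero_smul]
    · rw [show σ x = τ x from hs (subset_tsupport _ hx)]
  rw [← one_mul (G σ), ← h1, ← hG, h2, hG, h1, one_mul]

theorem linear_sum {V : SmoothVB n M} {G : V.DualSection →ₗ[ℝ] R}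
    (hG : ∀ f σ, G (SmoothVB.smulSection f σ) = φ f * G σ) {ι : Type*} [Fintype ι]
    {a : ι → C^∞⟮𝓡 n, M; ℝ⟯} {e : ι → V.DualSection} {σ : V.DualSection}
    (h : ∀ᶠ x in 𝓝 p, σ x = ∑ i, a i x • e i x) : G σ = ∑ i, φ (a i) * G (e i) := by
  have h1 : G σ = G (∑ i, SmoothVB.smulSection (a i) (e i)) := by
    apply hφ.linear_congr hG
    filter_upwards [h] with x hx
    rw [hx, SmoothVB.sum_smulSection_apply]
  rw [h1, map_sum]
  simp only [hG]

/-- With u = f - g and χ u = 0, the Leibniz rule gives 0 = φ(χ) δ(u) + φ(u) δ(χ). Here φ(χ) = 1 and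
φ(u) = 0 by locality of φ. -/
theorem derivation_congr {δ : C^∞⟮𝓡 n, M; ℝ⟯ →ₗ[ℝ] R}
    (hδ : ∀ f g, δ (f * g) = φ f * δ g + φ g * δ f) {f g : C^∞⟮𝓡 n, M; ℝ⟯}
    (h : ∀ᶠ x in 𝓝 p, f x = g x) : δ f = δ g := by
  rw [← sub_eq_zero, ← map_sub]
  have h0 : ∀ᶠ x in 𝓝 p, (f - g) x = 0 := h.mono fun x hx => sub_eq_zero.2 hx
  obtain ⟨χ, hχ, hs⟩ := exists_bump (n := n) h0
  have h1 : χ * (f - g) = 0 := by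
    ext x
    change χ x * (f - g) x = 0
    by_cases hx : χ x = 0
    · rw [hx, zero_mul]
    · rw [show (f - g) x = 0 from hs (subset_tsupport _ hx), mul_zero]
  have h2 := hδ χ (f - g)
  rw [h1, map_zero, hφ.eq_zero_of_eventually h0, zero_mul, add_zero,
    hφ.congr (g := 1) hχ, map_one, one_mul] at h2
  exact h2.symm

/-- A derivation that vanishes on coordinates vanishes. -/
theorem derivation_eq_zero {δ : C^∞⟮𝓡 n, M; ℝ⟯ →ₗ[ℝ] R}
    (hδ : ∀ f g, δ (f * g) = φ f * δ g + φ g * δ f) {X : Fin n → C^∞⟮𝓡 n, M; ℝ⟯}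
    (hX : ∀ i, X i p = 0) (hgen : ∀ g : C^∞⟮𝓡 n, M; ℝ⟯, g p = 0 →
      ∃ h : Fin n → C^∞⟮𝓡 n, M; ℝ⟯, ∀ᶠ x in 𝓝 p, g x = ∑ i, X i x * h i x)
    (h0 : ∀ i, δ (X i) = 0) : δ = 0 := by
  have hone : δ 1 = 0 := by
    have := hδ 1 1
    rw [mul_one, map_one φ, one_mul] at this
    exact left_eq_add.1 this
  -- The functions whose image annihilates all values of δ; the aim is 1 ∈ q.
  let q : Ideal C^∞⟮𝓡 n, M; ℝ⟯ :=
    { carrier := {c | ∀ g, φ c * δ g = 0}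
      add_mem' := fun ha hb g => by rw [map_add, add_mul, ha g, hb g, add_zero]
      zero_mem' := fun g => by rw [map_zero, zero_mul]
      smul_mem' := fun c a ha g => by rw [smul_eq_mul, map_mul, mul_assoc, ha g, mul_zero] }
  -- Hadamard's expansion g = g(p) + Σ X_i h_i near p, differentiated: the terms φ(h_i) δ(X_i) drop
  -- out by assumption.
  have hexp : ∀ g, ∃ h : Fin n → C^∞⟮𝓡 n, M; ℝ⟯, δ g = ∑ i, φ (X i) * δ (h i) := by
    intro g
    obtain ⟨h, hh⟩ := hgen (g - algebraMap ℝ _ (g p)) (sub_self _)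
    refine ⟨h, ?_⟩
    have h1 : δ (g - algebraMap ℝ _ (g p)) = δ g := by
      rw [map_sub, Algebra.algebraMap_eq_smul_one, map_smul, hone, smul_zero, sub_zero]
    rw [← h1, hφ.derivation_congr hδ (g := ∑ i, X i * h i), map_sum]
    · refine Finset.sum_congr rfl fun i _ => ?_
      rw [hδ, h0, mul_zero, add_zero]
    · filter_upwards [hh] with x hx
      rw [hx]
      exact (map_sum (GradedVB.evalAt n x) (fun i => X i * h i) Finset.univ).symm
  have hdesc : ∀ c, (∀ i, X i * c ∈ q) → c ∈ q := by
    intro c hc g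
    obtain ⟨h, hh⟩ := hexp g
    rw [hh, Finset.mul_sum]
    refine Finset.sum_eq_zero fun i _ => ?_
    rw [← mul_assoc, ← map_mul, mul_comm c]
    exact hc i (h i)
  have hrad : Ideal.span (Set.range X) ≤ q.radical := by
    rw [Ideal.span_le]
    rintro _ ⟨i, rfl⟩
    obtain ⟨m, hm⟩ := hφ.isNilpotent (X i) (hX i)
    exact ⟨m, fun g => by rw [map_pow, hm, zero_mul]⟩
  -- Each φ(X_i) is nilpotent, so some power of the finitely generated ideal (X_1, …, X_n) lies in
  -- q. By `hdesc` the exponent can be lowered step by step to 0.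
  obtain ⟨m, hm⟩ := Ideal.exists_pow_le_of_le_radical_of_fg hrad
    (Submodule.fg_span (Set.finite_range X))
  have hall : ∀ m, Ideal.span (Set.range X) ^ m ≤ q → (1 : C^∞⟮𝓡 n, M; ℝ⟯) ∈ q := by
    intro m
    induction m with
    | zero => intro h; exact h (by simp)
    | succ m ih =>
      intro h
      refine ih fun c hc => hdesc c fun i => h ?_
      rw [pow_succ']
      exact Ideal.mul_mem_mul (Ideal.subset_span ⟨i, rfl⟩) hc
  ext g
  have := hall m hm g
  rwa [map_one, one_mul] at this

/-- Maps on `1`-forms that are linear over functions are determined on exact forms. -/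
theorem linear_ext {G G' : (SmoothVB.tangent n M).DualSection →ₗ[ℝ] R}
    (hG : ∀ f σ, G (SmoothVB.smulSection f σ) = φ f * G σ)
    (hG' : ∀ f σ, G' (SmoothVB.smulSection f σ) = φ f * G' σ)
    (h : ∀ g, G (differential g) = G' (differential g)) : G = G' := by
  obtain ⟨X, -, -, hX, -⟩ := exists_coordinates n p
  ext α
  obtain ⟨a, ha⟩ := hX α
  rw [hφ.linear_sum hG ha, hφ.linear_sum hG' ha]
  exact Finset.sum_congr rfl fun i _ => by rw [h]

/-- Derivations factor through the differential. -/
theorem exists_linear_of_derivation {δ : C^∞⟮𝓡 n, M; ℝ⟯ →ₗ[ℝ] R}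
    (hδ : ∀ f g, δ (f * g) = φ f * δ g + φ g * δ f) :
    ∃ G : (SmoothVB.tangent n M).DualSection →ₗ[ℝ] R,
      (∀ f σ, G (SmoothVB.smulSection f σ) = φ f * G σ) ∧ ∀ g, G (differential g) = δ g := by
  obtain ⟨X, hX0, hgen, hX, hind⟩ := exists_coordinates n p
  choose a ha using hX
  have huniq : ∀ {α : (SmoothVB.tangent n M).DualSection} {b : Fin n → C^∞⟮𝓡 n, M; ℝ⟯},
      (∀ᶠ x in 𝓝 p, α x = ∑ i, b i x • differential (X i) x) →
      ∀ i, φ (a α i) = φ (b i) := by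
    intro α b hb i
    apply hφ.congr
    filter_upwards [hb, ha α, hind] with x h1 h2 h3
    have h4 := h3 (fun i => a α i x - b i x) (by
      rw [← sub_eq_zero.2 (h2.symm.trans h1), ← Finset.sum_sub_distrib]
      exact Finset.sum_congr rfl fun i _ =>
        ContinuousLinearMap.ext fun v => sub_mul _ _ _)
    exact sub_eq_zero.1 (congrFun h4 i)
  -- The formula is forced by linearity over φ and G(dX_i) = δ(X_i). By `huniq` it does not depend
  -- on the chosen coefficients of α.
  let G : (SmoothVB.tangent n M).DualSection →ₗ[ℝ] R :=
    { toFun := fun α => ∑ i, φ (a α i) * δ (X i)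
      map_add' := fun α β => by
        rw [← Finset.sum_add_distrib]
        refine Finset.sum_congr rfl fun i _ => ?_
        rw [huniq (α := α + β) (b := fun i => a α i + a β i), map_add, add_mul]
        filter_upwards [ha α, ha β] with x h1 h2
        rw [show (α + β) x = α x + β x from rfl, h1, h2, ← Finset.sum_add_distrib]
        exact Finset.sum_congr rfl fun i _ => (add_smul _ _ _).symm
      map_smul' := fun c α => by
        rw [RingHom.id_apply, Finset.smul_sum]
        refine Finset.sum_congr rfl fun i _ => ?_
        rw [huniq (α := c • α) (b := fun i => c • a α i), map_smul, smul_mul_assoc]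
        filter_upwards [ha α] with x h1
        rw [show (c • α) x = c • α x from rfl, h1, Finset.smul_sum]
        exact Finset.sum_congr rfl fun i _ => smul_smul _ _ _ }
  have hG : ∀ f σ, G (SmoothVB.smulSection f σ) = φ f * G σ := by
    intro f σ
    change ∑ i, φ (a (SmoothVB.smulSection f σ) i) * δ (X i) = φ f * ∑ i, φ (a σ i) * δ (X i)
    rw [Finset.mul_sum]
    refine Finset.sum_congr rfl fun i _ => ?_
    rw [huniq (b := fun i => f * a σ i), map_mul, mul_assoc]
    filter_upwards [ha σ] with x h1
    rw [SmoothVB.smulSection_apply, h1, Finset.smul_sum]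
    exact Finset.sum_congr rfl fun i _ => smul_smul _ _ _
  refine ⟨G, hG, fun g => ?_⟩
  let Dl : C^∞⟮𝓡 n, M; ℝ⟯ →ₗ[ℝ] (SmoothVB.tangent n M).DualSection :=
    { toFun := differential
      map_add' := differential_add
      map_smul' := fun c f => by
        have h := differential_mul (algebraMap ℝ _ c) f
        rw [differential_const, ← Algebra.smul_def] at h
        rw [h, RingHom.id_apply]
        ext1 x
        change c • differential f x + f x • (0 : (SmoothVB.tangent n M).Dual x) = c • differential f x
        rw [smul_zero, add_zero] }
  -- The difference is again a derivation along φ, and it vanishes on the coordinates.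
  have hzero : δ - G.comp Dl = 0 := by
    apply hφ.derivation_eq_zero (X := X) _ hX0 hgen
    · intro i
      change δ (X i) - ∑ j, φ (a (differential (X i)) j) * δ (X j) = 0
      classical
      have h1 : ∀ j, φ (a (differential (X i)) j) = φ (if i = j then 1 else 0) :=
        huniq (b := fun j => if i = j then 1 else 0) (Filter.Eventually.of_forall fun x => by
          rw [Finset.sum_eq_single i]
          · rw [if_pos rfl]; exact (one_smul _ _).symm
          · intro j _ hj
            rw [if_neg hj.symm]; exact zero_smul _ _
          · simp)
      simp [h1, apply_ite φ]
    · intro f g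
      change δ (f * g) - G (differential (f * g)) = φ f * (δ g - G (differential g)) +
        φ g * (δ f - G (differential f))
      rw [differential_mul, map_add, hG, hG, hδ]
      noncomm_ring
  exact (sub_eq_zero.1 (DFunLike.congr_fun hzero g)).symm

end IsThickenedEval
end Pointwise
end

/-! ### Morphisms between split graded manifolds over a base map -/

noncomputable section

/-- Elements of degree `0` of a graded-commutative algebra are central. -/
theorem GradedCommAlg.commute_of_mem_zero (A : GradedCommAlg.{u}) {a : A.carrier} (ha : a ∈ A.gr 0)
    (b : A.carrier) : Commute a b := by
  induction b using DirectSum.Decomposition.inductionOn A.gr with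
  | zero => exact Commute.zero_right a
  | add b c hb hc => exact hb.add_right hc
  | @homogeneous j b =>
    have h := A.graded_comm 0 j a b ha b.2
    rwa [zero_mul, uzpow_zero, one_smul] at h

namespace GradedVB
section
variable {n : ℕ} {M : Type u} [TopologicalSpace M] [ChartedSpace (EuclideanSpace ℝ (Fin n)) M]
  (V : GradedVB n M)

/-- The fibre of `S^{≥0} V^*` at `x`, as a graded-commutative algebra. -/
def symAlg (x : M) : GradedCommAlg.{0} where
  carrier := V.symFiber x
  gr := GradedSym.deg fun d : ℤ => (V (-d)).Dual x
  graded_comm i j a b ha hb := GradedSym.graded_comm i j a b ha hb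

/-- The evaluation of sections at a point. -/
def evalFiber (x : M) : V.functions.carrier →ₐ[ℝ] V.symFiber x :=
  (Pi.evalAlgHom ℝ V.symFiber x).comp V.sections.val

/-- The evaluation of sections at a point, as a morphism of graded algebras. -/
def evalHom (x : M) : GradedCommAlg.Hom V.functions (V.symAlg x) :=
  { V.evalFiber x with
    map_mem := fun {_ _} ha => ha.2 x }

variable {V}

theorem functions_ext {a b : V.functions.carrier} (h : ∀ x, V.evalFiber x a = V.evalFiber x b) :
    a = b := Subtype.ext (funext h)

theorem smooth_of_functions (a : V.functions.carrier) :
    (fun x => V.evalFiber x a) ∈ V.smoothSections := by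
  obtain ⟨s, c, rfl⟩ := a
  change DirectSum.coeAlgHom V.homSections c ∈ V.smoothSections
  induction c using DirectSum.induction_on with
  | zero => rw [map_zero]; exact zero_mem _
  | of m s => rw [DirectSum.coeAlgHom_of]; exact s.2.1
  | add a b ha hb => rw [map_add]; exact add_mem ha hb

theorem homSection_of_mem_gr {d : ℤ} {a : V.functions.carrier} (ha : a ∈ V.functions.gr d) :
    (fun x => V.evalFiber x a) ∈ V.homSections d := ha

/-- A homogeneous smooth section as an element of the algebra of functions. -/
def ofHomSection {d : ℤ} (s : ∀ x, V.symFiber x) (hs : s ∈ V.homSections d) : V.functions.carrier :=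
  (⟨s, V.homSections_le d hs⟩ : V.sections)

theorem ofHomSection_mem {d : ℤ} (s : ∀ x, V.symFiber x) (hs : s ∈ V.homSections d) :
    ofHomSection s hs ∈ V.functions.gr d := hs

theorem fnSection_homSection (f : C^∞⟮𝓡 n, M; ℝ⟯) : V.fnSection f ∈ V.homSections 0 :=
  ⟨polySections_le_smoothSections V (V.fnSection_mem f), fun x =>
    (SetLike.algebraMap_mem_graded (GradedSym.deg fun d : ℤ => (V (-d)).Dual x) (f x))⟩

theorem genSection_homSection (d : ℤ) (σ : (V (-d)).DualSection) :
    V.genSection d σ ∈ V.homSections d :=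
  ⟨polySections_le_smoothSections V (V.genSection_mem d σ), fun x =>
    GradedSym.ι_mem (P := fun d : ℤ => (V (-d)).Dual x) d (σ x)⟩

theorem polySections_le_sections : V.polySections ≤ V.sections := fun s hs => by
  induction hs using polySections_induction with
  | fn f => exact V.homSections_le 0 (fnSection_homSection f)
  | gen d σ => exact V.homSections_le d (genSection_homSection d σ)
  | add s t _ _ h h' => exact add_mem h h'
  | mul s t _ _ h h' => exact mul_mem h h'

variable (V) in
/-- Smooth functions on the base as functions on the split graded manifold. -/
def fn : C^∞⟮𝓡 n, M; ℝ⟯ →ₐ[ℝ] V.functions.carrier :=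
  V.fnSection.codRestrict V.sections fun f => V.homSections_le 0 (fnSection_homSection f)

variable (V) in
/-- Sections of `(V^*)_d` as functions on the split graded manifold. -/
def gen (d : ℤ) : (V (-d)).DualSection →ₗ[ℝ] V.functions.carrier :=
  (V.genSection d).codRestrict V.sections.toSubmodule fun σ =>
    V.homSections_le d (genSection_homSection d σ)

theorem fn_mem (f : C^∞⟮𝓡 n, M; ℝ⟯) : V.fn f ∈ V.functions.gr 0 := fnSection_homSection f

theorem gen_mem (d : ℤ) (σ : (V (-d)).DualSection) : V.gen d σ ∈ V.functions.gr d :=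
  genSection_homSection d σ

@[simp] theorem evalFiber_fn (f : C^∞⟮𝓡 n, M; ℝ⟯) (x : M) :
    V.evalFiber x (V.fn f) = V.fnSection f x := rfl

@[simp] theorem evalFiber_gen (d : ℤ) (σ : (V (-d)).DualSection) (x : M) :
    V.evalFiber x (V.gen d σ) = V.genSection d σ x := rfl

theorem gen_smul (d : ℤ) (f : C^∞⟮𝓡 n, M; ℝ⟯) (σ : (V (-d)).DualSection) :
    V.gen d (SmoothVB.smulSection f σ) = V.fn f * V.gen d σ :=
  functions_ext fun x => by
    rw [map_mul, evalFiber_fn, evalFiber_gen, evalFiber_gen, fnSection_apply, ← Algebra.smul_def]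
    exact map_smul (GradedSym.ι (fun d : ℤ => (V (-d)).Dual x) d) (f x) (σ x)

/-- The augmentation of a smooth section is continuous. -/
theorem continuous_aug {s : ∀ x, V.symFiber x} (hs : s ∈ V.smoothSections) :
    Continuous fun x => GradedSym.aug (s x) := by
  refine continuous_iff_continuousAt.2 fun x₀ => ?_
  obtain ⟨t, ht, hst⟩ := hs x₀
  suffices h : Continuous fun x => GradedSym.aug (t x) from
    h.continuousAt.congr (hst.mono fun x hx => congrArg GradedSym.aug hx.symm)
  clear hst
  induction ht using polySections_induction with
  | fn f =>
    simp only [fnSection_apply, AlgHom.commutes]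
    exact f.contMDiff.continuous
  | gen d σ =>
    simp only [genSection_apply, GradedSym.aug_ι]
    exact continuous_const
  | add s t _ _ h h' =>
    simp only [Pi.add_apply, map_add]
    exact h.add h'
  | mul s t _ _ h h' =>
    simp only [Pi.mul_apply, map_mul]
    exact h.mul h'

end

section Hom
variable {n : ℕ} {M : Type u} [TopologicalSpace M] [ChartedSpace (EuclideanSpace ℝ (Fin n)) M]
  [IsManifold (𝓡 n) ∞ M] [T2Space M] {m : ℕ} {N : Type v} [TopologicalSpace N]
  [ChartedSpace (EuclideanSpace ℝ (Fin m)) N] {V : GradedVB n M} {W : GradedVB m N}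

/-- `f` underlies the algebra morphism `φ`. -/
structure IsBase (f : N → M) (φ : C^∞⟮𝓡 n, M; ℝ⟯ →ₐ[ℝ] W.functions.carrier) : Prop where
  continuous : Continuous f
  isThickenedEval : ∀ y, IsThickenedEval (f y) ((W.evalFiber y).comp φ)

/-- Every algebra morphism from smooth functions on a manifold has an underlying map. -/
theorem exists_isBase [SecondCountableTopology M]
    (φ : C^∞⟮𝓡 n, M; ℝ⟯ →ₐ[ℝ] W.functions.carrier) : ∃ f : N → M, IsBase f φ := by
  choose f hf hφ using fun y => exists_isThickenedEval ((W.evalFiber y).comp φ)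
  refine ⟨f, continuous_iff_continuousAt.2 fun y U hU => ?_, hφ⟩
  obtain ⟨χ, hχ, hs⟩ := exists_bump (n := n) hU
  -- χ ∘ f is the augmentation of the smooth section φ(χ), hence continuous; where it is nonzero, f
  -- stays in the support of χ.
  have h1 : Continuous fun y => χ (f y) := by
    have := continuous_aug (smooth_of_functions (φ χ))
    refine this.congr fun y => hf y χ
  have h2 : χ (f y) ≠ 0 := by rw [hχ.self_of_nhds]; exact one_ne_zero
  exact (h1.continuousAt.eventually_ne h2).mono fun z hz => hs (subset_tsupport _ hz)

variable {f : N → M} {φ : C^∞⟮𝓡 n, M; ℝ⟯ →ₐ[ℝ] W.functions.carrier} (hf : IsBase f φ)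
include hf

/-- Morphisms over `f` depend only on germs. -/
theorem IsBase.evalFiber_congr {Ψ : V.functions.carrier →ₐ[ℝ] W.functions.carrier}
    (hΨ : ∀ g, Ψ (V.fn g) = φ g) {y : N} {a b : V.functions.carrier}
    (h : ∀ᶠ x in 𝓝 (f y), V.evalFiber x a = V.evalFiber x b) :
    W.evalFiber y (Ψ a) = W.evalFiber y (Ψ b) := by
  obtain ⟨χ, hχ, hs⟩ := exists_bump (n := n) h
  have h1 : V.fn χ * a = V.fn χ * b := functions_ext fun x => by
    rw [map_mul, map_mul, evalFiber_fn]
    by_cases hx : χ x = 0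
    · rw [fnSection_apply, hx, map_zero, zero_mul, zero_mul]
    · rw [show V.evalFiber x a = V.evalFiber x b from hs (subset_tsupport _ hx)]
  have h2 := congrArg (fun z => W.evalFiber y (Ψ z)) h1
  have h3 : W.evalFiber y (φ χ) = 1 :=
    ((hf.isThickenedEval y).congr (g := 1) hχ).trans (map_one _)
  simpa only [map_mul, hΨ, h3, one_mul] using h2

/-- Morphisms from a split graded manifold are determined on generators. -/
theorem IsBase.hom_ext {Ψ Ψ' : GradedCommAlg.Hom V.functions W.functions}
    (hΨ : ∀ g, Ψ (V.fn g) = φ g) (hΨ' : ∀ g, Ψ' (V.fn g) = φ g)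
    (h : ∀ d σ, Ψ (V.gen d σ) = Ψ' (V.gen d σ)) : Ψ = Ψ' := by
  have key : ∀ y, (W.evalFiber y).comp Ψ.toAlgHom = (W.evalFiber y).comp Ψ'.toAlgHom := fun y =>
    algHom_ext_of_local (V := V) (T := V.sections) (p := f y) polySections_le_sections
      (fun s hs => smooth_of_functions (V := V) ⟨s, hs⟩)
      (fun g hg => (congrArg (W.evalFiber y) (hΨ g)).trans
        ((hf.isThickenedEval y).eq_zero_of_eventually hg))
      (fun g => congrArg (W.evalFiber y) ((hΨ g).trans (hΨ' g).symm))
      (fun d σ => congrArg (W.evalFiber y) (h d σ))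
  apply GradedAlgHom.coe_toAlgHom_injective
  ext a
  exact functions_ext fun y => DFunLike.congr_fun (key y) a

/-- Data on generators, read at a point of the target. -/
def IsBase.localData (hφ : ∀ g, φ g ∈ W.functions.gr 0)
    (G : ∀ d, (V (-d)).DualSection →ₗ[ℝ] W.functions.carrier)
    (hGmem : ∀ d σ, G d σ ∈ W.functions.gr d)
    (hG : ∀ d g σ, G d (SmoothVB.smulSection g σ) = φ g * G d σ) (y : N) :
    LocalData V (f y) (W.symFiber y) where
  fn := (W.evalFiber y).comp φ
  gen d := (W.evalFiber y).toLinearMap.comp (G d)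
  fn_commute g r := (W.symAlg y).commute_of_mem_zero ((hφ g).2 y) r
  fn_local _ hg := (hf.isThickenedEval y).eq_zero_of_eventually hg
  gen_smul d g σ := (congrArg (W.evalFiber y) (hG d g σ)).trans (map_mul _ _ _)
  gen_mul_gen i j σ τ :=
    (W.symAlg y).graded_comm i j _ _ ((hGmem i σ).2 y) ((hGmem j τ).2 y)

omit hf in
/-- Local algebra morphisms into the fibres assemble to a morphism of graded manifolds if they do so
on generators. -/
theorem exists_hom_of_pointwise (hf : Continuous f)
    (Φ : ∀ y, V.smoothSections →ₐ[ℝ] W.symFiber y)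
    (hΦ : ∀ y s t, (∀ᶠ x in 𝓝 (f y), s.1 x = t.1 x) → Φ y s = Φ y t)
    {F : C^∞⟮𝓡 n, M; ℝ⟯ → W.functions.carrier}
    {G : ∀ d, (V (-d)).DualSection → W.functions.carrier}
    (hF : ∀ g, F g ∈ W.functions.gr 0) (hG : ∀ d σ, G d σ ∈ W.functions.gr d)
    (hfn : ∀ y g h, Φ y ⟨V.fnSection g, h⟩ = W.evalFiber y (F g))
    (hgen : ∀ y d σ h, Φ y ⟨V.genSection d σ, h⟩ = W.evalFiber y (G d σ)) :
    ∃ Ψ : GradedCommAlg.Hom V.functions W.functions,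
      (∀ g, Ψ (V.fn g) = F g) ∧ ∀ d σ, Ψ (V.gen d σ) = G d σ := by
  -- Smoothness in y is only assumed on generators. It passes to polynomials algebraically, and to
  -- all sections because the Φ y depend on germs and f is continuous.
  have hpoly : ∀ t (ht : t ∈ V.polySections),
      (fun y => Φ y ⟨t, polySections_le_smoothSections V ht⟩) ∈ W.smoothSections := by
    intro t ht
    induction ht using polySections_induction with
    | fn g =>
      have e : (fun y => Φ y ⟨V.fnSection g, polySections_le_smoothSections V
          (V.fnSection_mem g)⟩) = fun y => W.evalFiber y (F g) := funext fun y => hfn y g _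
      rw [e]
      exact smooth_of_functions (F g)
    | gen d σ =>
      have e : (fun y => Φ y ⟨V.genSection d σ, polySections_le_smoothSections V
          (V.genSection_mem d σ)⟩) = fun y => W.evalFiber y (G d σ) := funext fun y => hgen y d σ _
      rw [e]
      exact smooth_of_functions (G d σ)
    | add s t hs ht h h' =>
      have e : (fun y => Φ y ⟨s + t, polySections_le_smoothSections V (add_mem hs ht)⟩) =
          (fun y => Φ y ⟨s, polySections_le_smoothSections V hs⟩) +
            fun y => Φ y ⟨t, polySections_le_smoothSections V ht⟩ :=
        funext fun y => map_add (Φ y) ⟨s, _⟩ ⟨t, _⟩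
      rw [e]
      exact add_mem h h'
    | mul s t hs ht h h' =>
      have e : (fun y => Φ y ⟨s * t, polySections_le_smoothSections V (mul_mem hs ht)⟩) =
          (fun y => Φ y ⟨s, polySections_le_smoothSections V hs⟩) *
            fun y => Φ y ⟨t, polySections_le_smoothSections V ht⟩ :=
        funext fun y => map_mul (Φ y) ⟨s, _⟩ ⟨t, _⟩
      rw [e]
      exact mul_mem h h'
  have hcongr : ∀ (s t : V.smoothSections) (y₀ : N), (∀ᶠ x in 𝓝 (f y₀), s.1 x = t.1 x) →
      ∀ᶠ y in 𝓝 y₀, Φ y s = Φ y t := by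
    intro s t y₀ h
    filter_upwards [hf.continuousAt.eventually h.eventually_nhds] with y hy
    exact hΦ y s t hy
  have hsmooth : ∀ s : V.smoothSections, (fun y => Φ y s) ∈ W.smoothSections := by
    intro s y₀
    obtain ⟨t, ht, hst⟩ := s.2 (f y₀)
    obtain ⟨t', ht', h⟩ := hpoly t ht y₀
    refine ⟨t', ht', ?_⟩
    filter_upwards [h, hcongr s ⟨t, polySections_le_smoothSections V ht⟩ y₀ hst] with y h1 h2
    exact h2.trans h1
  -- The Φ y are not assumed to be graded. A homogeneous section is, near f(y), a combination of
  -- monomials of the same degree, and on those the degree is known from the generators.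
  have hdeg : ∀ (d : ℤ) (s : ∀ x, V.symFiber x) (hs : s ∈ V.homSections d),
      (fun y => Φ y ⟨s, hs.1⟩) ∈ W.homSections d := by
    intro d s hs
    refine ⟨hsmooth ⟨s, hs.1⟩, fun y => ?_⟩
    obtain ⟨t, ht, hst⟩ := exists_eventually_eq_monomials hs (f y)
    have hs' := hs.1
    have htp : ∃ htp : t ∈ V.smoothSections,
        Φ y ⟨t, htp⟩ ∈ GradedSym.deg (fun d : ℤ => (W (-d)).Dual y) d := by
      clear hst
      induction ht using Submodule.span_induction with
      | zero => exact ⟨zero_mem _, by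
          rw [show (⟨0, _⟩ : V.smoothSections) = 0 from rfl, map_zero]; exact zero_mem _⟩
      | add a b _ _ ha hb =>
        obtain ⟨ha, h⟩ := ha
        obtain ⟨hb, h'⟩ := hb
        refine ⟨add_mem ha hb, ?_⟩
        have := add_mem h h'
        rw [← map_add] at this
        exact this
      | smul c a _ ha =>
        obtain ⟨ha, h⟩ := ha
        refine ⟨Subalgebra.smul_mem _ ha c, ?_⟩
        have := Submodule.smul_mem _ c h
        rw [← map_smul] at this
        exact this
      | mem a ha =>
        obtain ⟨g, l, rfl, rfl⟩ := ha
        refine ⟨polySections_le_smoothSections V (V.monomial_mem g l), ?_⟩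
        clear hs
        have h1 : ∃ hl : (l.map fun σ => V.genSection σ.1 σ.2).prod ∈ V.smoothSections,
            Φ y ⟨_, hl⟩ ∈ GradedSym.deg (fun d : ℤ => (W (-d)).Dual y) (l.map Sigma.fst).sum := by
          induction l with
          | nil => exact ⟨one_mem _, by
              rw [show (⟨([].map fun σ : Σ d : ℤ, (V (-d)).DualSection =>
                V.genSection σ.1 σ.2).prod, _⟩ : V.smoothSections) = 1 from rfl, map_one]
              exact SetLike.GradedOne.one_mem⟩
          | cons σ l ih =>
            obtain ⟨hl, h⟩ := ih
            have hσ := (genSection_homSection (V := V) σ.1 σ.2).1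
            refine ⟨mul_mem hσ hl, ?_⟩
            have h2 : Φ y ⟨V.genSection σ.1 σ.2, hσ⟩ ∈
                GradedSym.deg (fun d : ℤ => (W (-d)).Dual y) σ.1 := by
              rw [hgen]
              exact (hG σ.1 σ.2).2 y
            have h3 := SetLike.mul_mem_graded h2 h
            rw [← map_mul] at h3
            exact h3
        obtain ⟨hl, h1⟩ := h1
        have h2 : Φ y ⟨V.fnSection g, (fnSection_homSection g).1⟩ ∈
            GradedSym.deg (fun d : ℤ => (W (-d)).Dual y) 0 := by
          rw [hfn]
          exact (hF g).2 y
        have h3 := SetLike.mul_mem_graded h2 h1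
        rw [← map_mul, zero_add] at h3
        exact h3
    obtain ⟨htp, h⟩ := htp
    change Φ y ⟨s, hs'⟩ ∈ _
    rwa [hΦ y ⟨s, hs'⟩ ⟨t, htp⟩ hst]
  let incl : V.sections →ₐ[ℝ] V.smoothSections :=
    Subalgebra.inclusion fun s hs => smooth_of_functions (V := V) ⟨s, hs⟩
  let Ψ₀ : V.sections →ₐ[ℝ] ∀ y, W.symFiber y := (AlgHom.pi Φ).comp incl
  have hrange : ∀ s, Ψ₀ s ∈ W.sections := by
    rintro ⟨s, c, rfl⟩
    induction c using DirectSum.induction_on with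
    | zero =>
      convert zero_mem W.sections
      exact (congrArg Ψ₀ (Subtype.ext (map_zero _))).trans (map_zero Ψ₀)
    | of d s =>
      refine W.homSections_le d ?_
      convert hdeg d _ s.2 using 1
      funext y
      exact congrArg (Φ y) (Subtype.ext (DirectSum.coeAlgHom_of _ _ _))
    | add a b ha hb =>
      convert add_mem ha hb
      refine Eq.trans ?_ (map_add Ψ₀ _ _)
      exact congrArg Ψ₀ (Subtype.ext (map_add _ _ _))
  let Ψ : V.functions.carrier →ₐ[ℝ] W.functions.carrier := Ψ₀.codRestrict W.sections hrange
  refine ⟨{ Ψ with map_mem := fun {d s} hs => hdeg d _ (homSection_of_mem_gr hs) }, fun g => ?_,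
    fun d σ => ?_⟩
  · exact functions_ext fun y => hfn y g _
  · exact functions_ext fun y => hgen y d σ _

/-- Morphisms from a split graded manifold can be prescribed on generators. -/
theorem IsBase.exists_hom (hφ : ∀ g, φ g ∈ W.functions.gr 0)
    (G : ∀ d, (V (-d)).DualSection →ₗ[ℝ] W.functions.carrier)
    (hGmem : ∀ d σ, G d σ ∈ W.functions.gr d)
    (hG : ∀ d g σ, G d (SmoothVB.smulSection g σ) = φ g * G d σ) :
    ∃ Ψ : GradedCommAlg.Hom V.functions W.functions,
      (∀ g, Ψ (V.fn g) = φ g) ∧ ∀ d σ, Ψ (V.gen d σ) = G d σ :=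
  exists_hom_of_pointwise (F := φ) (G := fun d => G d) hf.continuous
    (fun y => (hf.localData hφ G hGmem hG y).hom)
    (fun y _ _ h => (hf.localData hφ G hGmem hG y).hom_congr h) hφ hGmem
    (fun y g h => (hf.localData hφ G hGmem hG y).hom_fn g h)
    (fun y d σ h => (hf.localData hφ G hGmem hG y).hom_gen d σ h)

/-- Derivations with values in functions on a split graded manifold factor through the
differential. -/
theorem IsBase.exists_linear_of_derivation {d : ℤ}
    {δ : C^∞⟮𝓡 n, M; ℝ⟯ →ₗ[ℝ] W.functions.carrier} (hδmem : ∀ g, δ g ∈ W.functions.gr d)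
    (hφ : ∀ g, φ g ∈ W.functions.gr 0)
    (hδ : ∀ g h, δ (g * h) = φ g * δ h + φ h * δ g) :
    ∃ G : (SmoothVB.tangent n M).DualSection →ₗ[ℝ] W.functions.carrier,
      (∀ α, G α ∈ W.functions.gr d) ∧ (∀ g σ, G (SmoothVB.smulSection g σ) = φ g * G σ) ∧
        ∀ g, G (differential g) = δ g := by
  choose G hG hGd using fun y => (hf.isThickenedEval y).exists_linear_of_derivation
    (δ := (W.evalFiber y).toLinearMap.comp δ) fun g h => by
      change W.evalFiber y (δ (g * h)) = _
      rw [hδ, map_add, map_mul, map_mul]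
      rfl
  have hmem : ∀ α, (fun y => G y α) ∈ W.homSections d := by
    intro α
    -- The pointwise maps G y were chosen independently. Coordinates at f(y₀) still give the single
    -- formula Σ φ(a_i) δ(X_i) for all y near y₀, which shows that y ↦ G y α is smooth.
    have hloc : ∀ y₀, ∃ t ∈ W.homSections d, ∀ᶠ y in 𝓝 y₀, G y α = t y := by
      intro y₀
      obtain ⟨X, -, -, hX, -⟩ := exists_coordinates n (f y₀)
      obtain ⟨a, ha⟩ := hX α
      refine ⟨fun y => W.evalFiber y (∑ i, φ (a i) * δ (X i)), ?_, ?_⟩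
      · refine homSection_of_mem_gr (sum_mem fun i _ => ?_)
        have := SetLike.mul_mem_graded (hφ (a i)) (hδmem (X i))
        rwa [zero_add] at this
      · filter_upwards [hf.continuous.continuousAt.eventually ha.eventually_nhds] with y hy
        rw [(hf.isThickenedEval y).linear_sum (hG y) hy, map_sum]
        refine Finset.sum_congr rfl fun i _ => ?_
        rw [hGd, map_mul]
        rfl
    refine ⟨fun y₀ => ?_, fun y => ?_⟩
    · obtain ⟨t, ht, h⟩ := hloc y₀
      obtain ⟨t', ht', h'⟩ := ht.1 y₀
      exact ⟨t', ht', by filter_upwards [h, h'] with y h1 h2 using h1.trans h2⟩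
    · obtain ⟨t, ht, h⟩ := hloc y
      have := ht.2 y
      rwa [← h.self_of_nhds] at this
  refine ⟨{ toFun := fun α => ofHomSection _ (hmem α)
            map_add' := fun α β => functions_ext fun y => ?_
            map_smul' := fun c α => functions_ext fun y => ?_ },
    fun α => ofHomSection_mem _ (hmem α), fun g σ => functions_ext fun y => ?_,
    fun g => functions_ext fun y => hGd y g⟩
  · rw [map_add]; exact map_add (G y) α β
  · rw [map_smul]; exact map_smul (G y) c α
  · rw [map_mul]; exact hG y g σ

omit hf in
/-- Homogeneous functions of degree `d` are glued from local ones. -/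
theorem mem_homSections_of_local {d : ℤ} {s : ∀ x, V.symFiber x}
    (h : ∀ p, ∃ t ∈ V.homSections d, ∀ᶠ x in 𝓝 p, s x = t x) : s ∈ V.homSections d := by
  refine ⟨fun p => ?_, fun p => ?_⟩
  · obtain ⟨t, ht, hst⟩ := h p
    obtain ⟨t', ht', hst'⟩ := ht.1 p
    exact ⟨t', ht', by filter_upwards [hst, hst'] with y h1 h2 using h1.trans h2⟩
  · obtain ⟨t, ht, hst⟩ := h p
    rw [hst.self_of_nhds]
    exact ht.2 p

end Hom
end GradedVB
end

/-! ### The components of the graded bundle as sums of copies of TM -/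

noncomputable section

section DualMaps
variable {n : ℕ} {M : Type u} [TopologicalSpace M] [ChartedSpace (EuclideanSpace ℝ (Fin n)) M]

/-- The transpose of a bundle map that is constant in the preferred trivializations maps smooth
sections to smooth sections. -/
theorem contMDiff_dual_comp {V V' : SmoothVB n M} (A : ∀ x, V.fiber x →L[ℝ] V'.fiber x)
    (a : V.model →L[ℝ] V'.model)
    (hA : ∀ x₀, ∀ᶠ x in 𝓝 x₀, ∀ v,
      A x ((trivializationAt V.model V.fiber x₀).symmL ℝ x v) =
        (trivializationAt V'.model V'.fiber x₀).symmL ℝ x (a v))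
    (σ : V'.DualSection) :
    ContMDiff (𝓡 n) ((𝓡 n).prod 𝓘(ℝ, V.model →L[ℝ] ℝ)) ∞ (fun x =>
      (⟨x, (σ x).comp (A x)⟩ : Bundle.TotalSpace (V.model →L[ℝ] ℝ) V.Dual)) := fun x₀ => by
  refine (contMDiffAt_hom_bundle _).2 ⟨contMDiffAt_id, ?_⟩
  have h := ((contMDiffAt_hom_bundle _).1 (σ.contMDiff x₀)).2
  have h2 : ContMDiffAt (𝓡 n) 𝓘(ℝ, V.model →L[ℝ] ℝ) ∞ (fun x =>
      (ContinuousLinearMap.inCoordinates V'.model V'.fiber ℝ (Bundle.Trivial M ℝ) x₀ x x₀ x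
        (σ x)).comp a) x₀ := by
    exact ((ContinuousLinearMap.compL ℝ V.model V'.model ℝ).flip a).contMDiff.contMDiffAt.comp x₀ h
  refine h2.congr_of_eventuallyEq ?_
  filter_upwards [hA x₀] with x hx
  have key : ∀ (U : SmoothVB n M) (τ : U.Dual x) (v : U.model),
      ContinuousLinearMap.inCoordinates U.model U.fiber ℝ (Bundle.Trivial M ℝ) x₀ x x₀ x τ v =
        τ ((trivializationAt U.model U.fiber x₀).symmL ℝ x v) := fun U τ v => by
    simp [ContinuousLinearMap.inCoordinates]
  ext v
  refine (key V _ v).trans (Eq.trans ?_ (key V' _ (a v)).symm)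
  exact congrArg (σ x) (hx v)

/-- A fibrewise linear map between dual bundles that preserves smooth sections. -/
structure DualMap (V V' : SmoothVB n M) where
  toFun : ∀ x, V.Dual x →ₗ[ℝ] V'.Dual x
  onSections : V.DualSection → V'.DualSection
  onSections_apply : ∀ σ x, onSections σ x = toFun x (σ x)

namespace DualMap

/-- The identity. -/
def id (V : SmoothVB n M) : DualMap V V where
  toFun _ := LinearMap.id
  onSections σ := σ
  onSections_apply _ _ := rfl

/-- Composition. -/
def comp {V V' V'' : SmoothVB n M} (B : DualMap V' V'') (A : DualMap V V') : DualMap V V'' where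
  toFun x := (B.toFun x).comp (A.toFun x)
  onSections σ := B.onSections (A.onSections σ)
  onSections_apply σ x := by rw [B.onSections_apply, A.onSections_apply]; rfl

/-- The transpose of a bundle map. -/
def transpose {V V' : SmoothVB n M} (A : ∀ x, V.fiber x →L[ℝ] V'.fiber x)
    (a : V.model →L[ℝ] V'.model)
    (hA : ∀ x₀, ∀ᶠ x in 𝓝 x₀, ∀ v,
      A x ((trivializationAt V.model V.fiber x₀).symmL ℝ x v) =
        (trivializationAt V'.model V'.fiber x₀).symmL ℝ x (a v)) : DualMap V' V where
  toFun x :=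
    { toFun := fun σ => σ.comp (A x)
      map_add' := fun _ _ => rfl
      map_smul' := fun _ _ => rfl }
  onSections σ := ⟨fun x => (σ x).comp (A x), contMDiff_dual_comp A a hA σ⟩
  onSections_apply _ _ := rfl

variable [IsManifold (𝓡 n) ∞ M] (V W : SmoothVB n M)

/-- The preferred trivialization of a direct sum is the product of those of the summands. Hence the
inclusions and projections are constant in trivializations, and their transposes preserve
smoothness. -/
theorem prod_symmL (x₀ : M) : ∀ᶠ x in 𝓝 x₀, ∀ (v : V.model) (w : W.model),
    (trivializationAt (V.prod W).model (V.prod W).fiber x₀).symmL ℝ x (v, w) =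
      ((trivializationAt V.model V.fiber x₀).symmL ℝ x v,
        (trivializationAt W.model W.fiber x₀).symmL ℝ x w) := by
  let e := trivializationAt V.model V.fiber x₀
  let e' := trivializationAt W.model W.fiber x₀
  filter_upwards [e.open_baseSet.mem_nhds (FiberBundle.mem_baseSet_trivializationAt _ _ x₀),
    e'.open_baseSet.mem_nhds (FiberBundle.mem_baseSet_trivializationAt _ _ x₀)] with x hx hx' v w
  have h := Bundle.Trivialization.continuousLinearEquivAt_prod (𝕜 := ℝ) (e₁ := e) (e₂ := e')
    (x := x) ⟨hx, hx'⟩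
  have h2 := congrArg (fun E => ContinuousLinearEquiv.symm E (v, w)) h
  have h3 := (e.prod e').symm_continuousLinearEquivAt_eq (R := ℝ) (b := x) ⟨hx, hx'⟩
  have h4 := e.symm_continuousLinearEquivAt_eq (R := ℝ) (b := x) hx
  have h5 := e'.symm_continuousLinearEquivAt_eq (R := ℝ) (b := x) hx'
  refine (congrFun h3 (v, w)).symm.trans (h2.trans ?_)
  exact Prod.ext (congrFun h4 v) (congrFun h5 w)

/-- The projection to the dual of the first summand. -/
def fst : DualMap (V.prod W) V :=
  transpose (V := V) (V' := V.prod W) (fun x => ContinuousLinearMap.inl ℝ (V.fiber x) (W.fiber x))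
    (ContinuousLinearMap.inl ℝ V.model W.model) fun x₀ =>
    (prod_symmL V W x₀).mono fun x hx v => by
      refine Eq.trans ?_ (hx v 0).symm
      rw [map_zero]
      rfl

/-- The projection to the dual of the second summand. -/
def snd : DualMap (V.prod W) W :=
  transpose (V := W) (V' := V.prod W) (fun x => ContinuousLinearMap.inr ℝ (V.fiber x) (W.fiber x))
    (ContinuousLinearMap.inr ℝ V.model W.model) fun x₀ =>
    (prod_symmL V W x₀).mono fun x hx v => by
      refine Eq.trans ?_ (hx 0 v).symm
      rw [map_zero]
      rfl

/-- The inclusion of the dual of the first summand. -/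
def inl : DualMap V (V.prod W) :=
  transpose (V := V.prod W) (V' := V) (fun x => ContinuousLinearMap.fst ℝ (V.fiber x) (W.fiber x))
    (ContinuousLinearMap.fst ℝ V.model W.model) fun x₀ =>
    (prod_symmL V W x₀).mono fun _ hx v => congrArg Prod.fst (hx v.1 v.2)

/-- The inclusion of the dual of the second summand. -/
def inr : DualMap W (V.prod W) :=
  transpose (V := V.prod W) (V' := W) (fun x => ContinuousLinearMap.snd ℝ (V.fiber x) (W.fiber x))
    (ContinuousLinearMap.snd ℝ V.model W.model) fun x₀ =>
    (prod_symmL V W x₀).mono fun _ hx v => congrArg Prod.snd (hx v.1 v.2)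

end DualMap

variable [IsManifold (𝓡 n) ∞ M]

/-- A decomposition of the dual of `E` into copies of the cotangent bundle, indexed by `J`. -/
structure CotangentPower (E : SmoothVB n M) (J : Type) [Fintype J] where
  inj : J → DualMap (SmoothVB.tangent n M) E
  proj : J → DualMap E (SmoothVB.tangent n M)
  sum_inj_proj : ∀ x (σ : E.Dual x), ∑ j, (inj j).toFun x ((proj j).toFun x σ) = σ
  proj_inj_self : ∀ j x α, (proj j).toFun x ((inj j).toFun x α) = α
  proj_inj_of_ne : ∀ i j x α, i ≠ j → (proj i).toFun x ((inj j).toFun x α) = 0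

namespace CotangentPower

/-- The tangent bundle itself. -/
def tangent : CotangentPower (SmoothVB.tangent n M) Unit where
  inj _ := DualMap.id _
  proj _ := DualMap.id _
  sum_inj_proj _ _ := by simp [DualMap.id]
  proj_inj_self _ _ _ := rfl
  proj_inj_of_ne _ _ _ _ h := absurd rfl h

/-- The zero bundle. -/
def zero : CotangentPower (SmoothVB.zero n M) Empty where
  inj j := j.elim
  proj j := j.elim
  sum_inj_proj x σ := by
    rw [Finset.univ_eq_empty, Finset.sum_empty]
    refine ContinuousLinearMap.ext fun v => ?_
    have hv : v = 0 := (inferInstance : Subsingleton (EuclideanSpace ℝ (Fin 0))).elim _ _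
    rw [hv, map_zero, map_zero]
  proj_inj_self j := j.elim
  proj_inj_of_ne j := j.elim

/-- Reindexing. -/
def reindex {E : SmoothVB n M} {J J' : Type} [Fintype J] [Fintype J'] (P : CotangentPower E J)
    (e : J' ≃ J) : CotangentPower E J' where
  inj j := P.inj (e j)
  proj j := P.proj (e j)
  sum_inj_proj x σ := (Equiv.sum_comp e fun j => (P.inj j).toFun x ((P.proj j).toFun x σ)).trans
    (P.sum_inj_proj x σ)
  proj_inj_self j := P.proj_inj_self (e j)
  proj_inj_of_ne _ _ x α h := P.proj_inj_of_ne _ _ x α fun h' => h (e.injective h')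

/-- Direct sums. -/
def prod {E E' : SmoothVB n M} {J J' : Type} [Fintype J] [Fintype J'] (P : CotangentPower E J)
    (P' : CotangentPower E' J') : CotangentPower (E.prod E') (J ⊕ J') where
  inj := Sum.elim (fun j => (DualMap.inl E E').comp (P.inj j))
    fun j => (DualMap.inr E E').comp (P'.inj j)
  proj := Sum.elim (fun j => (P.proj j).comp (DualMap.fst E E'))
    fun j => (P'.proj j).comp (DualMap.snd E E')
  sum_inj_proj x σ := by
    rw [Fintype.sum_sum_type]
    have h1 := P.sum_inj_proj x ((DualMap.fst E E').toFun x σ)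
    have h2 := P'.sum_inj_proj x ((DualMap.snd E E').toFun x σ)
    have h3 : (DualMap.inl E E').toFun x ((DualMap.fst E E').toFun x σ) +
        (DualMap.inr E E').toFun x ((DualMap.snd E E').toFun x σ) = σ := by
      refine ContinuousLinearMap.ext fun v => ?_
      refine (map_add σ (v.1, 0) (0, v.2)).symm.trans (congrArg σ ?_)
      exact Prod.ext (add_zero _) (zero_add _)
    rw [← h1, ← h2, map_sum, map_sum] at h3
    exact h3
  proj_inj_self := by
    rintro (j | j) x α
    · exact P.proj_inj_self j x α
    · exact P'.proj_inj_self j x α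
  proj_inj_of_ne := by
    rintro (i | i) (j | j) x α h
    · exact P.proj_inj_of_ne i j x α fun h' => h (congrArg _ h')
    · refine (congrArg ((P.proj i).toFun x) ?_).trans (map_zero _)
      exact ContinuousLinearMap.ext fun v => map_zero ((P'.inj j).toFun x α)
    · refine (congrArg ((P'.proj i).toFun x) ?_).trans (map_zero _)
      exact ContinuousLinearMap.ext fun v => map_zero ((P.inj j).toFun x α)
    · exact P'.proj_inj_of_ne i j x α fun h' => h (congrArg _ h')

end CotangentPower

/-- The bundle is the sum of `m` copies of the tangent bundle. -/
def IsTangentPower (E : SmoothVB n M) (m : ℕ) : Prop := Nonempty (CotangentPower E (Fin m))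

theorem isTangentPower_zero : IsTangentPower (SmoothVB.zero n M) 0 :=
  ⟨CotangentPower.zero.reindex (Equiv.equivOfIsEmpty _ _)⟩

theorem isTangentPower_tangent : IsTangentPower (SmoothVB.tangent n M) 1 :=
  ⟨CotangentPower.tangent.reindex (Equiv.ofUnique _ _)⟩

theorem IsTangentPower.prod {E E' : SmoothVB n M} {m m' : ℕ} :
    IsTangentPower E m → IsTangentPower E' m' → IsTangentPower (E.prod E') (m + m') :=
  fun ⟨P⟩ ⟨P'⟩ => ⟨(P.prod P').reindex finSumFinEquiv.symm⟩

namespace GradedVB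

theorem isTangentPower_copies {V : GradedVB n M} {d : ℤ} {m : ℕ} (h : IsTangentPower (V d) m) :
    ∀ c : ℕ, IsTangentPower (V.copies c d) (c * m)
  | 0 => by rw [zero_mul]; exact isTangentPower_zero
  | c + 1 => by rw [add_mul, one_mul]; exact (isTangentPower_copies h c).prod h

theorem isTangentPower_sumIcc {V : ℕ → GradedVB n M} {d : ℤ} {m : ℕ → ℕ}
    (h : ∀ i, IsTangentPower (V i d) (m i)) :
    ∀ k, IsTangentPower (sumIcc V k d) (∑ i ∈ Finset.range k, m (i + 1))
  | 0 => isTangentPower_zero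
  | k + 1 => by rw [Finset.sum_range_succ]; exact (isTangentPower_sumIcc h k).prod (h (k + 1))

theorem isTangentPower_shiftedTangent (i d : ℤ) :
    IsTangentPower (shiftedTangent n M i d) (if i + d = 0 then 1 else 0) := by
  change IsTangentPower (if i + d = 0 then _ else _) _
  split_ifs
  · exact isTangentPower_tangent
  · exact isTangentPower_zero

theorem isTangentPower_iteratedTangent (k : ℕ) (d : ℤ) :
    IsTangentPower (iteratedTangent n M k d)
      (∑ i ∈ Finset.range k, k.choose (i + 1) * if ((i + 1 : ℕ) : ℤ) + d = 0 then 1 else 0) :=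
  isTangentPower_sumIcc (fun i => isTangentPower_copies (isTangentPower_shiftedTangent i d) _) k

/-- The indices, other than that of `1`, of the elements of degree `-d` of a basis. -/
abbrev _root_.WeilBasis.Index {L : GradedCommAlg.{w}} (b : WeilBasis L) (d : ℤ) : Type :=
  {i : b.idx // i ≠ b.unit ∧ (b.deg i : ℤ) = d}

instance _root_.WeilBasis.fintypeIndex {L : GradedCommAlg.{w}} (b : WeilBasis L) (d : ℤ) :
    Fintype (b.Index d) := by
  classical exact inferInstance

/-- At most one summand i + 1 = d of the sum survives, and it counts the products of d distinct
generators. Discarding the unit empties the index set in degree 0, matching a bundle with no degree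
0 component. -/
theorem card_Index_Dpow (k : ℕ) (d : ℤ) : Fintype.card ((WeilBasis.Dpow k).Index d) =
    ∑ i ∈ Finset.range k, k.choose (i + 1) * if ((i + 1 : ℕ) : ℤ) + -d = 0 then 1 else 0 := by
  classical
  let b := WeilBasis.Dpow k
  by_cases hd : ∃ e : ℕ, d = (e + 1 : ℕ)
  · obtain ⟨e, rfl⟩ := hd
    have h1 : Fintype.card ((WeilBasis.Dpow k).Index (e + 1 : ℕ)) = k.choose (e + 1) := by
      rw [← WeilBasis.card_Dpow]
      refine Fintype.card_congr (Equiv.subtypeEquivRight fun i => ⟨fun h => ?_, fun h => ⟨?_, ?_⟩⟩)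
      · exact_mod_cast h.2
      · rintro rfl
        rw [b.deg_unit] at h
        exact absurd h (by omega)
      · exact_mod_cast h
    rw [h1]
    have h2 : ∀ i, (((i + 1 : ℕ) : ℤ) + -((e + 1 : ℕ) : ℤ) = 0) ↔ e = i := fun i => by omega
    simp only [h2, mul_ite, mul_one, mul_zero]
    rw [Finset.sum_ite_eq]
    split_ifs with h
    · rfl
    · rw [Finset.mem_range, not_lt] at h
      -- Beyond the range of the sum, e + 1 exceeds k and both sides vanish.
      exact Nat.choose_eq_zero_of_lt (by omega)
  · have h1 : IsEmpty ((WeilBasis.Dpow k).Index d) := ⟨fun i => by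
      have h2 : b.deg i.1 ≠ 0 := fun h => i.2.1 ((b.deg_eq_zero _).1 h)
      refine hd ⟨b.deg i.1 - 1, ?_⟩
      refine i.2.2.symm.trans ?_
      change ((b.deg i.1 : ℕ) : ℤ) = _
      omega⟩
    rw [Fintype.card_eq_zero]
    symm
    refine Finset.sum_eq_zero fun i _ => ?_
    rw [if_neg, mul_zero]
    intro h
    exact hd ⟨i, by omega⟩

/-- Only the number of copies matters: any bijection between the copies and the basis elements of
degree -d will do. -/
theorem nonempty_cotangentPower (k : ℕ) (d : ℤ) :
    Nonempty (CotangentPower (iteratedTangent n M k (-d)) ((WeilBasis.Dpow k).Index d)) := by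
  obtain ⟨P⟩ := isTangentPower_iteratedTangent (n := n) (M := M) k (-d)
  rw [← card_Index_Dpow] at P
  exact ⟨P.reindex (Fintype.equivFin _)⟩

variable (n M) in
/-- The decomposition of the duals of the components of `⨁ T[i]M^{binom(k,i)}` into copies of the
cotangent bundle. -/
def cotangentPower (k : ℕ) (d : ℤ) :
    CotangentPower (iteratedTangent n M k (-d)) ((WeilBasis.Dpow k).Index d) :=
  (nonempty_cotangentPower k d).some

end GradedVB
end DualMaps
end

/-! ### Contraction of bilinear forms and covariant derivatives of 1-forms -/

noncomputable section

namespace GradedVB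
variable (n : ℕ) (M : Type u) [TopologicalSpace M] [ChartedSpace (EuclideanSpace ℝ (Fin n)) M]
  [IsManifold (𝓡 n) ∞ M]

/-- The graded vector bundle that is the tangent bundle in each degree. -/
abbrev constTangent : GradedVB n M := fun _ => SmoothVB.tangent n M

variable {n M}

/-- The cotangent space. -/
abbrev _root_.CotangentSpace (n : ℕ) {M : Type u} [TopologicalSpace M]
    [ChartedSpace (EuclideanSpace ℝ (Fin n)) M] (x : M) : Type :=
  TangentSpace (𝓡 n) x →L[ℝ] Bundle.Trivial M ℝ x

/-- The bilinear form `β ⊗ γ`. -/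
def _root_.CotangentSpace.tensor {x : M} (β γ : CotangentSpace n x) :
    TangentSpace (𝓡 n) x →L[ℝ] CotangentSpace n x := ContinuousLinearMap.smulRight β γ

/-- A basis of the tangent space. -/
def _root_.CotangentSpace.vector (n : ℕ) {M : Type u} [TopologicalSpace M]
    [ChartedSpace (EuclideanSpace ℝ (Fin n)) M] (x : M) (j : Fin n) : TangentSpace (𝓡 n) x :=
  (EuclideanSpace.single j (1 : ℝ) : EuclideanSpace ℝ (Fin n))

/-- The dual basis of the cotangent space. -/
def _root_.CotangentSpace.form (n : ℕ) {M : Type u} [TopologicalSpace M]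
    [ChartedSpace (EuclideanSpace ℝ (Fin n)) M] (x : M) (j : Fin n) : CotangentSpace n x :=
  (EuclideanSpace.proj j : EuclideanSpace ℝ (Fin n) →L[ℝ] ℝ)

theorem _root_.CotangentSpace.eq_sum {x : M} (β : CotangentSpace n x) :
    β = ∑ j, (β (CotangentSpace.vector n x j) : ℝ) • CotangentSpace.form n x j := by
  refine ContinuousLinearMap.ext fun v => ?_
  have hv : ∀ v : EuclideanSpace ℝ (Fin n), v = ∑ i, v i • EuclideanSpace.single i (1 : ℝ) := by
    intro v
    ext j; simp [Pi.single_apply]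
  rw [sum_apply]
  refine (congrArg β (hv v)).trans ((map_sum β _ _).trans (Finset.sum_congr rfl fun i _ => ?_))
  refine (map_smul β _ _).trans ?_
  exact mul_comm _ _

/-- A covector as a generator of degree `d`. -/
def formι (x : M) (d : ℤ) : CotangentSpace n x →ₗ[ℝ] (constTangent n M).symFiber x :=
  GradedSym.ι (fun d : ℤ => (constTangent n M (-d)).Dual x) d

theorem formι_mem {x : M} (d : ℤ) (β : CotangentSpace n x) :
    formι x d β ∈ GradedSym.deg (fun d : ℤ => (constTangent n M (-d)).Dual x) d :=
  GradedSym.ι_mem (P := fun d : ℤ => (constTangent n M (-d)).Dual x) d β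

/-- The contraction `β ⊗ γ ↦ β γ` of bilinear forms into the symmetric algebra, where `β` has degree
`0` and `γ` has degree `d`. -/
def contract (x : M) (d : ℤ) :
    (TangentSpace (𝓡 n) x →L[ℝ] CotangentSpace n x) →ₗ[ℝ] (constTangent n M).symFiber x where
  toFun A := ∑ j : Fin n, formι x 0 (CotangentSpace.form n x j) *
    formι x d (A (CotangentSpace.vector n x j))
  map_add' A B := by
    rw [← Finset.sum_add_distrib]
    refine Finset.sum_congr rfl fun j _ => ?_
    rw [← mul_add]
    exact congrArg _ (map_add (formι x d) _ _)
  map_smul' c A := by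
    rw [Finset.smul_sum]
    refine Finset.sum_congr rfl fun j _ => ?_
    rw [RingHom.id_apply, ← mul_smul_comm]
    exact congrArg _ (map_smul (formι x d) _ _)

theorem contract_apply {x : M} (d : ℤ) (A : TangentSpace (𝓡 n) x →L[ℝ] CotangentSpace n x) :
    contract x d A = ∑ j : Fin n, formι x 0 (CotangentSpace.form n x j) *
      formι x d (A (CotangentSpace.vector n x j)) := rfl

/-- Expand β in the dual basis and use bilinearity of the product. -/
theorem contract_tensor {x : M} (d : ℤ) (β γ : CotangentSpace n x) :
    contract x d (CotangentSpace.tensor β γ) = formι x 0 β * formι x d γ := by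
  conv_rhs => rw [CotangentSpace.eq_sum β, map_sum, Finset.sum_mul]
  rw [contract_apply]
  refine Finset.sum_congr rfl fun j _ => ?_
  rw [map_smul, smul_mul_assoc, ← mul_smul_comm]
  exact congrArg _ (map_smul (formι x d) _ γ)

theorem contract_mem {x : M} (d : ℤ) (A : TangentSpace (𝓡 n) x →L[ℝ] CotangentSpace n x) :
    contract x d A ∈ GradedSym.deg (fun d : ℤ => (constTangent n M (-d)).Dual x) d := by
  rw [contract_apply]
  refine Submodule.sum_mem _ fun j _ => ?_
  have := SetLike.mul_mem_graded (formι_mem 0 (CotangentSpace.form n x j))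
    (formι_mem d (A (CotangentSpace.vector n x j)))
  rwa [zero_add] at this

end GradedVB

section Connection
variable {n : ℕ} {M : Type u} [TopologicalSpace M] [ChartedSpace (EuclideanSpace ℝ (Fin n)) M]
  [IsManifold (𝓡 n) ∞ M]
  (conn : CovariantDerivative (𝓡 n) (EuclideanSpace ℝ (Fin n) →L[ℝ] ℝ)
      (fun x : M => TangentSpace (𝓡 n) x →L[ℝ] Bundle.Trivial M ℝ x))

/-- The covariant derivative of a `1`-form at a point. -/
def covariantDerivativeAt (x : M) : (SmoothVB.tangent n M).DualSection →ₗ[ℝ]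
    (TangentSpace (𝓡 n) x →L[ℝ] CotangentSpace n x) where
  toFun α := conn.toFun (fun x => α x) x
  map_add' α β := conn.isCovariantDerivativeOnUniv.add
    (α.contMDiff.mdifferentiable (by simp) x) (β.contMDiff.mdifferentiable (by simp) x)
  map_smul' c α := conn.isCovariantDerivativeOnUniv.smul_const c
    (α.contMDiff.mdifferentiable (by simp) x)

theorem covariantDerivativeAt_smulSection (x : M) (f : C^∞⟮𝓡 n, M; ℝ⟯)
    (α : (SmoothVB.tangent n M).DualSection) :
    covariantDerivativeAt conn x (SmoothVB.smulSection f α) =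
      f x • covariantDerivativeAt conn x α +
        CotangentSpace.tensor (differential f x) (α x) :=
  conn.isCovariantDerivativeOnUniv.leibniz (g := f)
    (α.contMDiff.mdifferentiable (by simp) x) (f.contMDiff.mdifferentiable (by simp) x)

/-- In a frame e_i dual to dX_i one has ∇α = Σ dX_i ⊗ ∇_{e_i} α near p. Smoothness of the connection
makes the second factors germs of smooth 1-forms, so the contraction of ∇α is locally a polynomial
section. -/
theorem exists_covariantDerivative_expansion [T2Space M]
    [CovariantDerivative.ContMDiffCovariantDerivative conn ∞] (p : M)
    (α : (SmoothVB.tangent n M).DualSection) :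
    ∃ β γ : Fin n → (SmoothVB.tangent n M).DualSection, ∀ᶠ x in 𝓝 p,
      covariantDerivativeAt conn x α = ∑ i, CotangentSpace.tensor (β i x) (γ i x) := by
  obtain ⟨X, hX⟩ := exists_coordinate_functions n p
  obtain ⟨e, he, hX⟩ := exists_frame_of_coordinates X hX
  have hsmooth := (CovariantDerivative.ContMDiffCovariantDerivative.contMDiff (cov := conn)
    (k := ∞)).contMDiff (σ := fun x => α x) (α.contMDiff.contMDiffOn.of_le (by simp))
  have hγ : ∀ i, ∃ γ : (SmoothVB.tangent n M).DualSection, ∀ᶠ x in 𝓝 p,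
      γ x = covariantDerivativeAt conn x α (e i x) := fun i =>
    exists_section_eventuallyEq (n := n) (F := EuclideanSpace ℝ (Fin n) →L[ℝ] ℝ)
      (V := fun x : M => TangentSpace (𝓡 n) x →L[ℝ] Bundle.Trivial M ℝ x)
      ((he i).mono fun x h1 => ContMDiffAt.clm_bundle_apply (F₁ := EuclideanSpace ℝ (Fin n))
        (F₂ := EuclideanSpace ℝ (Fin n) →L[ℝ] ℝ)
        (E₂ := fun x : M => TangentSpace (𝓡 n) x →L[ℝ] Bundle.Trivial M ℝ x)
        (hsmooth.contMDiffAt Filter.univ_mem) h1)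
  choose γ hγ using hγ
  refine ⟨fun i => differential (X i), γ, ?_⟩
  filter_upwards [hX, Filter.eventually_all.2 hγ] with x h1 h2
  refine ContinuousLinearMap.ext fun v => ?_
  rw [sum_apply]
  nth_rewrite 1 [h1.1 v]
  rw [map_sum]
  refine Finset.sum_congr rfl fun i _ => ?_
  rw [map_smul, ← h2]
  rfl

end Connection
end

/-! ### The symmetrized covariant derivative as a derivation raising the order -/

noncomputable section

namespace DualNumber
variable {S : Type*} [Ring S] [Algebra ℝ S]

/-- The dual number `a + b ε`. -/
def mk (a b : S) : DualNumber S := TrivSqZeroExt.inl a + TrivSqZeroExt.inr b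

@[simp] theorem fst_mk (a b : S) : (mk a b).fst = a := by simp [mk]
@[simp] theorem snd_mk (a b : S) : (mk a b).snd = b := by simp [mk]

theorem snd_mul' (x y : DualNumber S) : (x * y).snd = x.fst * y.snd + x.snd * y.fst := by
  rw [TrivSqZeroExt.snd_mul, smul_eq_mul, MulOpposite.smul_eq_mul_unop, MulOpposite.unop_op]

theorem units_smul (e : ℤˣ) (x : DualNumber S) : (e • x).fst = e • x.fst ∧ (e • x).snd = e • x.snd := by
  rcases Int.units_eq_one_or e with rfl | rfl
  · simp
  · simp [Units.smul_def]

/-- The auxiliary ε is central and of degree 0, unlike the generator of C(D), so it contributes no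
sign. Since ε² = 0, no relation between b and d is needed. -/
theorem mk_mul_mk_comm {e : ℤˣ} {a b c d : S} (h1 : a * c = e • (c * a)) (h2 : a * d = e • (d * a))
    (h3 : b * c = e • (c * b)) : mk a b * mk c d = e • (mk c d * mk a b) := by
  have h := units_smul e (mk c d * mk a b)
  apply TrivSqZeroExt.ext
  · rw [h.1, TrivSqZeroExt.fst_mul, TrivSqZeroExt.fst_mul, fst_mk, fst_mk, h1]
  · rw [h.2, snd_mul', snd_mul', fst_mk, fst_mk, snd_mk, snd_mk, smul_add, h2, h3, add_comm]

end DualNumber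

namespace GradedVB
variable {n : ℕ} {M : Type u} [TopologicalSpace M] [ChartedSpace (EuclideanSpace ℝ (Fin n)) M]
  [IsManifold (𝓡 n) ∞ M]
  (conn : CovariantDerivative (𝓡 n) (EuclideanSpace ℝ (Fin n) →L[ℝ] ℝ)
      (fun x : M => TangentSpace (𝓡 n) x →L[ℝ] Bundle.Trivial M ℝ x))

theorem formι_add {x : M} (d : ℤ) (α β : (SmoothVB.tangent n M).DualSection) :
    formι x d ((α + β) x) = formι x d (α x) + formι x d (β x) := map_add (formι x d) (α x) (β x)

theorem formι_smul {x : M} (d : ℤ) (c : ℝ) (α : (SmoothVB.tangent n M).DualSection) :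
    formι x d ((c • α) x) = c • formι x d (α x) := map_smul (formι x d) c (α x)

theorem formι_smulSection {x : M} (d : ℤ) (f : C^∞⟮𝓡 n, M; ℝ⟯)
    (α : (SmoothVB.tangent n M).DualSection) :
    formι x d (SmoothVB.smulSection f α x) = f x • formι x d (α x) :=
  map_smul (formι x d) (f x) (α x)

/-- The differential as a derivation. -/
theorem formι_differential_mul {x : M} (f g : C^∞⟮𝓡 n, M; ℝ⟯) :
    formι x 0 (differential (f * g) x) =
      f x • formι x 0 (differential g x) + g x • formι x 0 (differential f x) := by
  rw [differential_mul, formι_add, formι_smulSection, formι_smulSection]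

theorem formι_differential_const {x : M} (c : ℝ) :
    formι x 0 (differential (algebraMap ℝ C^∞⟮𝓡 n, M; ℝ⟯ c) x) = 0 := by
  rw [differential_const]
  exact map_zero (formι x 0)

/-- The `1`-jet `f + ε df` of a function. -/
def jet (x : M) : C^∞⟮𝓡 n, M; ℝ⟯ →ₐ[ℝ] DualNumber ((constTangent n M).symFiber x) where
  toFun f := DualNumber.mk (algebraMap ℝ _ (f x)) (formι x 0 (differential f x))
  map_one' := TrivSqZeroExt.ext ((DualNumber.fst_mk _ _).trans (map_one _)) <| by
    refine (DualNumber.snd_mk _ _).trans ?_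
    have h := formι_differential_const (n := n) (x := x) 1
    rwa [map_one] at h
  map_mul' f g := TrivSqZeroExt.ext
    (by
      rw [TrivSqZeroExt.fst_mul, DualNumber.fst_mk, DualNumber.fst_mk, DualNumber.fst_mk, ← map_mul]
      rfl)
    (by
      rw [DualNumber.snd_mul', DualNumber.fst_mk, DualNumber.fst_mk, DualNumber.snd_mk,
        DualNumber.snd_mk, DualNumber.snd_mk, ← Algebra.commutes (g x), ← Algebra.smul_def,
        ← Algebra.smul_def, formι_differential_mul])
  map_zero' := TrivSqZeroExt.ext ((DualNumber.fst_mk _ _).trans (map_zero _)) <| by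
    refine (DualNumber.snd_mk _ _).trans ?_
    have h := formι_differential_const (n := n) (x := x) 0
    rwa [map_zero] at h
  map_add' f g := TrivSqZeroExt.ext
    (by
      rw [TrivSqZeroExt.fst_add, DualNumber.fst_mk, DualNumber.fst_mk, DualNumber.fst_mk, ← map_add]
      rfl)
    (by
      rw [TrivSqZeroExt.snd_add, DualNumber.snd_mk, DualNumber.snd_mk, DualNumber.snd_mk,
        differential_add, formι_add])
  commutes' c := TrivSqZeroExt.ext (DualNumber.fst_mk _ _) <| by
    refine (DualNumber.snd_mk _ _).trans ?_
    exact formι_differential_const c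

theorem jet_apply (x : M) (f : C^∞⟮𝓡 n, M; ℝ⟯) :
    jet x f = DualNumber.mk (algebraMap ℝ _ (f x)) (formι x 0 (differential f x)) := rfl

theorem formι_zero_comm {x : M} (β : CotangentSpace n x) (s : (constTangent n M).symFiber x) :
    formι x 0 β * s = s * formι x 0 β :=
  ((constTangent n M).symAlg x).commute_of_mem_zero (formι_mem 0 β) s

/-- The symbol term df ⊗ α of the connection contracts to df · α. This is what the Leibniz rule
requires of a derivation with f ↦ df, and it makes f + ε df compatible with α + ε ∇α. -/
theorem contract_covariantDerivativeAt_smulSection {x : M} (d : ℤ) (f : C^∞⟮𝓡 n, M; ℝ⟯)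
    (α : (SmoothVB.tangent n M).DualSection) :
    contract x d (covariantDerivativeAt conn x (SmoothVB.smulSection f α)) =
      f x • contract x d (covariantDerivativeAt conn x α) +
        formι x 0 (differential f x) * formι x d (α x) := by
  have h := contract_tensor d (x := x) (differential f x) (α x)
  rw [covariantDerivativeAt_smulSection, ← h]
  exact (map_add (contract x d) _ _).trans
    (congrArg₂ (· + ·) (map_smul (contract x d) (f x) _) rfl)

theorem symFiber_mul_comm {x : M} {i j : ℤ} {a b : (constTangent n M).symFiber x}
    (ha : a ∈ GradedSym.deg (fun d : ℤ => (constTangent n M (-d)).Dual x) i)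
    (hb : b ∈ GradedSym.deg (fun d : ℤ => (constTangent n M (-d)).Dual x) j) :
    a * b = (-1 : ℤˣ) ^ (i * j) • (b * a) :=
  GradedSym.graded_comm i j a b ha hb

/-- The symmetrized covariant derivative on generators, read at a point: the `ε`-component is the
derivative. -/
def jetData (x : M) : LocalData (constTangent n M) x (DualNumber ((constTangent n M).symFiber x)) where
  fn := jet x
  gen d :=
    { toFun := fun α => DualNumber.mk (formι x d (α x)) (contract x d (covariantDerivativeAt conn x α))
      map_add' := fun α β => by
        apply TrivSqZeroExt.ext
        · rw [TrivSqZeroExt.fst_add, DualNumber.fst_mk, DualNumber.fst_mk, DualNumber.fst_mk,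
            formι_add]
        · rw [TrivSqZeroExt.snd_add, DualNumber.snd_mk, DualNumber.snd_mk, DualNumber.snd_mk,
            map_add (covariantDerivativeAt conn x), map_add (contract x d)]
      map_smul' := fun c α => by
        apply TrivSqZeroExt.ext
        · rw [RingHom.id_apply, TrivSqZeroExt.fst_smul, DualNumber.fst_mk, DualNumber.fst_mk,
            formι_smul]
        · rw [RingHom.id_apply, TrivSqZeroExt.snd_smul, DualNumber.snd_mk, DualNumber.snd_mk,
            map_smul (covariantDerivativeAt conn x), map_smul (contract x d)] }
  fn_commute f r := by
    apply TrivSqZeroExt.ext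
    · rw [jet_apply, TrivSqZeroExt.fst_mul, TrivSqZeroExt.fst_mul, DualNumber.fst_mk]
      exact Algebra.commutes _ _
    · rw [jet_apply, DualNumber.snd_mul', DualNumber.snd_mul', DualNumber.fst_mk, DualNumber.snd_mk,
        Algebra.commutes, add_comm]
      exact congrArg (· + _) (formι_zero_comm _ _)
  fn_local f hf := by
    apply TrivSqZeroExt.ext
    · rw [jet_apply, DualNumber.fst_mk, hf.self_of_nhds, map_zero]
      rfl
    · have h := (differential_congr (g := 0) hf).self_of_nhds
      have h0 := differential_const (n := n) (M := M) 0
      rw [map_zero] at h0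
      rw [jet_apply, DualNumber.snd_mk, h, h0]
      exact map_zero (formι x 0)
  gen_smul d f σ := by
    apply TrivSqZeroExt.ext
    · change TrivSqZeroExt.fst (DualNumber.mk _ _) = TrivSqZeroExt.fst (jet x f * DualNumber.mk _ _)
      rw [jet_apply, TrivSqZeroExt.fst_mul, DualNumber.fst_mk, DualNumber.fst_mk, DualNumber.fst_mk,
        ← Algebra.smul_def]
      exact formι_smulSection d f σ
    · change TrivSqZeroExt.snd (DualNumber.mk _ _) = TrivSqZeroExt.snd (jet x f * DualNumber.mk _ _)
      rw [jet_apply, DualNumber.snd_mul', DualNumber.fst_mk, DualNumber.fst_mk, DualNumber.snd_mk,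
        DualNumber.snd_mk, DualNumber.snd_mk, ← Algebra.smul_def]
      exact contract_covariantDerivativeAt_smulSection conn d f σ
  gen_mul_gen i j σ τ := by
    have h1 := symFiber_mul_comm (formι_mem i (σ x)) (formι_mem j (τ x))
    have h2 := symFiber_mul_comm (formι_mem i (σ x)) (contract_mem j (covariantDerivativeAt conn x τ))
    have h3 := symFiber_mul_comm (contract_mem i (covariantDerivativeAt conn x σ)) (formι_mem j (τ x))
    exact DualNumber.mk_mul_mk_comm h1 h2 h3

variable [T2Space M]

/-- Both sides are algebra morphisms that depend on germs at x and agree on functions and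
generators. -/
theorem fst_jetData_hom (x : M) (s : (constTangent n M).smoothSections) :
    ((jetData conn x).hom s).fst = s.1 x := by
  have h : (TrivSqZeroExt.fstHom ℝ _ _).comp (jetData conn x).hom =
      (Pi.evalAlgHom ℝ (constTangent n M).symFiber x).comp (constTangent n M).smoothSections.val := by
    refine algHom_ext_of_local (V := constTangent n M) (p := x)
      (polySections_le_smoothSections _) le_rfl ?_ ?_ ?_
    · intro f hf
      rw [AlgHom.comp_apply, LocalData.hom_fn, (jetData conn x).fn_local f hf, map_zero]
    · intro f
      rw [AlgHom.comp_apply, LocalData.hom_fn]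
      exact DualNumber.fst_mk _ _
    · intro d σ
      rw [AlgHom.comp_apply, LocalData.hom_gen]
      exact DualNumber.fst_mk _ _
  exact DFunLike.congr_fun h s

/-- The symmetrized covariant derivative of a smooth section, as a family of values. -/
def derivAt (s : (constTangent n M).smoothSections) : ∀ x, (constTangent n M).symFiber x := fun x =>
  ((jetData conn x).hom s).snd

/-- The ε-component of an algebra morphism whose ε-free part is the evaluation satisfies the Leibniz
rule. The derivation is thus obtained from the universal property for algebra morphisms. -/
theorem derivAt_mul (s t : (constTangent n M).smoothSections) :
    derivAt conn (s * t) = s.1 * derivAt conn t + derivAt conn s * t.1 := funext fun x => by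
  rw [derivAt, map_mul, DualNumber.snd_mul', fst_jetData_hom, fst_jetData_hom]
  rfl

theorem derivAt_add (s t : (constTangent n M).smoothSections) :
    derivAt conn (s + t) = derivAt conn s + derivAt conn t := funext fun x => by
  rw [derivAt, map_add, TrivSqZeroExt.snd_add]
  rfl

theorem derivAt_smul (c : ℝ) (s : (constTangent n M).smoothSections) :
    derivAt conn (c • s) = c • derivAt conn s := funext fun x => by
  rw [derivAt, map_smul, TrivSqZeroExt.snd_smul]
  rfl

theorem derivAt_fn (f : C^∞⟮𝓡 n, M; ℝ⟯) (h) :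
    derivAt conn ⟨(constTangent n M).fnSection f, h⟩ =
      (constTangent n M).genSection 0 (differential f) := funext fun x => by
  rw [derivAt, LocalData.hom_fn]
  exact DualNumber.snd_mk _ _

theorem derivAt_gen (d : ℤ) (σ : (SmoothVB.tangent n M).DualSection) (h) (x : M) :
    derivAt conn ⟨(constTangent n M).genSection d σ, h⟩ x =
      contract x d (covariantDerivativeAt conn x σ) := by
  rw [derivAt, LocalData.hom_gen]
  exact DualNumber.snd_mk _ _

theorem derivAt_congr {s t : (constTangent n M).smoothSections} {p : M}
    (h : ∀ᶠ x in 𝓝 p, s.1 x = t.1 x) : ∀ᶠ x in 𝓝 p, derivAt conn s x = derivAt conn t x := by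
  filter_upwards [h.eventually_nhds] with x hx
  rw [derivAt, (jetData conn x).hom_congr hx]
  rfl

/-- Polynomial sections of order at least `m` in the generators of degree `0`. -/
def order (n : ℕ) (M : Type u) [TopologicalSpace M] [ChartedSpace (EuclideanSpace ℝ (Fin n)) M]
    [IsManifold (𝓡 n) ∞ M] (m : ℕ) : Submodule ℝ (∀ x, (constTangent n M).symFiber x) :=
  LinearMap.range ((constTangent n M).genSection 0) ^ m * (constTangent n M).polySections.toSubmodule

theorem order_zero : order n M 0 = (constTangent n M).polySections.toSubmodule := by
  rw [order, pow_zero, one_mul]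

theorem order_succ (m : ℕ) :
    order n M (m + 1) = LinearMap.range ((constTangent n M).genSection 0) * order n M m := by
  rw [order, pow_succ', mul_assoc, ← order]

/-- Generators of degree 0 commute with everything, so G^a P G^b P = G^{a+b} P, with G their span
and P the polynomial sections. -/
theorem order_mul (a b : ℕ) : order n M a * order n M b ≤ order n M (a + b) := by
  let P := (constTangent n M).polySections.toSubmodule
  let G := LinearMap.range ((constTangent n M).genSection 0)
  have hPG : P * G = G * P := Submodule.mul_comm_of_commute fun s t _ ht => by
    obtain ⟨α, rfl⟩ := ht
    exact funext fun x => (formι_zero_comm (α x) (s x)).symm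
  have hPG' : ∀ m, P * G ^ m = G ^ m * P := by
    intro m
    induction m with
    | zero => rw [pow_zero, one_mul, mul_one]
    | succ m ih => rw [pow_succ, ← mul_assoc, ih, mul_assoc, hPG, mul_assoc]
  have hPP : P * P = P := Subalgebra.isIdempotentElem_toSubmodule _
  refine le_of_eq ?_
  change G ^ a * P * (G ^ b * P) = G ^ (a + b) * P
  rw [mul_assoc, ← mul_assoc P, hPG', mul_assoc, hPP, ← mul_assoc, pow_add]

theorem order_le (m : ℕ) : order n M m ≤ (constTangent n M).polySections.toSubmodule := by
  induction m with
  | zero => rw [order_zero]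
  | succ m ih =>
    rw [order_succ, Submodule.mul_le]
    rintro _ ⟨α, rfl⟩ t ht
    exact (constTangent n M).polySections.mul_mem (genSection_mem _ 0 α) (ih ht)

theorem gen_mem_order (α : (SmoothVB.tangent n M).DualSection) :
    (constTangent n M).genSection 0 α ∈ order n M 1 := by
  rw [order_succ, order_zero, ← mul_one ((constTangent n M).genSection 0 α)]
  exact Submodule.mul_mem_mul ⟨α, rfl⟩ (constTangent n M).polySections.one_mem

/-- Sections that are locally of order at least `m`. -/
def locOrder (n : ℕ) (M : Type u) [TopologicalSpace M] [ChartedSpace (EuclideanSpace ℝ (Fin n)) M]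
    [IsManifold (𝓡 n) ∞ M] (m : ℕ) : Submodule ℝ (∀ x, (constTangent n M).symFiber x) where
  carrier := {s | ∀ p, ∃ t ∈ order n M m, ∀ᶠ x in 𝓝 p, s x = t x}
  add_mem' {s s'} hs hs' p := by
    obtain ⟨t, ht, h⟩ := hs p
    obtain ⟨t', ht', h'⟩ := hs' p
    exact ⟨t + t', add_mem ht ht', by
      filter_upwards [h, h'] with x e e'
      rw [Pi.add_apply, Pi.add_apply, e, e']⟩
  zero_mem' p := ⟨0, zero_mem _, Filter.Eventually.of_forall fun _ => rfl⟩
  smul_mem' c s hs p := by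
    obtain ⟨t, ht, h⟩ := hs p
    exact ⟨c • t, Submodule.smul_mem _ c ht, by
      filter_upwards [h] with x e
      rw [Pi.smul_apply, Pi.smul_apply, e]⟩

theorem order_le_locOrder (m : ℕ) : order n M m ≤ locOrder n M m := fun t ht _ =>
  ⟨t, ht, Filter.Eventually.of_forall fun _ => rfl⟩

theorem mul_mem_locOrder {a b : ℕ} {s t : ∀ x, (constTangent n M).symFiber x}
    (hs : s ∈ locOrder n M a) (ht : t ∈ locOrder n M b) : s * t ∈ locOrder n M (a + b) := by
  intro p
  obtain ⟨s', hs', h⟩ := hs p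
  obtain ⟨t', ht', h'⟩ := ht p
  exact ⟨s' * t', order_mul a b (Submodule.mul_mem_mul hs' ht'), by
    filter_upwards [h, h'] with x e e'
    rw [Pi.mul_apply, Pi.mul_apply, e, e']⟩

theorem locOrder_zero : locOrder n M 0 = (constTangent n M).smoothSections.toSubmodule := by
  ext s
  change (∀ p, ∃ t ∈ order n M 0, _) ↔ ∀ p, ∃ t ∈ (constTangent n M).polySections, _
  rw [order_zero]
  rfl

theorem locOrder_le (m : ℕ) : locOrder n M m ≤ (constTangent n M).smoothSections.toSubmodule :=
  fun _ hs p => by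
    obtain ⟨t, ht, h⟩ := hs p
    exact ⟨t, order_le m ht, h⟩

variable [CovariantDerivative.ContMDiffCovariantDerivative conn ∞]

/-- Locally the derivative of σ is Σ β_i γ_i with β_i of degree 0, which adds one to the order of
the generators. The parameter m covers both cases: m = 1 for generators of degree 0, and m = 0 in
general. -/
theorem derivAt_gen_mem (d : ℤ) (σ : (SmoothVB.tangent n M).DualSection) (h) {m : ℕ}
    (hm : ∀ τ, (constTangent n M).genSection d τ ∈ order n M m) :
    derivAt conn ⟨(constTangent n M).genSection d σ, h⟩ ∈ locOrder n M (1 + m) := by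
  intro p
  obtain ⟨β, γ, hβγ⟩ := exists_covariantDerivative_expansion conn p σ
  refine ⟨∑ i, (constTangent n M).genSection 0 (β i) * (constTangent n M).genSection d (γ i),
    Submodule.sum_mem _ fun i _ => order_mul 1 m (Submodule.mul_mem_mul (gen_mem_order _) (hm _)), ?_⟩
  filter_upwards [hβγ] with x hx
  rw [derivAt_gen, hx, map_sum, Finset.sum_apply]
  exact Finset.sum_congr rfl fun i _ => contract_tensor d _ _

theorem derivAt_mul_mem {s t : (constTangent n M).smoothSections} {m : ℕ}
    (h : s.1 * derivAt conn t ∈ locOrder n M m) (h' : derivAt conn s * t.1 ∈ locOrder n M m) :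
    derivAt conn (s * t) ∈ locOrder n M m := by
  rw [derivAt_mul]
  exact add_mem h h'

theorem derivAt_add_mem {s t : (constTangent n M).smoothSections} {m : ℕ}
    (h : derivAt conn s ∈ locOrder n M m) (h' : derivAt conn t ∈ locOrder n M m) :
    derivAt conn (s + t) ∈ locOrder n M m := by
  rw [derivAt_add]
  exact add_mem h h'

theorem derivAt_mem_of_polySections {t : ∀ x, (constTangent n M).symFiber x}
    (ht : t ∈ (constTangent n M).polySections) :
    ∃ h : t ∈ (constTangent n M).smoothSections, derivAt conn ⟨t, h⟩ ∈ locOrder n M 1 := by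
  induction ht using polySections_induction with
  | fn f =>
    refine ⟨polySections_le_smoothSections _ (fnSection_mem _ f), ?_⟩
    rw [derivAt_fn]
    exact order_le_locOrder _ (gen_mem_order _)
  | gen d σ =>
    have hσ : (constTangent n M).genSection d σ ∈ (constTangent n M).smoothSections :=
      polySections_le_smoothSections _ (genSection_mem _ d σ)
    have h := derivAt_gen_mem conn d σ hσ (m := 0) fun τ => by
      rw [order_zero]
      exact genSection_mem _ d τ
    rw [add_zero] at h
    exact ⟨hσ, h⟩
  | add s t _ _ hs ht =>
    obtain ⟨hs, h⟩ := hs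
    obtain ⟨ht, h'⟩ := ht
    exact ⟨add_mem hs ht, derivAt_add_mem conn (s := ⟨s, hs⟩) (t := ⟨t, ht⟩) h h'⟩
  | mul s t _ _ hs ht =>
    obtain ⟨hs, h⟩ := hs
    obtain ⟨ht, h'⟩ := ht
    have h1 : s ∈ locOrder n M 0 := by rw [locOrder_zero]; exact hs
    have h2 : t ∈ locOrder n M 0 := by rw [locOrder_zero]; exact ht
    exact ⟨mul_mem hs ht, derivAt_mul_mem conn (s := ⟨s, hs⟩) (t := ⟨t, ht⟩) (m := 1)
      (by simpa using mul_mem_locOrder h1 h') (by simpa using mul_mem_locOrder h h2)⟩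

/-- In D(αt) = α D(t) + D(α) t the first term has order 1 + (m + 1) by induction. The second has
order 2 + m because D(α) is quadratic. -/
theorem derivAt_mem_of_order (m : ℕ) {t : ∀ x, (constTangent n M).symFiber x}
    (ht : t ∈ order n M m) :
    ∃ h : t ∈ (constTangent n M).smoothSections, derivAt conn ⟨t, h⟩ ∈ locOrder n M (m + 1) := by
  induction m generalizing t with
  | zero =>
    rw [order_zero] at ht
    exact derivAt_mem_of_polySections conn ht
  | succ m ih =>
    rw [order_succ] at ht
    induction ht using Submodule.mul_induction_on' with
    | mem_mul_mem a ha t ht =>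
      obtain ⟨α, rfl⟩ := ha
      obtain ⟨h, h'⟩ := ih ht
      have hα : (constTangent n M).genSection 0 α ∈ (constTangent n M).smoothSections :=
        polySections_le_smoothSections _ (genSection_mem _ 0 α)
      have h1 := mul_mem_locOrder (order_le_locOrder _ (gen_mem_order α)) h'
      have h2 := mul_mem_locOrder (derivAt_gen_mem conn 0 α hα gen_mem_order)
        (order_le_locOrder _ ht)
      rw [show 1 + (m + 1) = m + 1 + 1 by ring] at h1
      rw [show 1 + 1 + m = m + 1 + 1 by ring] at h2
      exact ⟨mul_mem hα h, derivAt_mul_mem conn (s := ⟨_, hα⟩) (t := ⟨t, h⟩) h1 h2⟩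
    | add s hs t ht h h' =>
      obtain ⟨hs, h⟩ := h
      obtain ⟨ht, h'⟩ := h'
      exact ⟨add_mem hs ht, derivAt_add_mem conn (s := ⟨s, hs⟩) (t := ⟨t, ht⟩) h h'⟩

theorem derivAt_mem {m : ℕ} {s : (constTangent n M).smoothSections} (hs : s.1 ∈ locOrder n M m) :
    derivAt conn s ∈ locOrder n M (m + 1) := by
  intro p
  obtain ⟨t, ht, h⟩ := hs p
  obtain ⟨ht', h'⟩ := derivAt_mem_of_order conn m ht
  obtain ⟨r, hr, h''⟩ := h' p
  refine ⟨r, hr, ?_⟩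
  filter_upwards [derivAt_congr conn (s := s) (t := ⟨t, ht'⟩) h, h''] with x h1 h2 using h1.trans h2

/-- The symmetrized covariant derivative. -/
def symDeriv : (constTangent n M).smoothSections →ₗ[ℝ] (constTangent n M).smoothSections where
  toFun s := ⟨derivAt conn s, locOrder_le 1 (derivAt_mem conn (m := 0) (by
    rw [locOrder_zero]; exact s.2))⟩
  map_add' s t := Subtype.ext (derivAt_add conn s t)
  map_smul' c s := Subtype.ext (derivAt_smul conn c s)

theorem symDeriv_mul (s t : (constTangent n M).smoothSections) :
    symDeriv conn (s * t) = s * symDeriv conn t + symDeriv conn s * t :=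
  Subtype.ext (derivAt_mul conn s t)

theorem symDeriv_pow_mem {m : ℕ} {s : (constTangent n M).smoothSections} (hs : s.1 ∈ locOrder n M m)
    (a : ℕ) : ((symDeriv conn ^ a) s).1 ∈ locOrder n M (m + a) := by
  induction a with
  | zero => exact hs
  | succ a ih =>
    rw [pow_succ', Module.End.mul_apply]
    exact derivAt_mem conn ih

end GradedVB
end

/-! ### Substitution of the tautological form -/

noncomputable section

namespace DualMap
variable {n : ℕ} {M : Type u} [TopologicalSpace M] [ChartedSpace (EuclideanSpace ℝ (Fin n)) M]
  {V V' : SmoothVB n M} (A : DualMap V V')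

/-- The induced linear map on sections. -/
def sections : V.DualSection →ₗ[ℝ] V'.DualSection where
  toFun := A.onSections
  map_add' σ τ := by
    ext1 x
    rw [A.onSections_apply]
    refine (map_add (A.toFun x) (σ x) (τ x)).trans ?_
    rw [← A.onSections_apply, ← A.onSections_apply]
    rfl
  map_smul' c σ := by
    ext1 x
    rw [A.onSections_apply]
    refine (map_smul (A.toFun x) c (σ x)).trans ?_
    rw [← A.onSections_apply]
    rfl

theorem sections_apply (σ : V.DualSection) (x : M) : A.sections σ x = A.toFun x (σ x) :=
  A.onSections_apply σ x

theorem sections_smulSection (f : C^∞⟮𝓡 n, M; ℝ⟯) (σ : V.DualSection) :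
    A.sections (SmoothVB.smulSection f σ) = SmoothVB.smulSection f (A.sections σ) := by
  ext1 x
  rw [sections_apply]
  refine (map_smul (A.toFun x) (f x) (σ x)).trans ?_
  rw [← sections_apply]
  rfl

end DualMap

namespace GradedVB
open GradedCommAlg (tmul mapRight)
variable {n : ℕ} {M : Type u} [TopologicalSpace M] [ChartedSpace (EuclideanSpace ℝ (Fin n)) M]

section Evaluation
variable {L : GradedCommAlg.{0}} (b : WeilBasis L) {V : GradedVB n M}

variable (L V) in
/-- Evaluation at a point with coefficients in `L`. -/
def evalTensor (x : M) : GradedCommAlg.Hom (L.tensor V.functions) (L.tensor (V.symAlg x)) :=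
  mapRight L (V.evalHom x)

-- The finite basis reduces elements of L ⊗ C(𝔖(V)) to families of sections, which are determined by
-- their values.
include b in
theorem evalTensor_ext {u v : (L.tensor V.functions).carrier}
    (h : ∀ x, evalTensor L V x u = evalTensor L V x v) : u = v :=
  b.ext_coord fun i => functions_ext fun x => by
    have := congrArg (b.coord i) (h x)
    rw [evalTensor, b.coord_mapRight, b.coord_mapRight] at this
    exact this

variable [IsManifold (𝓡 n) ∞ M] [T2Space M]

-- Each coordinate is a section of fixed degree `deg i`, and homogeneous sections glue. Finiteness
-- of the basis then reassembles the element.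
include b in
theorem exists_of_local {c : ∀ x, (L.tensor (V.symAlg x)).carrier}
    (h : ∀ p, ∃ u ∈ (L.tensor V.functions).gr 0, ∀ᶠ x in 𝓝 p, c x = evalTensor L V x u) :
    ∃ u ∈ (L.tensor V.functions).gr 0, ∀ x, evalTensor L V x u = c x := by
  classical
  have hs : ∀ i, (fun x => b.coord i (c x)) ∈ V.homSections (b.deg i) := fun i => by
    refine mem_homSections_of_local fun p => ?_
    obtain ⟨u, hu, hc⟩ := h p
    have h1 := b.coord_mem hu i
    rw [zero_add] at h1
    refine ⟨_, homSection_of_mem_gr h1, ?_⟩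
    filter_upwards [hc] with x hx
    rw [hx, evalTensor, b.coord_mapRight]
    rfl
  refine ⟨∑ i, tmul L V.functions (b.basis i) (ofHomSection _ (hs i)), ?_, fun x => ?_⟩
  · refine b.mem_of_coord fun i => ?_
    rw [b.coord_sum_tmul, zero_add]
    exact ofHomSection_mem _ (hs i)
  · refine b.ext_coord fun i => ?_
    rw [evalTensor, b.coord_mapRight, b.coord_sum_tmul]
    rfl

end Evaluation

section Taut
variable [IsManifold (𝓡 n) ∞ M] {L : GradedCommAlg.{0}} (b : WeilBasis L) {V : GradedVB n M}
  (P : ∀ d : ℤ, CotangentPower (V (-d)) (b.Index d))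

/-- The generators of degree `deg i` belonging to the copy of the tangent bundle with index `i`. -/
def copyGen (i : b.idx) : (SmoothVB.tangent n M).DualSection →ₗ[ℝ] V.functions.carrier := by
  classical exact
  if h : i = b.unit then 0 else
    (V.gen (b.deg i)).comp ((P (b.deg i)).inj ⟨i, h, rfl⟩).sections

theorem copyGen_unit : copyGen b P b.unit = 0 := dif_pos rfl

theorem copyGen_of_ne {i : b.idx} (h : i ≠ b.unit) (α : (SmoothVB.tangent n M).DualSection) :
    copyGen b P i α = V.gen (b.deg i) (((P (b.deg i)).inj ⟨i, h, rfl⟩).sections α) := by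
  rw [copyGen, dif_neg h]; rfl

theorem copyGen_mem (i : b.idx) (α : (SmoothVB.tangent n M).DualSection) :
    copyGen b P i α ∈ V.functions.gr (b.deg i) := by
  by_cases h : i = b.unit
  · rw [h, copyGen_unit]; exact zero_mem _
  · rw [copyGen_of_ne b P h]; exact gen_mem _ _

theorem copyGen_smul (i : b.idx) (f : C^∞⟮𝓡 n, M; ℝ⟯) (α : (SmoothVB.tangent n M).DualSection) :
    copyGen b P i (SmoothVB.smulSection f α) = V.fn f * copyGen b P i α := by
  by_cases h : i = b.unit
  · rw [h, copyGen_unit, LinearMap.zero_apply, LinearMap.zero_apply, mul_zero]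
  · rw [copyGen_of_ne b P h, copyGen_of_ne b P h, DualMap.sections_smulSection, gen_smul]

/-- The sum of the generators belonging to `α`, with coefficients in a basis of `L`. -/
def tautForm : (SmoothVB.tangent n M).DualSection →ₗ[ℝ] (L.tensor V.functions).carrier where
  toFun α := ∑ i, tmul L V.functions (b.basis i) (copyGen b P i α)
  map_add' α β := by
    rw [← Finset.sum_add_distrib]
    exact Finset.sum_congr rfl fun i _ => by rw [map_add, GradedCommAlg.tmul_add]
  map_smul' c α := by
    rw [RingHom.id_apply, Finset.smul_sum]
    exact Finset.sum_congr rfl fun i _ => by rw [map_smul, GradedCommAlg.tmul_smul]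

theorem coord_tautForm (i : b.idx) (α : (SmoothVB.tangent n M).DualSection) :
    b.coord i (tautForm b P α) = copyGen b P i α := by
  classical exact b.coord_sum_tmul (fun i => copyGen b P i α) i

/-- The degree -`deg i` of the basis element cancels the degree `deg i` of the copy. -/
theorem tautForm_mem (α : (SmoothVB.tangent n M).DualSection) :
    tautForm b P α ∈ (L.tensor V.functions).gr 0 := b.mem_of_coord fun i => by
  rw [coord_tautForm, zero_add]
  exact copyGen_mem b P i α

/-- There is no copy for the basis element 1, so the tautological form has coefficients in the
augmentation ideal of L; this is the source of nilpotency. -/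
theorem tautForm_mem_fil (α : (SmoothVB.tangent n M).DualSection) :
    tautForm b P α ∈ b.fil V.functions 1 := fun i hi => by
  rw [coord_tautForm, (b.deg_eq_zero i).1 (by omega), copyGen_unit, LinearMap.zero_apply]

theorem tautForm_smul (f : C^∞⟮𝓡 n, M; ℝ⟯) (α : (SmoothVB.tangent n M).DualSection) :
    tautForm b P (SmoothVB.smulSection f α) = tmul L V.functions 1 (V.fn f) * tautForm b P α :=
  b.ext_coord fun i => by
    rw [coord_tautForm, copyGen_smul, b.coord_one_tmul_mul (fn_mem f), coord_tautForm]

/-- `f ↦ 1 ⊗ f`. -/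
def oneTmulFn : C^∞⟮𝓡 n, M; ℝ⟯ →ₐ[ℝ] (L.tensor V.functions).carrier :=
  (GradedTensorProduct.includeRight L.gr V.functions.gr).comp V.fn

theorem oneTmulFn_apply (f : C^∞⟮𝓡 n, M; ℝ⟯) :
    oneTmulFn f = tmul L V.functions 1 (V.fn f) := rfl

theorem oneTmulFn_mem (f : C^∞⟮𝓡 n, M; ℝ⟯) :
    (oneTmulFn f : (L.tensor V.functions).carrier) ∈ (L.tensor V.functions).gr 0 :=
  GradedTensor.right_mem L.gr V.functions.gr (fn_mem f)

/-- The generators of degree `0` go to the tautological form, those of other degrees to `0`. -/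
def tautGen (d : ℤ) : (SmoothVB.tangent n M).DualSection →ₗ[ℝ] (L.tensor V.functions).carrier :=
  if d = 0 then tautForm b P else 0

theorem tautGen_mem (d : ℤ) (α : (SmoothVB.tangent n M).DualSection) :
    tautGen b P d α ∈ (L.tensor V.functions).gr 0 := by
  unfold tautGen
  split_ifs
  · exact tautForm_mem b P α
  · exact zero_mem _

theorem tautGen_smul (d : ℤ) (f : C^∞⟮𝓡 n, M; ℝ⟯) (α : (SmoothVB.tangent n M).DualSection) :
    tautGen b P d (SmoothVB.smulSection f α) = oneTmulFn f * tautGen b P d α := by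
  unfold tautGen
  split_ifs
  · exact tautForm_smul b P f α
  · exact (mul_zero _).symm

/-- In degree 0 the sign is trivial and elements of total degree 0 are central; in other degrees
both sides are 0. -/
theorem tautGen_mul (i j : ℤ) (σ τ : (SmoothVB.tangent n M).DualSection) :
    tautGen b P i σ * tautGen b P j τ = (-1 : ℤˣ) ^ (i * j) • (tautGen b P j τ * tautGen b P i σ) := by
  by_cases hi : i = 0
  · rw [hi, zero_mul, uzpow_zero, one_smul]
    exact (GradedCommAlg.commute_of_mem_zero _ (tautGen_mem b P 0 σ) _).eq
  · have h : tautGen b P i σ = 0 := by rw [tautGen, if_neg hi]; rfl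
    rw [h, zero_mul, mul_zero, smul_zero]

/-- The tautological data at a point. -/
def tautData (x : M) : LocalData (constTangent n M) x (L.tensor (V.symAlg x)).carrier where
  fn := (evalTensor L V x).toAlgHom.comp oneTmulFn
  gen d := (evalTensor L V x).toAlgHom.toLinearMap.comp (tautGen b P d)
  fn_commute f r := GradedCommAlg.commute_of_mem_zero _ ((evalTensor L V x).map_mem (oneTmulFn_mem f)) r
  fn_local f hf := by
    change mapRight L (V.evalHom x) (tmul L V.functions 1 (V.fn f)) = 0
    rw [GradedCommAlg.mapRight_tmul]
    have h : V.evalHom x (V.fn f) = 0 := by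
      change algebraMap ℝ (V.symFiber x) (f x) = 0
      rw [hf.self_of_nhds, map_zero]
    rw [h, GradedCommAlg.tmul_zero]
  gen_smul d f σ := (congrArg (evalTensor L V x) (tautGen_smul b P d f σ)).trans
    (map_mul (evalTensor L V x) _ _)
  gen_mul_gen i j σ τ := by
    have h := congrArg (evalTensor L V x) (tautGen_mul b P i j σ τ)
    rwa [map_units_smul, map_mul, map_mul] at h

variable [T2Space M]

theorem exists_taut_of_polySections {t : ∀ x, (constTangent n M).symFiber x}
    (ht : t ∈ (constTangent n M).polySections) :
    ∃ u ∈ (L.tensor V.functions).gr 0, ∀ x h, evalTensor L V x u = (tautData b P x).hom ⟨t, h⟩ := by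
  induction ht using polySections_induction with
  | fn f => exact ⟨_, oneTmulFn_mem f, fun x h => ((tautData b P x).hom_fn f h).symm⟩
  | gen d σ => exact ⟨_, tautGen_mem b P d σ, fun x h => ((tautData b P x).hom_gen d σ h).symm⟩
  | add s t hs ht h h' =>
    obtain ⟨u, hu, h⟩ := h
    obtain ⟨u', hu', h'⟩ := h'
    refine ⟨u + u', add_mem hu hu', fun x _ => ?_⟩
    rw [map_add, h x (polySections_le_smoothSections _ hs),
      h' x (polySections_le_smoothSections _ ht), ← map_add]
    rfl
  | mul s t hs ht h h' =>
    obtain ⟨u, hu, h⟩ := h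
    obtain ⟨u', hu', h'⟩ := h'
    have hm := SetLike.mul_mem_graded hu hu'
    rw [zero_add] at hm
    refine ⟨u * u', hm, fun x _ => ?_⟩
    rw [map_mul, h x (polySections_le_smoothSections _ hs),
      h' x (polySections_le_smoothSections _ ht), ← map_mul]
    rfl

/-- The pointwise substitutions are glued: near each p the section is a polynomial, for which a
common element of L ⊗ C(𝔖(V)) exists. -/
theorem exists_taut (s : (constTangent n M).smoothSections) :
    ∃ u ∈ (L.tensor V.functions).gr 0, ∀ x, evalTensor L V x u = (tautData b P x).hom s := by
  refine exists_of_local b fun p => ?_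
  obtain ⟨t, ht, hst⟩ := s.2 p
  obtain ⟨u, hu, h⟩ := exists_taut_of_polySections b P ht
  refine ⟨u, hu, ?_⟩
  filter_upwards [hst.eventually_nhds] with x hx
  rw [h x (polySections_le_smoothSections _ ht)]
  exact (tautData b P x).hom_congr hx

/-- Substitution of the tautological form for the generators of degree `0`. -/
def tautHom : (constTangent n M).smoothSections →ₐ[ℝ] (L.tensor V.functions).carrier := by
  choose G _ hG using exists_taut b P
  exact
  { toFun := G
    map_one' := evalTensor_ext b fun x => by rw [hG, map_one, map_one]
    map_mul' := fun s t => evalTensor_ext b fun x => by rw [hG, map_mul, map_mul, hG, hG]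
    map_zero' := evalTensor_ext b fun x => by rw [hG, map_zero, map_zero]
    map_add' := fun s t => evalTensor_ext b fun x => by rw [hG, map_add, map_add, hG, hG]
    commutes' := fun c => evalTensor_ext b fun x => by
      rw [hG, AlgHom.commutes]
      exact ((evalTensor L V x).toAlgHom.commutes c).symm }

theorem tautHom_mem (s : (constTangent n M).smoothSections) :
    tautHom b P s ∈ (L.tensor V.functions).gr 0 := (exists_taut b P s).choose_spec.1

theorem evalTensor_tautHom (s : (constTangent n M).smoothSections) (x : M) :
    evalTensor L V x (tautHom b P s) = (tautData b P x).hom s :=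
  (exists_taut b P s).choose_spec.2 x

theorem tautHom_fn (f : C^∞⟮𝓡 n, M; ℝ⟯) (h) :
    tautHom b P ⟨(constTangent n M).fnSection f, h⟩ = oneTmulFn f :=
  evalTensor_ext b fun x => by rw [evalTensor_tautHom, LocalData.hom_fn]; rfl

theorem tautHom_gen (α : (SmoothVB.tangent n M).DualSection) (h) :
    tautHom b P ⟨(constTangent n M).genSection 0 α, h⟩ = tautForm b P α :=
  evalTensor_ext b fun x => by rw [evalTensor_tautHom, LocalData.hom_gen]; rfl

/-- Each generator of degree 0 contributes a factor in the augmentation ideal of L. -/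
theorem tautHom_mem_fil_of_order (m : ℕ) {t : ∀ x, (constTangent n M).symFiber x}
    (ht : t ∈ order n M m) : ∃ h, tautHom b P ⟨t, h⟩ ∈ b.fil V.functions m := by
  induction m generalizing t with
  | zero => exact ⟨polySections_le_smoothSections _ (order_le 0 ht), b.mem_fil_zero _⟩
  | succ m ih =>
    rw [order_succ] at ht
    induction ht using Submodule.mul_induction_on' with
    | mem_mul_mem a ha t ht =>
      obtain ⟨α, rfl⟩ := ha
      obtain ⟨h, h'⟩ := ih ht
      have hα : (constTangent n M).genSection 0 α ∈ (constTangent n M).smoothSections :=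
        polySections_le_smoothSections _ (genSection_mem _ 0 α)
      refine ⟨mul_mem hα h, ?_⟩
      have e := map_mul (tautHom b P) ⟨_, hα⟩ ⟨t, h⟩
      rw [tautHom_gen] at e
      have h2 := b.mul_mem_fil (tautForm_mem_fil b P α) h'
      rw [← e, add_comm] at h2
      exact h2
    | add s hs t ht h h' =>
      obtain ⟨hs, h⟩ := h
      obtain ⟨ht, h'⟩ := h'
      refine ⟨add_mem hs ht, ?_⟩
      have h2 := add_mem h h'
      rw [← map_add] at h2
      exact h2

/-- Vanishing of a coordinate can be tested at points, where the substitution only sees the germ of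
s. -/
theorem tautHom_mem_fil {m : ℕ} {s : (constTangent n M).smoothSections}
    (hs : s.1 ∈ locOrder n M m) : tautHom b P s ∈ b.fil V.functions m := by
  intro i hi
  refine functions_ext fun x => ?_
  obtain ⟨t, ht, hst⟩ := hs x
  obtain ⟨ht', h⟩ := tautHom_mem_fil_of_order b P m ht
  have e : evalTensor L V x (tautHom b P s) = evalTensor L V x (tautHom b P ⟨t, ht'⟩) := by
    rw [evalTensor_tautHom, evalTensor_tautHom]
    exact (tautData b P x).hom_congr hst
  have e' := congrArg (b.coord i) e
  rw [evalTensor, b.coord_mapRight, b.coord_mapRight, h i hi, map_zero] at e'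
  exact e'.trans (map_zero _).symm

end Taut
end GradedVB
end

/-! ### The Taylor expansion -/

noncomputable section

section Taylor
variable {S T : Type*} [Ring S] [Algebra ℝ S] [Ring T] [Algebra ℝ T] {D : S →ₗ[ℝ] S}

/-- The iterated Leibniz rule. -/
theorem leibniz_pow (hD : ∀ s t, D (s * t) = s * D t + D s * t) (m : ℕ) (s t : S) :
    (D ^ m) (s * t) = ∑ p ∈ Finset.HasAntidiagonal.antidiagonal m, m.choose p.1 • ((D ^ p.1) s * (D ^ p.2) t) := by
  induction m with
  | zero => simp
  | succ m ih =>
    rw [pow_succ', Module.End.mul_apply, ih, map_sum,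
      Finset.sum_antidiagonal_choose_succ_nsmul (fun a b => (D ^ a) s * (D ^ b) t),
      ← Finset.sum_add_distrib]
    refine Finset.sum_congr rfl fun p hp => ?_
    -- One of the two sums from Pascal's rule carries the binomial coefficient of the second index.
    rw [Nat.choose_symm_of_eq_add (Finset.HasAntidiagonal.mem_antidiagonal.1 hp).symm, map_nsmul, hD, smul_add,
      pow_succ', pow_succ', Module.End.mul_apply, Module.End.mul_apply]

/-- The terms `G (D^m s) / m!` of the exponential series. -/
def expTerm (G : S →ₐ[ℝ] T) (D : S →ₗ[ℝ] S) (m : ℕ) : S →ₗ[ℝ] T :=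
  (m.factorial : ℝ)⁻¹ • G.toLinearMap.comp (D ^ m)

theorem expTerm_apply (G : S →ₐ[ℝ] T) (D : S →ₗ[ℝ] S) (m : ℕ) (s : S) :
    expTerm G D m s = (m.factorial : ℝ)⁻¹ • G ((D ^ m) s) := rfl

theorem expTerm_mul (hD : ∀ s t, D (s * t) = s * D t + D s * t) (G : S →ₐ[ℝ] T) (m : ℕ) (s t : S) :
    expTerm G D m (s * t) =
      ∑ p ∈ Finset.HasAntidiagonal.antidiagonal m, expTerm G D p.1 s * expTerm G D p.2 t := by
  rw [expTerm_apply, leibniz_pow hD, map_sum, Finset.smul_sum]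
  refine Finset.sum_congr rfl fun p hp => ?_
  rw [Finset.HasAntidiagonal.mem_antidiagonal] at hp
  rw [map_nsmul, map_mul, expTerm_apply, expTerm_apply, smul_mul_smul_comm, ← Nat.cast_smul_eq_nsmul ℝ,
    smul_smul]
  congr 1
  -- (a + b)!⁻¹ · binom(a + b, a) = a!⁻¹ · b!⁻¹.
  rw [← hp, Nat.cast_add_choose, div_eq_mul_inv, ← mul_assoc, inv_mul_cancel₀, one_mul, mul_inv]
  exact_mod_cast Nat.factorial_ne_zero _

/-- The exponential of a derivation is multiplicative. Truncation at K does no harm because products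
of terms of total index at least K vanish: the square of indices reduces to the triangle a + b < K,
summed along antidiagonals. -/
theorem sum_expTerm_mul (hD : ∀ s t, D (s * t) = s * D t + D s * t) (G : S →ₐ[ℝ] T) (K : ℕ) (s t : S)
    (h : ∀ a b, K ≤ a + b → expTerm G D a s * expTerm G D b t = 0) :
    ∑ m ∈ Finset.range K, expTerm G D m (s * t) =
      (∑ m ∈ Finset.range K, expTerm G D m s) * ∑ m ∈ Finset.range K, expTerm G D m t := by
  rw [Finset.sum_mul_sum, ← Finset.sum_product',
    ← Finset.sum_filter_add_sum_filter_not _ (fun p : ℕ × ℕ => p.1 + p.2 < K),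
    Finset.sum_eq_zero (s := Finset.filter (fun p : ℕ × ℕ => ¬ p.1 + p.2 < K) _), add_zero,
    ← Finset.sum_fiberwise_of_maps_to (g := fun p : ℕ × ℕ => p.1 + p.2) (t := Finset.range K)]
  · refine Finset.sum_congr rfl fun m hm => ?_
    rw [expTerm_mul hD]
    refine Finset.sum_congr ?_ fun _ _ => rfl
    rw [Finset.mem_range] at hm
    ext p
    simp only [Finset.HasAntidiagonal.mem_antidiagonal, Finset.mem_filter, Finset.mem_product, Finset.mem_range]
    omega
  · intro p hp
    exact Finset.mem_range.2 (Finset.mem_filter.1 hp).2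
  · intro p hp
    exact h _ _ (not_lt.1 (Finset.mem_filter.1 hp).2)

end Taylor

namespace WeilBasis
variable {L : GradedCommAlg.{u}} (b : WeilBasis L) {B : GradedCommAlg.{v}}

/-- A bound for the degrees of the elements of a basis, at least `2`. -/
def bound : ℕ := ∑ i, b.deg i + 2

theorem deg_lt_bound (i : b.idx) : b.deg i < b.bound :=
  (Finset.single_le_sum (fun i _ => Nat.zero_le (b.deg i)) (Finset.mem_univ i)).trans_lt
    (by rw [bound]; omega)

theorem eq_zero_of_mem_fil_bound {d : ℕ} (hd : b.bound ≤ d) {x : (L.tensor B).carrier}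
    (h : x ∈ b.fil B d) : x = 0 :=
  b.ext_coord fun i => by rw [map_zero]; exact h i ((b.deg_lt_bound i).trans_le hd)

end WeilBasis

namespace GradedVB
open GradedCommAlg (tmul mapRight)
variable {n : ℕ} {M : Type u} [TopologicalSpace M] [ChartedSpace (EuclideanSpace ℝ (Fin n)) M]
  [IsManifold (𝓡 n) ∞ M] [T2Space M]
  (conn : CovariantDerivative (𝓡 n) (EuclideanSpace ℝ (Fin n) →L[ℝ] ℝ)
      (fun x : M => TangentSpace (𝓡 n) x →L[ℝ] Bundle.Trivial M ℝ x))
  [CovariantDerivative.ContMDiffCovariantDerivative conn ∞]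
  {L : GradedCommAlg.{0}} (b : WeilBasis L) {V : GradedVB n M}
  (P : ∀ d : ℤ, CotangentPower (V (-d)) (b.Index d))

/-- Functions as smooth sections. -/
def smoothFn (n : ℕ) (M : Type u) [TopologicalSpace M] [ChartedSpace (EuclideanSpace ℝ (Fin n)) M]
    [IsManifold (𝓡 n) ∞ M] : C^∞⟮𝓡 n, M; ℝ⟯ →ₐ[ℝ] (constTangent n M).smoothSections :=
  (constTangent n M).fnSection.codRestrict _ fun f =>
    polySections_le_smoothSections _ (fnSection_mem _ f)

theorem symDeriv_pow_mem_locOrder (m : ℕ) (s : (constTangent n M).smoothSections) :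
    ((symDeriv conn ^ m) s).1 ∈ locOrder n M m := by
  have h := symDeriv_pow_mem conn (m := 0) (s := s) (by rw [locOrder_zero]; exact s.2) m
  rwa [zero_add] at h

theorem expTerm_mem_fil (m : ℕ) (s : (constTangent n M).smoothSections) :
    expTerm (tautHom b P) (symDeriv conn) m s ∈ b.fil V.functions m :=
  Submodule.smul_mem _ _ (tautHom_mem_fil b P (symDeriv_pow_mem_locOrder conn m s))

/-- The Taylor expansion of functions along the tautological form. -/
def taylor : C^∞⟮𝓡 n, M; ℝ⟯ →ₐ[ℝ] (L.tensor V.functions).carrier :=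
  AlgHom.ofLinearMap
    ((∑ m ∈ Finset.range b.bound, expTerm (tautHom b P) (symDeriv conn) m).comp
      (smoothFn n M).toLinearMap)
    (by
      -- A derivation kills 1, so only the term m = 0 contributes to the image of 1.
      have h1 : symDeriv conn 1 = 0 := by
        have h := symDeriv_mul conn 1 1
        rw [one_mul, one_mul, mul_one] at h
        exact left_eq_add.1 h
      rw [LinearMap.comp_apply, LinearMap.sum_apply, AlgHom.toLinearMap_apply, map_one,
        Finset.sum_eq_single 0]
      · rw [expTerm_apply]
        simp
      · intro m _ hm
        obtain ⟨m, rfl⟩ := Nat.exists_eq_succ_of_ne_zero hm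
        rw [expTerm_apply, pow_succ, Module.End.mul_apply, h1, map_zero, map_zero, smul_zero]
      · intro h
        exact absurd (Finset.mem_range.2 (by rw [WeilBasis.bound]; omega)) h)
    (fun f g => by
      rw [LinearMap.comp_apply, LinearMap.comp_apply, LinearMap.comp_apply, LinearMap.sum_apply,
        LinearMap.sum_apply, LinearMap.sum_apply, AlgHom.toLinearMap_apply,
        AlgHom.toLinearMap_apply, AlgHom.toLinearMap_apply, map_mul]
      -- The m-th term has coefficients of `deg` at least m, so products of total index at least
      -- `bound` lie beyond every basis element.
      exact sum_expTerm_mul (symDeriv_mul conn) _ _ _ _ fun c d h =>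
        b.eq_zero_of_mem_fil_bound h
          (b.mul_mem_fil (expTerm_mem_fil conn b P c _) (expTerm_mem_fil conn b P d _)))

theorem taylor_apply (f : C^∞⟮𝓡 n, M; ℝ⟯) : taylor conn b P f =
    ∑ m ∈ Finset.range b.bound, expTerm (tautHom b P) (symDeriv conn) m (smoothFn n M f) :=
  LinearMap.sum_apply _ _ _

theorem taylor_mem (f : C^∞⟮𝓡 n, M; ℝ⟯) : taylor conn b P f ∈ (L.tensor V.functions).gr 0 := by
  rw [taylor_apply]
  exact sum_mem fun m _ => Submodule.smul_mem _ _ (tautHom_mem b P _)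

/-- The Taylor expansion up to first order. -/
theorem exists_taylor_eq (f : C^∞⟮𝓡 n, M; ℝ⟯) : ∃ s : (constTangent n M).smoothSections,
    s.1 ∈ locOrder n M 2 ∧
      taylor conn b P f = oneTmulFn f + tautForm b P (differential f) + tautHom b P s := by
  -- The bound exceeds Σ `deg i` by 2, so exactly the terms of orders 0 and 1 can be split off.
  refine ⟨∑ m ∈ Finset.range (∑ i, b.deg i),
    ((m + 2).factorial : ℝ)⁻¹ • (symDeriv conn ^ (m + 2)) (smoothFn n M f), ?_, ?_⟩
  · rw [AddSubmonoidClass.coe_finsetSum]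
    refine sum_mem fun m _ => Submodule.smul_mem _ _ ?_
    rw [add_comm, pow_add, Module.End.mul_apply]
    exact symDeriv_pow_mem_locOrder conn 2 _
  · rw [taylor_apply, WeilBasis.bound, Finset.sum_range_succ', Finset.sum_range_succ', map_sum]
    have h0 : expTerm (tautHom b P) (symDeriv conn) 0 (smoothFn n M f) = oneTmulFn f := by
      rw [expTerm_apply, pow_zero, Nat.factorial_zero, Nat.cast_one, inv_one, one_smul]
      exact tautHom_fn b P f _
    have h1 : expTerm (tautHom b P) (symDeriv conn) 1 (smoothFn n M f) =
        tautForm b P (differential f) := by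
      rw [expTerm_apply, pow_one, Nat.factorial_one, Nat.cast_one, inv_one, one_smul,
        ← tautHom_gen b P _ (polySections_le_smoothSections _ (genSection_mem _ 0 _))]
      exact congrArg _ (Subtype.ext (derivAt_fn conn f _))
    rw [h0, h1, add_assoc, add_comm, add_comm (tautForm b P _)]
    refine congrArg _ (Finset.sum_congr rfl fun m _ => ?_)
    rw [map_smul]
    rfl

end GradedVB
end

/-! ### Leading dependence of (id ⊗ Ψ) ∘ `taylor` on Ψ -/

noncomputable section

namespace WeilBasis
open GradedCommAlg (tmul mapRight)
variable {L : GradedCommAlg.{u}} (b : WeilBasis L) {B : GradedCommAlg.{v}} {C : GradedCommAlg.{w}}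
  {Ψ Ψ' : GradedCommAlg.Hom B C}

theorem mapRight_mem_fil {d : ℕ} {x : (L.tensor B).carrier} (hx : x ∈ b.fil B d) :
    mapRight L Ψ x ∈ b.fil C d := fun i hi => by
  rw [b.coord_mapRight, hx i hi, map_zero]

theorem mapRight_sub_mem_fil {d : ℕ} (h : ∀ e : ℤ, e < d → ∀ a ∈ B.gr e, Ψ a = Ψ' a)
    {x : (L.tensor B).carrier} (hx : x ∈ (L.tensor B).gr 0) :
    mapRight L Ψ x - mapRight L Ψ' x ∈ b.fil C d := fun i hi => by
  have h1 := b.coord_mem hx i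
  rw [zero_add] at h1
  rw [map_sub, b.coord_mapRight, b.coord_mapRight, h _ (by exact_mod_cast hi) _ h1, sub_self]

/-- Morphisms that agree in degrees less than `d` agree on the coefficients of degree `d` of
products. -/
theorem eq_on_coord_mul {d : ℕ} (h : ∀ e : ℤ, e < d → ∀ a ∈ B.gr e, Ψ a = Ψ' a)
    {x y : (L.tensor B).carrier} (hx : x ∈ (L.tensor B).gr 0) (hy : y ∈ (L.tensor B).gr 0)
    (hx1 : x ∈ b.fil B 1) (hy1 : y ∈ b.fil B 1) {i : b.idx} (hi : b.deg i ≤ d) :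
    Ψ (b.coord i (x * y)) = Ψ' (b.coord i (x * y)) := by
  -- With F = id ⊗ Ψ and F' = id ⊗ Ψ': F(x)F(y) - F'(x)F'(y) = F(x)(F(y) - F'(y)) + (F(x) -
  -- F'(x))F'(y). Each product pairs a factor of order 1 with one of order d, so it vanishes up to
  -- `deg` d.
  have h1 := b.mul_mem_fil (b.mapRight_mem_fil (Ψ := Ψ) hx1) (b.mapRight_sub_mem_fil h hy)
  have h2 := b.mul_mem_fil (b.mapRight_sub_mem_fil h hx) (b.mapRight_mem_fil (Ψ := Ψ') hy1)
  rw [add_comm] at h1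
  have h3 := add_mem h1 h2 i (Nat.lt_succ_of_le hi)
  rw [mul_sub, sub_mul, sub_add_sub_cancel, ← map_mul, ← map_mul, map_sub, b.coord_mapRight,
    b.coord_mapRight, sub_eq_zero] at h3
  exact h3

end WeilBasis

namespace GradedVB
open GradedCommAlg (tmul mapRight)
variable {n : ℕ} {M : Type u} [TopologicalSpace M] [ChartedSpace (EuclideanSpace ℝ (Fin n)) M]
  [IsManifold (𝓡 n) ∞ M] {L : GradedCommAlg.{0}} (b : WeilBasis L) {V : GradedVB n M}
  (P : ∀ d : ℤ, CotangentPower (V (-d)) (b.Index d))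

theorem copyGen_index {d : ℤ} (j : b.Index d) (α : (SmoothVB.tangent n M).DualSection) :
    copyGen b P j.1 α = V.gen d (((P d).inj j).sections α) := by
  obtain ⟨i, h, rfl⟩ := j
  exact copyGen_of_ne b P h α

theorem gen_eq_sum (d : ℤ) (σ : (V (-d)).DualSection) :
    V.gen d σ = ∑ j : b.Index d, copyGen b P j.1 (((P d).proj j).sections σ) := by
  simp only [copyGen_index]
  rw [← map_sum]
  congr 1
  ext1 x
  have h : ∀ s : Finset (b.Index d),
      (∑ j ∈ s, ((P d).inj j).sections (((P d).proj j).sections σ)) x =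
      ∑ j ∈ s, ((P d).inj j).toFun x (((P d).proj j).toFun x (σ x)) := by
    classical
    intro s
    induction s using Finset.induction_on with
    | empty => rfl
    | insert j s hj ih =>
      rw [Finset.sum_insert hj, Finset.sum_insert hj, ← ih, ← DualMap.sections_apply,
        ← DualMap.sections_apply]
      rfl
  rw [h, (P d).sum_inj_proj]

-- Every index other than that of 1 has positive `deg`, so there are no copies of TM in these
-- degrees. This makes the induction on the degree start.
include b P in
theorem gen_eq_zero {d : ℤ} (hd : d ≤ 0) (σ : (V (-d)).DualSection) : V.gen d σ = 0 := by
  rw [gen_eq_sum b P]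
  refine Finset.sum_eq_zero fun j _ => absurd j.2.2 fun h => j.2.1 ?_
  rw [← b.deg_eq_zero]
  change ((b.deg j.1 : ℕ) : ℤ) = d at h
  omega

theorem proj_sections_inj_sections {d : ℤ} (i j : b.Index d)
    (α : (SmoothVB.tangent n M).DualSection) [Decidable (i = j)] :
    ((P d).proj i).sections (((P d).inj j).sections α) = if i = j then α else 0 := by
  ext1 x
  rw [DualMap.sections_apply, DualMap.sections_apply]
  split_ifs with h
  · rw [h, (P d).proj_inj_self]
  · rw [(P d).proj_inj_of_ne _ _ _ _ h]
    rfl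

variable [T2Space M] {m : ℕ} {N : Type v} [TopologicalSpace N]
  [ChartedSpace (EuclideanSpace ℝ (Fin m)) N] {W : GradedVB m N} {f : N → M}
  {φ : C^∞⟮𝓡 n, M; ℝ⟯ →ₐ[ℝ] W.functions.carrier} (hf : IsBase f φ)
  {Ψ Ψ' : GradedCommAlg.Hom V.functions W.functions}

include hf in
/-- Morphisms that agree on functions and on generators of degree less than `d` agree in degrees less
than `d`, if there are no generators of nonpositive degree. -/
theorem IsBase.eq_of_lt (hΨ : ∀ g, Ψ (V.fn g) = φ g) (hΨ' : ∀ g, Ψ' (V.fn g) = φ g)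
    (hz : ∀ e : ℤ, e ≤ 0 → ∀ σ, V.gen e σ = 0) {d : ℤ}
    (h : ∀ e < d, ∀ σ, Ψ (V.gen e σ) = Ψ' (V.gen e σ)) {e : ℤ} (he : e < d)
    {a : V.functions.carrier} (ha : a ∈ V.functions.gr e) : Ψ a = Ψ' a := by
  refine functions_ext fun y => ?_
  obtain ⟨t, ht, hst⟩ := exists_eventually_eq_monomials (homSection_of_mem_gr ha) (f y)
  have key : ∃ c : V.functions.carrier, (∀ x, V.evalFiber x c = t x) ∧ Ψ c = Ψ' c := by
    clear hst
    induction ht using Submodule.span_induction with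
    | zero => exact ⟨0, fun x => map_zero _, by rw [map_zero, map_zero]⟩
    | add s t _ _ hs ht =>
      obtain ⟨c, hc, h⟩ := hs
      obtain ⟨c', hc', h'⟩ := ht
      exact ⟨c + c', fun x => by rw [map_add, hc, hc']; rfl, by rw [map_add, map_add, h, h']⟩
    | smul r t _ ht =>
      obtain ⟨c, hc, h⟩ := ht
      exact ⟨r • c, fun x => by rw [map_smul, hc]; rfl, by rw [map_smul, map_smul, h]⟩
    | mem t ht =>
      obtain ⟨g, l, hl, rfl⟩ := ht
      refine ⟨V.fn g * (l.map fun σ => V.gen σ.1 σ.2).prod, fun x => ?_, ?_⟩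
      · rw [map_mul, map_list_prod, monomial, Pi.mul_apply, Pi.list_prod_apply, List.map_map,
          List.map_map]
        rfl
      · rw [map_mul, map_mul, hΨ, hΨ']
        congr 1
        -- If all factors are nonzero, their degrees are positive and add up to e, so each is at
        -- most e and hence less than d.
        by_cases h0 : ∃ σ ∈ l, V.gen σ.1 σ.2 = 0
        · obtain ⟨σ, hσ, h0⟩ := h0
          rw [List.prod_eq_zero (List.mem_map.2 ⟨σ, hσ, h0⟩), map_zero, map_zero]
        · push Not at h0
          have hpos : ∀ x ∈ l.map Sigma.fst, (0 : ℤ) ≤ x := by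
            intro x hx
            obtain ⟨σ, hσ, rfl⟩ := List.mem_map.1 hx
            by_contra hneg
            exact h0 σ hσ (hz _ (by omega) _)
          rw [map_list_prod, map_list_prod, List.map_map, List.map_map]
          congr 1
          refine List.map_congr_left fun σ hσ => h _ ?_ _
          exact (List.single_le_sum hpos _ (List.mem_map.2 ⟨σ, hσ, rfl⟩)).trans_lt (hl ▸ he)
  obtain ⟨c, hc, h⟩ := key
  have hac : ∀ᶠ x in 𝓝 (f y), V.evalFiber x a = V.evalFiber x c := hst.mono fun x hx =>
    hx.trans (hc x).symm
  have e1 := hf.evalFiber_congr (Ψ := Ψ.toAlgHom) hΨ hac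
  have e2 := hf.evalFiber_congr (Ψ := Ψ'.toAlgHom) hΨ' hac
  exact e1.trans ((congrArg (W.evalFiber y) h).trans e2.symm)

-- A section of order 2 is locally a sum of products α t with t of order 1, so its substitution is a
-- sum of products of two elements of the augmentation filtration. A coefficient of degree d in such
-- a product involves only coefficients of smaller degree.
include hf in
theorem IsBase.eq_on_coord_tautHom (hΨ : ∀ g, Ψ (V.fn g) = φ g) (hΨ' : ∀ g, Ψ' (V.fn g) = φ g) {d : ℕ}
    (h : ∀ e : ℤ, e < d → ∀ a ∈ V.functions.gr e, Ψ a = Ψ' a)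
    {s : (constTangent n M).smoothSections} (hs : s.1 ∈ locOrder n M 2) {i : b.idx}
    (hi : b.deg i ≤ d) :
    Ψ (b.coord i (tautHom b P s)) = Ψ' (b.coord i (tautHom b P s)) := by
  refine functions_ext fun y => ?_
  obtain ⟨t, ht, hst⟩ := hs (f y)
  have key : ∃ ht, Ψ (b.coord i (tautHom b P ⟨t, ht⟩)) = Ψ' (b.coord i (tautHom b P ⟨t, ht⟩)) := by
    clear hst
    rw [order_succ] at ht
    induction ht using Submodule.mul_induction_on' with
    | mem_mul_mem a ha t ht =>
      obtain ⟨α, rfl⟩ := ha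
      obtain ⟨h1, h2⟩ := tautHom_mem_fil_of_order b P 1 ht
      have hα : (constTangent n M).genSection 0 α ∈ (constTangent n M).smoothSections :=
        polySections_le_smoothSections _ (genSection_mem _ 0 α)
      refine ⟨mul_mem hα h1, ?_⟩
      have e := map_mul (tautHom b P) ⟨_, hα⟩ ⟨t, h1⟩
      rw [tautHom_gen] at e
      have h3 := b.eq_on_coord_mul h (tautForm_mem b P α) (tautHom_mem b P ⟨t, h1⟩)
        (tautForm_mem_fil b P α) h2 hi
      rw [← e] at h3
      exact h3
    | add s hs t ht h h' =>
      obtain ⟨hs, h⟩ := h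
      obtain ⟨ht, h'⟩ := h'
      refine ⟨add_mem hs ht, ?_⟩
      have e := map_add (tautHom b P) ⟨s, hs⟩ ⟨t, ht⟩
      have h2 : Ψ (b.coord i (tautHom b P ⟨s, hs⟩ + tautHom b P ⟨t, ht⟩)) =
          Ψ' (b.coord i (tautHom b P ⟨s, hs⟩ + tautHom b P ⟨t, ht⟩)) := by
        rw [map_add, map_add, map_add, h, h']
      rw [← e] at h2
      exact h2
  obtain ⟨ht', key⟩ := key
  have hac : ∀ᶠ x in 𝓝 (f y), V.evalFiber x (b.coord i (tautHom b P s)) =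
      V.evalFiber x (b.coord i (tautHom b P ⟨t, ht'⟩)) := by
    filter_upwards [hst.eventually_nhds] with x hx
    have e : evalTensor L V x (tautHom b P s) = evalTensor L V x (tautHom b P ⟨t, ht'⟩) := by
      rw [evalTensor_tautHom, evalTensor_tautHom]
      exact (tautData b P x).hom_congr hx
    have e' := congrArg (b.coord i) e
    rw [evalTensor, b.coord_mapRight, b.coord_mapRight] at e'
    exact e'
  have e1 := hf.evalFiber_congr (Ψ := Ψ.toAlgHom) hΨ hac
  have e2 := hf.evalFiber_congr (Ψ := Ψ'.toAlgHom) hΨ' hac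
  exact e1.trans ((congrArg (W.evalFiber y) key).trans e2.symm)

variable (conn : CovariantDerivative (𝓡 n) (EuclideanSpace ℝ (Fin n) →L[ℝ] ℝ)
      (fun x : M => TangentSpace (𝓡 n) x →L[ℝ] Bundle.Trivial M ℝ x))
  [CovariantDerivative.ContMDiffCovariantDerivative conn ∞]

theorem coord_oneTmulFn_of_ne {i : b.idx} (hi : i ≠ b.unit) (g : C^∞⟮𝓡 n, M; ℝ⟯) :
    b.coord i (oneTmulFn g : (L.tensor V.functions).carrier) = 0 := by
  rw [oneTmulFn_apply, b.coord_tmul, ← b.basis_unit, Module.Basis.repr_self,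
    Finsupp.single_eq_of_ne hi, zero_smul]

theorem coord_unit_oneTmulFn (g : C^∞⟮𝓡 n, M; ℝ⟯) :
    b.coord b.unit (oneTmulFn g : (L.tensor V.functions).carrier) = V.fn g := by
  rw [oneTmulFn_apply, b.coord_tmul, ← b.basis_unit, Module.Basis.repr_self,
    Finsupp.single_eq_same, one_smul]

/-- All terms of positive order lie in the augmentation filtration, so modulo it the Taylor
expansion is f itself. -/
theorem coord_unit_taylor (g : C^∞⟮𝓡 n, M; ℝ⟯) : b.coord b.unit (taylor conn b P g) = V.fn g := by
  obtain ⟨s, hs, h⟩ := exists_taylor_eq conn b P g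
  rw [h, map_add, map_add, coord_unit_oneTmulFn, coord_tautForm, copyGen_unit, LinearMap.zero_apply,
    tautHom_mem_fil b P hs b.unit (by rw [b.deg_unit]; norm_num), add_zero, add_zero]

include hf in
/-- The leading dependence of `(id ⊗ Ψ) ∘ taylor` on `Ψ`. -/
theorem IsBase.coord_taylor_sub (hΨ : ∀ g, Ψ (V.fn g) = φ g) (hΨ' : ∀ g, Ψ' (V.fn g) = φ g) {d : ℕ}
    (h : ∀ e : ℤ, e < d → ∀ σ, Ψ (V.gen e σ) = Ψ' (V.gen e σ)) {i : b.idx} (hi : b.deg i ≤ d)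
    (g : C^∞⟮𝓡 n, M; ℝ⟯) :
    Ψ (b.coord i (taylor conn b P g)) - Ψ' (b.coord i (taylor conn b P g)) =
      Ψ (copyGen b P i (differential g)) - Ψ' (copyGen b P i (differential g)) := by
  obtain ⟨s, hs, e⟩ := exists_taylor_eq conn b P g
  have h1 : Ψ (b.coord i (oneTmulFn g)) = Ψ' (b.coord i (oneTmulFn g)) := by
    by_cases hu : i = b.unit
    · rw [hu, coord_unit_oneTmulFn, hΨ, hΨ']
    · rw [coord_oneTmulFn_of_ne b hu, map_zero, map_zero]
  -- Terms of order at least 2 do not see the generators of degree d; only the linear term df does.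
  have h2 := hf.eq_on_coord_tautHom b P hΨ hΨ'
    (fun e he a ha => hf.eq_of_lt hΨ hΨ' (fun e he σ => gen_eq_zero b P he σ) h he ha) hs hi
  rw [e, map_add, map_add, map_add, map_add, map_add, map_add, h1, h2, coord_tautForm]
  abel

end GradedVB
end

/-! ### Universality of the Taylor expansion over split graded manifolds -/

noncomputable section

namespace GradedVB
open GradedCommAlg (tmul mapRight)
variable {n : ℕ} {M : Type u} [TopologicalSpace M] [ChartedSpace (EuclideanSpace ℝ (Fin n)) M]
  [IsManifold (𝓡 n) ∞ M] {L : GradedCommAlg.{0}} (b : WeilBasis L) {V : GradedVB n M}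
  (P : ∀ d : ℤ, CotangentPower (V (-d)) (b.Index d)) [T2Space M] {m : ℕ} {N : Type v}
  [TopologicalSpace N] [ChartedSpace (EuclideanSpace ℝ (Fin m)) N] {W : GradedVB m N} {f : N → M}
  {φ : C^∞⟮𝓡 n, M; ℝ⟯ →ₐ[ℝ] W.functions.carrier} (hf : IsBase f φ)
  {Ψ Ψ' : GradedCommAlg.Hom V.functions W.functions}

-- At every point of N this is the corresponding statement for a thickened evaluation.
include hf in
theorem IsBase.linear_ext {G G' : (SmoothVB.tangent n M).DualSection →ₗ[ℝ] W.functions.carrier}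
    (hG : ∀ g σ, G (SmoothVB.smulSection g σ) = φ g * G σ)
    (hG' : ∀ g σ, G' (SmoothVB.smulSection g σ) = φ g * G' σ)
    (h : ∀ g, G (differential g) = G' (differential g)) : G = G' := by
  ext α
  refine functions_ext fun y => ?_
  have e := (hf.isThickenedEval y).linear_ext (G := (W.evalFiber y).toLinearMap.comp G)
    (G' := (W.evalFiber y).toLinearMap.comp G')
    (fun g σ => (congrArg (W.evalFiber y) (hG g σ)).trans (map_mul _ _ _))
    (fun g σ => (congrArg (W.evalFiber y) (hG' g σ)).trans (map_mul _ _ _))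
    (fun g => congrArg (W.evalFiber y) (h g))
  exact LinearMap.congr_fun e α

variable (conn : CovariantDerivative (𝓡 n) (EuclideanSpace ℝ (Fin n) →L[ℝ] ℝ)
      (fun x : M => TangentSpace (𝓡 n) x →L[ℝ] Bundle.Trivial M ℝ x))
  [CovariantDerivative.ContMDiffCovariantDerivative conn ∞]

theorem hom_copyGen_smul (hΨ : ∀ g, Ψ (V.fn g) = φ g) (i : b.idx) (g : C^∞⟮𝓡 n, M; ℝ⟯)
    (σ : (SmoothVB.tangent n M).DualSection) :
    Ψ (copyGen b P i (SmoothVB.smulSection g σ)) = φ g * Ψ (copyGen b P i σ) := by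
  rw [copyGen_smul, map_mul, hΨ]

include hf in
/-- Morphisms are determined by their composition with the Taylor expansion. -/
theorem IsBase.eq_of_coord_taylor (hΨ : ∀ g, Ψ (V.fn g) = φ g) (hΨ' : ∀ g, Ψ' (V.fn g) = φ g)
    (h : ∀ i g, Ψ (b.coord i (taylor conn b P g)) = Ψ' (b.coord i (taylor conn b P g))) :
    Ψ = Ψ' := by
  -- Induction on the degree: once Ψ and Ψ' agree below degree d, their Taylor coefficients of
  -- degree d differ by the difference of their values on (dg)^{(i)}. Exact forms determine φ-linear
  -- maps on 1-forms.
  have key : ∀ d : ℕ, ∀ e : ℤ, e < d → ∀ σ, Ψ (V.gen e σ) = Ψ' (V.gen e σ) := by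
    intro d
    induction d with
    | zero =>
      intro e he σ
      rw [gen_eq_zero b P (by exact_mod_cast he.le), map_zero, map_zero]
    | succ d ih =>
      intro e he σ
      rcases lt_or_eq_of_le (show e ≤ d by push_cast at he; omega) with he | rfl
      · exact ih e he σ
      · rw [gen_eq_sum b P, map_sum, map_sum]
        refine Finset.sum_congr rfl fun j _ => ?_
        have hj : b.deg j.1 ≤ d := by
          have h2 : ((b.deg j.1 : ℕ) : ℤ) = d := j.2.2
          omega
        have e := hf.linear_ext (G := Ψ.toAlgHom.toLinearMap.comp (copyGen b P j.1))
          (G' := Ψ'.toAlgHom.toLinearMap.comp (copyGen b P j.1))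
          (hom_copyGen_smul b P hΨ j.1) (hom_copyGen_smul b P hΨ' j.1) fun g => by
            have h3 := hf.coord_taylor_sub b P conn hΨ hΨ' ih hj g
            rw [h, sub_self] at h3
            exact sub_eq_zero.1 h3.symm
        exact LinearMap.congr_fun e _
  exact hf.hom_ext hΨ hΨ' fun d σ => key (d.toNat + 1) d (by push_cast; omega) σ

include hf in
/-- Morphisms can be corrected in degree `d` by linear maps on the copies of the tangent bundle of
degree `d`. -/
theorem IsBase.exists_correction (hφ : ∀ g, φ g ∈ W.functions.gr 0) (hΨ : ∀ g, Ψ (V.fn g) = φ g)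
    {d : ℕ} (H : b.idx → (SmoothVB.tangent n M).DualSection →ₗ[ℝ] W.functions.carrier)
    (hHmem : ∀ i α, H i α ∈ W.functions.gr (b.deg i))
    (hH : ∀ i g σ, H i (SmoothVB.smulSection g σ) = φ g * H i σ)
    (hHd : ∀ i, b.deg i ≠ d → H i = 0) (hu : H b.unit = 0) :
    ∃ Ψ' : GradedCommAlg.Hom V.functions W.functions, (∀ g, Ψ' (V.fn g) = φ g) ∧
      ∀ i, b.deg i ≤ d → ∀ g, Ψ' (b.coord i (taylor conn b P g)) =
        Ψ (b.coord i (taylor conn b P g)) + H i (differential g) := by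
  classical
  -- The new morphism keeps Ψ on functions and adds H i to its values on the i-th copy. As H i = 0
  -- unless `deg i` = d, only generators of degree d are affected.
  obtain ⟨Ψ', hΨ', hgen⟩ := hf.exists_hom hφ
    (fun e => Ψ.toAlgHom.toLinearMap.comp (V.gen e) +
      ∑ j : b.Index e, (H j.1).comp ((P e).proj j).sections)
    (fun e σ => by
      rw [LinearMap.add_apply, LinearMap.sum_apply]
      refine add_mem (Ψ.map_mem (gen_mem e σ)) (sum_mem fun j _ => ?_)
      have h := hHmem j.1 (((P e).proj j).sections σ)
      rw [j.2.2] at h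
      exact h)
    (fun e g σ => by
      rw [LinearMap.add_apply, LinearMap.sum_apply, LinearMap.add_apply, LinearMap.sum_apply, mul_add,
        Finset.mul_sum]
      congr 1
      · change Ψ (V.gen e _) = φ g * Ψ (V.gen e σ)
        rw [gen_smul, map_mul, hΨ]
      · refine Finset.sum_congr rfl fun j _ => ?_
        rw [LinearMap.comp_apply, DualMap.sections_smulSection, hH]
        rfl)
  have hgen' : ∀ e σ, Ψ' (V.gen e σ) =
      Ψ (V.gen e σ) + ∑ j : b.Index e, H j.1 (((P e).proj j).sections σ) := fun e σ => by
    rw [hgen, LinearMap.add_apply, LinearMap.sum_apply]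
    rfl
  refine ⟨Ψ', hΨ', fun i hi g => ?_⟩
  have hlt : ∀ e : ℤ, e < d → ∀ σ, Ψ' (V.gen e σ) = Ψ (V.gen e σ) := fun e he σ => by
    rw [hgen', Finset.sum_eq_zero, add_zero]
    intro j _
    rw [hHd, LinearMap.zero_apply]
    intro h
    have h2 : ((b.deg j.1 : ℕ) : ℤ) = e := j.2.2
    omega
  have h1 := hf.coord_taylor_sub b P conn hΨ' hΨ hlt hi g
  have h2 : Ψ' (copyGen b P i (differential g)) =
      Ψ (copyGen b P i (differential g)) + H i (differential g) := by
    by_cases hi : i = b.unit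
    · rw [hi, copyGen_unit, hu, LinearMap.zero_apply, LinearMap.zero_apply, map_zero, map_zero,
        add_zero]
    · rw [copyGen_of_ne b P hi, hgen', Finset.sum_eq_single ⟨i, hi, rfl⟩]
      · rw [proj_sections_inj_sections, if_pos rfl]
      · intro j _ hj
        rw [proj_sections_inj_sections, if_neg hj, map_zero]
      · intro h
        exact absurd (Finset.mem_univ _) h
  rw [h2, add_sub_cancel_left] at h1
  exact eq_add_of_sub_eq' h1

-- Induction on d: the discrepancy in degree d + 1 is a derivation along φ, because in products of
-- lowest order both Φ and the Taylor expansion act through φ. It factors through the differential,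
-- and the resulting linear maps correct Ψ.
include hf in
theorem IsBase.exists_hom_coord_taylor
    {Φ : C^∞⟮𝓡 n, M; ℝ⟯ →ₐ[ℝ] (L.tensor W.functions).carrier}
    (hΦ : ∀ g, Φ g ∈ (L.tensor W.functions).gr 0) (hΦφ : ∀ g, b.coord b.unit (Φ g) = φ g) (d : ℕ) :
    ∃ Ψ : GradedCommAlg.Hom V.functions W.functions, (∀ g, Ψ (V.fn g) = φ g) ∧
      ∀ i, b.deg i ≤ d → ∀ g, Ψ (b.coord i (taylor conn b P g)) = b.coord i (Φ g) := by
  have hφ : ∀ g, φ g ∈ W.functions.gr 0 := fun g => by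
    rw [← hΦφ]; exact b.coord_unit_mem (hΦ g)
  induction d with
  | zero =>
    -- In degree 0 only the coefficient of 1 is prescribed, so Ψ may kill all generators.
    obtain ⟨Ψ, hΨ, -⟩ := hf.exists_hom (V := V) hφ (fun _ => 0) (fun _ _ => zero_mem _)
      (fun _ _ _ => (mul_zero _).symm)
    refine ⟨Ψ, hΨ, fun i hi g => ?_⟩
    rw [(b.deg_eq_zero i).1 (by omega), coord_unit_taylor, hΨ, hΦφ]
  | succ d ih =>
    obtain ⟨Ψ, hΨ, hd⟩ := ih
    let E : C^∞⟮𝓡 n, M; ℝ⟯ →ₗ[ℝ] (L.tensor W.functions).carrier :=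
      Φ.toLinearMap - (mapRight L Ψ).toAlgHom.toLinearMap.comp (taylor conn b P).toLinearMap
    have hE : ∀ g, E g = Φ g - mapRight L Ψ (taylor conn b P g) := fun _ => rfl
    have hcoord : ∀ i g, b.coord i (E g) =
        b.coord i (Φ g) - Ψ (b.coord i (taylor conn b P g)) := fun i g => by
      rw [hE, map_sub, b.coord_mapRight]
    have hE0 : ∀ g, E g ∈ (L.tensor W.functions).gr 0 := fun g =>
      sub_mem (hΦ g) ((mapRight L Ψ).map_mem (taylor_mem conn b P g))
    have hEfil : ∀ g, E g ∈ b.fil W.functions (d + 1) := fun g i hi => by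
      rw [hcoord, hd i (by omega), sub_self]
    have hEmul : ∀ g h i, b.deg i ≤ d + 1 →
        b.coord i (E (g * h)) = φ g * b.coord i (E h) + φ h * b.coord i (E g) := by
      intro g h i hi
      -- The difference of two algebra morphisms is a twisted derivation; elements of degree 0 are
      -- central, so the factor can be moved to the left.
      have e : E (g * h) = Φ g * E h + mapRight L Ψ (taylor conn b P h) * E g := by
        have hc : mapRight L Ψ (taylor conn b P h) * E g = E g * mapRight L Ψ (taylor conn b P h) :=
          (GradedCommAlg.commute_of_mem_zero _
            ((mapRight L Ψ).map_mem (taylor_mem conn b P h)) (E g)).eq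
        rw [hc, hE, hE, hE, map_mul, map_mul, map_mul]
        noncomm_ring
      -- Replacing Φ g by 1 ⊗ φ(g) costs an element of order 1; multiplied by E h, of order d + 1,
      -- it is invisible up to `deg` d + 1.
      have h1 : b.coord i ((Φ g - tmul L W.functions 1 (φ g)) * E h) = 0 := by
        have hm := b.sub_unit_mem_fil (Φ g)
        rw [hΦφ] at hm
        exact b.mul_mem_fil hm (hEfil h) i (by omega)
      have h2 : b.coord i ((mapRight L Ψ (taylor conn b P h) - tmul L W.functions 1 (φ h)) * E g) =
          0 := by
        have hm := b.sub_unit_mem_fil (mapRight L Ψ (taylor conn b P h))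
        rw [b.coord_mapRight, coord_unit_taylor, hΨ] at hm
        exact b.mul_mem_fil hm (hEfil g) i (by omega)
      rw [sub_mul, map_sub, b.coord_one_tmul_mul (hφ _), sub_eq_zero] at h1 h2
      rw [e, map_add, h1, h2]
    have hH : ∀ i, ∃ H : (SmoothVB.tangent n M).DualSection →ₗ[ℝ] W.functions.carrier,
        (∀ α, H α ∈ W.functions.gr (b.deg i)) ∧
        (∀ g σ, H (SmoothVB.smulSection g σ) = φ g * H σ) ∧ (b.deg i ≠ d + 1 → H = 0) ∧
        (b.deg i = d + 1 → ∀ g, H (differential g) = b.coord i (E g)) := by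
      intro i
      by_cases hi : b.deg i = d + 1
      · obtain ⟨H, h1, h2, h3⟩ := hf.exists_linear_of_derivation (d := b.deg i)
          (δ := (b.coord i).comp E)
          (fun g => by have := b.coord_mem (hE0 g) i; rwa [zero_add] at this) hφ
          (fun g h => hEmul g h i hi.le)
        exact ⟨H, h1, h2, fun h => absurd hi h, fun _ => h3⟩
      · exact ⟨0, fun _ => zero_mem _, fun _ _ => (mul_zero _).symm, fun _ => rfl, fun h => absurd h hi⟩
    choose H h1 h2 h3 h4 using hH
    obtain ⟨Ψ', hΨ', h⟩ := hf.exists_correction b P conn hφ hΨ (d := d + 1) H h1 h2 h3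
      (h3 _ (by rw [b.deg_unit]; omega))
    refine ⟨Ψ', hΨ', fun i hi g => ?_⟩
    rw [h i hi]
    by_cases hi' : b.deg i = d + 1
    · rw [h4 i hi', hcoord, add_sub_cancel]
    · rw [h3 i hi', LinearMap.zero_apply, add_zero, hd i (by omega)]

/-- The Taylor expansion as a morphism of graded algebras. -/
def taylorHom : GradedCommAlg.Hom (GradedCommAlg.ofManifold n M) (L.tensor V.functions) :=
  { taylor conn b P with
    map_mem := fun {d g} hg => by
      by_cases hd : d = 0
      · subst hd
        exact taylor_mem conn b P g
      · have h0 : g = 0 := (GradedCommAlg.mem_zeroGr (A := C^∞⟮𝓡 n, M; ℝ⟯)).1 hg hd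
        rw [h0]
        change taylor conn b P 0 ∈ _
        rw [map_zero]
        exact zero_mem _ }

/-- The Taylor expansion is universal. -/
theorem existsUnique_comp_taylorHom [SecondCountableTopology M]
    (Φ : GradedCommAlg.Hom (GradedCommAlg.ofManifold n M) (L.tensor W.functions)) :
    ∃! Ψ : GradedCommAlg.Hom V.functions W.functions,
      (mapRight L Ψ).comp (taylorHom b P conn) = Φ := by
  have hΦ : ∀ g, Φ g ∈ (L.tensor W.functions).gr 0 := fun g =>
    Φ.map_mem ((GradedCommAlg.mem_zeroGr (A := C^∞⟮𝓡 n, M; ℝ⟯)).2 fun h => absurd rfl h)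
  -- The coefficient of 1 is an algebra morphism, since the augmentation ideal of L is discarded.
  -- Any solution Ψ must restrict to it on functions.
  let φ : C^∞⟮𝓡 n, M; ℝ⟯ →ₐ[ℝ] W.functions.carrier := AlgHom.ofLinearMap
    ((b.coord b.unit).comp Φ.toAlgHom.toLinearMap)
    (by
      change b.coord b.unit (Φ 1) = 1
      rw [map_one, ← GradedCommAlg.tmul_one_one, b.coord_tmul, ← b.basis_unit,
        Module.Basis.repr_self, Finsupp.single_eq_same, one_smul])
    (fun g h => by
      exact (congrArg (b.coord b.unit) (map_mul Φ (g : (GradedCommAlg.ofManifold n M).carrier) h)).trans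
        (b.coord_unit_mul (hΦ g)))
  obtain ⟨f, hf⟩ := exists_isBase φ
  have hcomp : ∀ Ψ : GradedCommAlg.Hom V.functions W.functions,
      (mapRight L Ψ).comp (taylorHom b P conn) = Φ →
      ∀ i (g : C^∞⟮𝓡 n, M; ℝ⟯), Ψ (b.coord i (taylor conn b P g)) = b.coord i (Φ g) := by
    intro Ψ h i g
    rw [← b.coord_mapRight]
    exact congrArg (b.coord i) (DFunLike.congr_fun h g)
  have hfn : ∀ Ψ : GradedCommAlg.Hom V.functions W.functions,
      (mapRight L Ψ).comp (taylorHom b P conn) = Φ → ∀ g, Ψ (V.fn g) = φ g := by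
    intro Ψ h g
    rw [← coord_unit_taylor b P conn g]
    exact hcomp Ψ h b.unit g
  -- Every basis element has `deg` below `bound`, so agreement up to `bound` is agreement
  -- everywhere.
  obtain ⟨Ψ, hΨ, h⟩ := hf.exists_hom_coord_taylor (V := V) b P conn (Φ := Φ.toAlgHom) hΦ
    (fun _ => rfl) b.bound
  refine ⟨Ψ, ?_, fun Ψ' h' => ?_⟩
  · refine DFunLike.ext _ _ fun g => b.ext_coord fun i => ?_
    refine Eq.trans ?_ (h i (b.deg_lt_bound i).le g)
    exact b.coord_mapRight Ψ i _
  · refine hf.eq_of_coord_taylor b P conn (hfn Ψ' h') hΨ fun i g => ?_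
    rw [hcomp Ψ' h']
    exact (h i (b.deg_lt_bound i).le g).symm

end GradedVB
end

/-! ### Representability on all graded manifolds -/

noncomputable section

namespace ZManifold
open GradedCommAlg (mapRight)
variable {n : ℕ} {M : Type u} [TopologicalSpace M] [ChartedSpace (EuclideanSpace ℝ (Fin n)) M]
  [IsManifold (𝓡 n) ∞ M] [T2Space M] [SecondCountableTopology M]
  (conn : CovariantDerivative (𝓡 n) (EuclideanSpace ℝ (Fin n) →L[ℝ] ℝ)
      (fun x : M => TangentSpace (𝓡 n) x →L[ℝ] Bundle.Trivial M ℝ x))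
  [CovariantDerivative.ContMDiffCovariantDerivative conn ∞]
  {L : GradedCommAlg.{0}} (b : WeilBasis L) {V : GradedVB n M}
  (P : ∀ d : ℤ, CotangentPower (V (-d)) (b.Index d))

/-- A graded manifold is only isomorphic to a split one. Existence and uniqueness are carried across
such an isomorphism by functoriality of id ⊗ -. -/
theorem existsUnique_comp_taylorHom (T : ZManifold.{u})
    (Φ : GradedCommAlg.Hom (GradedCommAlg.ofManifold n M) (L.tensor T.alg)) :
    ∃! Ψ : GradedCommAlg.Hom V.functions T.alg,
      (mapRight L Ψ).comp (GradedVB.taylorHom b P conn) = Φ := by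
  obtain ⟨m, N, _, _, _, _, _, W, e, he⟩ := T.isSplit
  let E : GradedCommAlg.Hom T.alg W.functions :=
    { e.toAlgHom with map_mem := fun {d a} ha => (he d a).1 ha }
  let E' : GradedCommAlg.Hom W.functions T.alg :=
    { e.symm.toAlgHom with
      map_mem := fun {d a} ha => (he d (e.symm a)).2 (by rwa [AlgEquiv.apply_symm_apply]) }
  have h1 : E'.comp E = GradedAlgHom.id ℝ T.alg.gr := DFunLike.ext _ _ fun a => e.symm_apply_apply a
  have h2 : E.comp E' = GradedAlgHom.id ℝ W.functions.gr :=
    DFunLike.ext _ _ fun a => e.apply_symm_apply a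
  have hmap : ∀ {A B C : GradedCommAlg.{u}} (F : GradedCommAlg.Hom A B) (F' : GradedCommAlg.Hom B C)
      (U : GradedCommAlg.Hom (GradedCommAlg.ofManifold n M) (L.tensor A)),
      (mapRight L (F'.comp F)).comp U = (mapRight L F').comp ((mapRight L F).comp U) := by
    intro A B C F F' U
    rw [mapRight, GradedTensor.map_comp]
    rfl
  have hid : ∀ {A : GradedCommAlg.{u}}
      (U : GradedCommAlg.Hom (GradedCommAlg.ofManifold n M) (L.tensor A)),
      (mapRight L (GradedAlgHom.id ℝ A.gr)).comp U = U := by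
    intro A U
    rw [mapRight, GradedTensor.map_id]
    rfl
  obtain ⟨Ψ, hΨ, huniq⟩ := GradedVB.existsUnique_comp_taylorHom b P conn ((mapRight L E).comp Φ)
  refine ⟨E'.comp Ψ, ?_, fun Ψ' hΨ' => ?_⟩
  · change (mapRight L (E'.comp Ψ)).comp _ = Φ
    rw [hmap, hΨ, ← hmap, h1, hid]
  · have h3 := huniq (E.comp Ψ') (by
      change (mapRight L (E.comp Ψ')).comp _ = _
      rw [hmap, hΨ'])
    rw [← h3]
    change Ψ' = (E'.comp E).comp Ψ'
    rw [h1]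
    rfl

/-- The presheaf `Hom(D^{×k}, M)` is represented by a split graded manifold whose duals are copies of
the cotangent bundle indexed by a basis of `C(D^{×k})`. -/
def representableBy :
    (homPresheaf L (GradedCommAlg.ofManifold n M)).RepresentableBy (split V) where
  homEquiv {T} := Equiv.ofBijective
    (fun Ψ : GradedCommAlg.Hom V.functions T.alg =>
      ((mapRight L Ψ).comp (GradedVB.taylorHom b P conn) :
        GradedCommAlg.Hom (GradedCommAlg.ofManifold n M) (L.tensor T.alg)))
    (Function.bijective_iff_existsUnique _ |>.2 (existsUnique_comp_taylorHom conn b P T))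
  homEquiv_comp {T T'} F G := by
    change (GradedTensor.map (GradedAlgHom.comp F G)).comp (GradedVB.taylorHom b P conn) =
      (GradedTensor.map F).comp ((GradedTensor.map G).comp (GradedVB.taylorHom b P conn))
    rw [GradedTensor.map_comp]
    rfl

end ZManifold

theorem mainTheorem5 (n : ℕ) (M : Type u) [TopologicalSpace M]
    [ChartedSpace (EuclideanSpace ℝ (Fin n)) M] [IsManifold (𝓡 n) ∞ M] [T2Space M]
    [SecondCountableTopology M]
    (conn : CovariantDerivative (𝓡 n) (EuclideanSpace ℝ (Fin n) →L[ℝ] ℝ)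
      (fun x : M => TangentSpace (𝓡 n) x →L[ℝ] Bundle.Trivial M ℝ x))
    [CovariantDerivative.ContMDiffCovariantDerivative conn ∞] (k : ℕ) :
    (ZManifold.homPresheaf (GradedCommAlg.Dpow k) (GradedCommAlg.ofManifold n M)).IsRepresentable ∧
    Nonempty (ZManifold.homPresheaf (GradedCommAlg.Dpow k) (GradedCommAlg.ofManifold n M) ≅
      yoneda.obj (ZManifold.split (GradedVB.iteratedTangent n M k))) := by
  have R := ZManifold.representableBy conn (WeilBasis.Dpow k) (GradedVB.cotangentPower n M k)
  exact ⟨R.isRepresentable, ⟨R.toIso.symm⟩⟩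
end
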